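/- **Corollary 3.6.** Throughout, for a probability measure $\mu$ on $\mathbb{R}_+=[0,\infty)$ let $\psi_\mu(u)=-\log\int_{[0,\infty)}e^{-ux}\,\mu(dx)$, $u>0$, be its Laplace exponent. A function $k:(0,\infty)\to[0,\infty)$ is *completely monotone* if it is $C^\infty$ and $(-1)^nk^{(n)}\ge 0$ for all $n\ge 0$. A function $f$ on $(0,\infty)$ is a *complete Bernstein function* (CBF; without constant term) if $$f(u)=au+\int_{(0,\infty)}(1-e^{-ut})\,m(t)\,dt,\qquad u>0,$$ for some $a\ge 0$ and some completely monotone $m$ with $\int_{(0,\infty)}\min(1,t)\,m(t)\,dt<\infty$. *Bondesson's class* $\mathrm{BO}$ is the set of probability measures on $\mathbb{R}_+$ whose Laplace exponent is a CBF. *Thorin's class* $\mathrm{T}$ (the generalized gamma convolutions) is the set of probability measures $\mu$ on $\mathbb{R}_+$ with $$\psi_\mu(u)=au+\int_{(0,\infty)}(1-e^{-ut})\,\frac{k(t)}{t}\,dt,\qquad u>0,$$ for some $a\ge 0$ and some completely monotone $k$ with $\int_{(0,\infty)}\min(1,t)\,\frac{k(t)}{t}\,dt<\infty$. A probability measure $\mu$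 is *selfdecomposable* if for every $c\in(0,1)$ it is the law of $cX'+Y_c$ for some independent random variables $X',Y_c$ with $X'\sim\mu$. A *subordinator* is a real-valued Lévy process $(X_t)_{t\ge 0}$ with almost surely nondecreasing paths. Let $\mu$ be a selfdecomposable probability measure on $\mathbb{R}_+$. Then the following statements are equivalent. 1. $\mu\in\mathrm{T}$. 2. $u\mapsto\psi_\mu(u)-\psi_\mu(cu)$ is a CBF for all $c\in(0,1)$. 3. $u\mapsto\psi_\mu(cu)-\psi_\mu(u)$ is a CBF for all $c>1$. 4. $u\mapsto u\,\psi_\mu'(u)$ is a CBF. 5. $\mu$ is the law of the almost surely convergent pathwise Lebesgue–Stieltjes integral $\int_{(0,\infty)}e^{-t}\,dX_t$ for some subordinator $(X_t)_{t\ge0}$ with $\mathbb{E}[\log^+(X_1)]<\infty$ and $\mathcal{L}(X_1)\in\mathrm{BO}$. -/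

import Mathlib

open MeasureTheory ProbabilityTheory Set
open scoped NNReal

noncomputable section

/-- A probability distribution on `ℝ₊ = [0, ∞)`, regarded as a measure on `ℝ`. -/
structure IsProbOnNonneg (μ : Measure ℝ) : Prop where
  isProbabilityMeasure : IsProbabilityMeasure μ
  measure_Iio_zero : μ (Iio 0) = 0

/-- Selfdecomposability: for every `c ∈ (0,1)` the law `μ` of `X` is the law of `c X' + Y` with
`X'` distributed as `X` and `Y` a random variable (with law `ρ`) independent of `X'`. -/
def IsSelfdecomposable (μ : Measure ℝ) : Prop :=
  ∀ c ∈ Ioo (0 : ℝ) 1, ∃ ρ : Measure ℝ, IsProbabilityMeasure ρ ∧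
    μ = Measure.conv (μ.map (fun x => c * x)) ρ

/-- The Laplace exponent `ψ_μ(u) = -log ∫ e^{-ux} μ(dx)` (used for `u > 0`, `μ` on `ℝ₊`). -/
def laplaceExponent (μ : Measure ℝ) (u : ℝ) : ℝ :=
  -Real.log (∫ x, Real.exp (-u * x) ∂μ)

/-- Complete monotonicity on `(0, ∞)`. -/
def IsCompletelyMonotone (k : ℝ → ℝ) : Prop :=
  ContDiffOn ℝ (⊤ : ℕ∞) k (Ioi 0) ∧
    ∀ n : ℕ, ∀ t : ℝ, 0 < t → 0 ≤ (-1 : ℝ) ^ n * iteratedDeriv n k t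

/-- On `(0, ∞)`, the function `f` is the Bernstein function (without constant term)
`f(u) = a u + ∫_{(0,∞)} (1 - e^{-ut}) m(t) dt`, where `a ≥ 0` and `m ≥ 0` is a Lévy density,
that is, `∫_{(0,∞)} min(1,t) m(t) dt < ∞`. -/
structure HasBernsteinRep (f : ℝ → ℝ) (a : ℝ) (m : ℝ → ℝ) : Prop where
  drift_nonneg : 0 ≤ a
  density_nonneg : ∀ t, 0 < t → 0 ≤ m t
  integrable : IntegrableOn (fun t => min 1 t * m t) (Ioi 0)
  eq : ∀ u, 0 < u → f u = a * u + ∫ t in Ioi (0 : ℝ), (1 - Real.exp (-u * t)) * m t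

/-- Complete Bernstein functions (vanishing at `0`): Bernstein functions on `(0, ∞)` whose Lévy
measure has a completely monotone density. -/
def IsCompleteBernstein (f : ℝ → ℝ) : Prop :=
  ∃ (a : ℝ) (m : ℝ → ℝ), IsCompletelyMonotone m ∧ HasBernsteinRep f a m

/-- Bondesson's class `BO`. -/
def IsBondesson (μ : Measure ℝ) : Prop :=
  IsProbOnNonneg μ ∧ IsCompleteBernstein (laplaceExponent μ)

/-- Thorin's class `T` (generalized gamma convolutions): the Lévy measure has a density of the
form `k(t)/t` with `k` completely monotone. -/
def IsThorin (μ : Measure ℝ) : Prop :=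
  IsProbOnNonneg μ ∧ ∃ (a : ℝ) (k : ℝ → ℝ),
    IsCompletelyMonotone k ∧ HasBernsteinRep (laplaceExponent μ) a (fun t => k t / t)

/-- A subordinator: a real-valued Lévy process with almost surely nondecreasing (hence, being
right-continuous, càdlàg) paths. Continuity in probability is a consequence of stationarity of the
increments and right-continuity. -/
structure IsSubordinator {Ω : Type*} [MeasurableSpace Ω] (X : ℝ≥0 → Ω → ℝ) (P : Measure Ω) :
    Prop where
  measurable : ∀ t, Measurable (X t)
  zero : ∀ᵐ ω ∂P, X 0 ω = 0
  indep : HasIndepIncrements X P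
  stationary : ∀ s t : ℝ≥0, P.map (fun ω => X (s + t) ω - X s ω) = P.map (X t)
  mono : ∀ᵐ ω ∂P, Monotone (fun t => X t ω)
  right_continuous : ∀ᵐ ω ∂P, ∀ t, ContinuousWithinAt (fun s => X s ω) (Ici t) t

open Classical in
/-- The Lebesgue-Stieltjes measure `dx` of a nondecreasing right-continuous path
`x : [0, ∞) → ℝ` (extended to the left of `0` by the constant `x 0`); junk value `0` if `x` is
not nondecreasing. -/
def pathMeasure (x : ℝ≥0 → ℝ) : Measure ℝ :=
  if h : Monotone x then (h.comp (fun _ _ hab => Real.toNNReal_mono hab)).stieltjesFunction.measure else 0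

/-- `μ` is the law of the (almost surely convergent, pathwise Lebesgue-Stieltjes) integral
`∫_{(0,∞)} e^{-t} dX_t`. -/
def IsLawOfExpIntegral {Ω : Type*} [MeasurableSpace Ω] (μ : Measure ℝ) (X : ℝ≥0 → Ω → ℝ)
    (P : Measure Ω) : Prop :=
  (∀ᵐ ω ∂P, IntegrableOn (fun t : ℝ => Real.exp (-t)) (Ioi 0) (pathMeasure fun t => X t ω)) ∧
    HasLaw (fun ω => ∫ t in Ioi (0 : ℝ), Real.exp (-t) ∂(pathMeasure fun t => X t ω)) μ P

end

/-!
Let `ψ` be the Laplace exponent of `μ`. Thorin's class serves as the hub for the analytic conditions,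
and the function `u ψ'(u)` as the link to exponential integrals.

*Thorin's class and `u ψ'(u)`.* By Tonelli's theorem, dividing a Bernstein function with Lévy density
`m` by `u` and integrating over `(0, U)` gives a Bernstein function of `U` whose Lévy density at `s` is
`s⁻¹ ∫_s^∞ m` (`HasBernsteinRep.lintegral_div`). If `μ` is in Thorin's class with density `k(t)/t`,
then `k` decreases to `0`, so that `k` is the tail integral of the completely monotone function
`-k'`, and `u ψ'(u)` has Lévy density `-k'`
(`IsThorin.isCompleteBernstein_mul_deriv`). Conversely, if `u ψ'(u)` has Lévy density `m`, then `k` is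
the tail integral of `m`, which is again completely monotone
(`isThorin_of_isCompleteBernstein_mul_deriv`).

*Thorin's class and differences.* The Lévy density of `ψ(u) - ψ(cu)` is `(k(t) - k(t/c))/t`, the integral
over `b` in `[1, 1/c]` of the completely monotone functions `-k'(bt)` (`IsThorin.isCompleteBernstein_sub`).
Conversely, telescoping over the scales `2^{-i}` shows that `ψ` itself is a complete Bernstein
function, with density `n`, say. By uniqueness of the Lévy density
(`HasBernsteinRep.density_unique`) the differences `t n(t) - bt n(bt)`, divided by `t`, are completely
monotone for all `b > 1`; dividing by `b - 1` and letting `b` decrease to `1`, so is minus the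
derivative of `k(t) = t n(t)`, whence `k` is completely monotone
(`IsCompletelyMonotone.id_mul`, `isThorin_of_isCompleteBernstein_sub`). The formulations with
`c < 1` and with `c > 1` differ by a scaling of the argument.

*Exponential integrals.* If `X` is a subordinator and `φ` is the Laplace exponent of `X 1`, Riemann sums
over grids show that `∫_{(0,n]} e^{-t} dX_t` has Laplace exponent `∫_0^n φ(u e^{-t}) dt`, which is
`Φ(u) - Φ(u e^{-n})` for any antiderivative `Φ` of `φ(v)/v`
(`IsSubordinator.integral_exp_neg_integral_Ioc`). Hence, if `μ` is the law of the integral over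
`(0, ∞)`, then `ψ' = Φ'`, that is, `u ψ'(u) = φ(u)`
(`IsLawOfExpIntegral.mul_deriv_laplaceExponent`). Conversely, let `u ψ'(u)` be a complete Bernstein
function. It is the Laplace exponent of a subordinator, which is built from countably many
independent finite clouds of points that together have the intensity (Lebesgue measure) ⊗ (Lévy
measure) (`exists_isSubordinator`). One may take `Φ = ψ`, which vanishes at `0`; this gives both the
almost sure convergence of the exponential integral and its law
(`IsSubordinator.isLawOfExpIntegral`). The logarithmic moment is finite because
`∫_0^1 φ(v)/v dv = ψ(1)` (`IsProbOnNonneg.integrable_posLog`).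
-/

open Filter Topology

/-! ### Completely monotone functions -/

/-- A sequence of functions, each being the derivative of the preceding one on `(0, ∞)`,
lists the iterated derivatives of its first member. -/
theorem contDiffOn_and_iteratedDeriv_of_hasDerivAt {F : ℕ → ℝ → ℝ}
    (hF : ∀ j t, 0 < t → HasDerivAt (F j) (F (j + 1) t) t) :
    ContDiffOn ℝ (⊤ : ℕ∞) (F 0) (Ioi 0) ∧
      ∀ j t, 0 < t → iteratedDeriv j (F 0) t = F j t := by
  have hiter : ∀ n i t, 0 < t → iteratedDeriv n (F i) t = F (i + n) t := by
    intro n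
    induction n with
    | zero => intro i t _; simp
    | succ n ih =>
      intro i t ht
      rw [iteratedDeriv_succ]
      have h1 : iteratedDeriv n (F i) =ᶠ[𝓝 t] F (i + n) := by
        filter_upwards [Ioi_mem_nhds ht] with x hx using ih i x hx
      rw [h1.deriv_eq]
      exact (hF (i + n) t ht).deriv
  have hcd : ∀ n : ℕ, ∀ i, ContDiffOn ℝ n (F i) (Ioi 0) := by
    intro n
    induction n with
    | zero =>
      intro i
      simp only [Nat.cast_zero, contDiffOn_zero]
      exact fun t ht => (hF i t ht).continuousAt.continuousWithinAt
    | succ n ih =>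
      intro i
      have : ((n + 1 : ℕ) : WithTop ℕ∞) = (n : WithTop ℕ∞) + 1 := by push_cast; rfl
      rw [this, contDiffOn_succ_iff_deriv_of_isOpen isOpen_Ioi]
      refine ⟨fun t ht => (hF i t ht).differentiableAt.differentiableWithinAt, by simp, ?_⟩
      exact (ih (i + 1)).congr fun t ht => (hF i t ht).deriv
  refine ⟨contDiffOn_infty.2 fun n => hcd n 0, fun j t ht => by simpa using hiter j 0 t ht⟩

/-- `F 0, F 1, F 2, …` are the functions `f, -f', f'', …` on `(0, ∞)`, and they are all
nonnegative there. -/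
structure IsMonotoneTower (F : ℕ → ℝ → ℝ) : Prop where
  hasDerivAt : ∀ j t, 0 < t → HasDerivAt (F j) (-F (j + 1) t) t
  nonneg : ∀ j t, 0 < t → 0 ≤ F j t

theorem IsMonotoneTower.iteratedDeriv_eq {F : ℕ → ℝ → ℝ} (hF : IsMonotoneTower F) (j : ℕ) {t : ℝ}
    (ht : 0 < t) : (-1) ^ j * iteratedDeriv j (F 0) t = F j t := by
  have h := contDiffOn_and_iteratedDeriv_of_hasDerivAt (F := fun j t => (-1) ^ j * F j t)
    (fun j t ht => by
      have := (hF.hasDerivAt j t ht).const_mul ((-1) ^ j)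
      convert! this using 1
      ring)
  have h2 := h.2 j t ht
  simp only [pow_zero, one_mul] at h2
  rw [h2, ← mul_assoc, ← mul_pow]
  simp

theorem IsMonotoneTower.isCompletelyMonotone {F : ℕ → ℝ → ℝ} (hF : IsMonotoneTower F) :
    IsCompletelyMonotone (F 0) := by
  have h := contDiffOn_and_iteratedDeriv_of_hasDerivAt (F := fun j t => (-1) ^ j * F j t)
    (fun j t ht => by
      have := (hF.hasDerivAt j t ht).const_mul ((-1) ^ j)
      convert! this using 1
      ring)
  refine ⟨by simpa using h.1, fun n t ht => ?_⟩
  rw [hF.iteratedDeriv_eq n ht]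
  exact hF.nonneg n t ht

theorem IsCompletelyMonotone.isMonotoneTower {f : ℝ → ℝ} (hf : IsCompletelyMonotone f) :
    IsMonotoneTower (fun j t => (-1) ^ j * iteratedDeriv j f t) := by
  refine ⟨fun j t ht => ?_, fun j t ht => hf.2 j t ht⟩
  have hd : DifferentiableAt ℝ (iteratedDeriv j f) t := by
    have h1 := hf.1.differentiableOn_iteratedDerivWithin (m := j)
      (by exact_mod_cast WithTop.coe_lt_top _) (uniqueDiffOn_Ioi 0)
    refine ((h1.congr fun x hx => ?_).differentiableAt (Ioi_mem_nhds ht))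
    exact (iteratedDerivWithin_of_isOpen isOpen_Ioi hx).symm
  have := hd.hasDerivAt.const_mul ((-1 : ℝ) ^ j)
  convert! this using 1
  rw [iteratedDeriv_succ]
  ring

theorem IsCompletelyMonotone.exists_tower {f : ℝ → ℝ} (hf : IsCompletelyMonotone f) :
    ∃ F, IsMonotoneTower F ∧ F 0 = f :=
  ⟨_, hf.isMonotoneTower, by simp⟩

theorem IsCompletelyMonotone.congr {f g : ℝ → ℝ} (hf : IsCompletelyMonotone f)
    (h : ∀ t, 0 < t → g t = f t) : IsCompletelyMonotone g := by
  refine ⟨hf.1.congr h, fun n t ht => ?_⟩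
  have : g =ᶠ[𝓝 t] f := by
    filter_upwards [Ioi_mem_nhds ht] with x hx using h x hx
  rw [this.iteratedDeriv_eq n]
  exact hf.2 n t ht

namespace IsCompletelyMonotone

variable {f : ℝ → ℝ}

theorem nonneg (hf : IsCompletelyMonotone f) {t : ℝ} (ht : 0 < t) : 0 ≤ f t := by
  simpa using hf.2 0 t ht

theorem hasDerivAt (hf : IsCompletelyMonotone f) {t : ℝ} (ht : 0 < t) :
    HasDerivAt f (deriv f t) t :=
  ((hf.1.differentiableOn (by simp)).differentiableAt (Ioi_mem_nhds ht)).hasDerivAt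

theorem continuousOn (hf : IsCompletelyMonotone f) : ContinuousOn f (Ioi 0) := hf.1.continuousOn

theorem neg_deriv (hf : IsCompletelyMonotone f) : IsCompletelyMonotone (fun t => -deriv f t) := by
  have h := hf.isMonotoneTower
  have h' : IsMonotoneTower (fun j t => (-1) ^ (j + 1) * iteratedDeriv (j + 1) f t) :=
    ⟨fun j => h.hasDerivAt (j + 1), fun j => h.nonneg (j + 1)⟩
  simpa using h'.isCompletelyMonotone

theorem antitoneOn (hf : IsCompletelyMonotone f) : AntitoneOn f (Ioi 0) := by
  refine antitoneOn_of_deriv_nonpos (convex_Ioi 0) hf.continuousOn ?_ ?_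
  · exact fun t ht => (hf.hasDerivAt (by simpa using ht)).differentiableAt.differentiableWithinAt
  · intro t ht
    have := hf.neg_deriv.nonneg (t := t) (by simpa using ht)
    linarith

/-- A nonnegative antiderivative of the negative of a completely monotone function is completely
monotone. -/
theorem of_hasDerivAt {g : ℝ → ℝ} (hg : IsCompletelyMonotone g) (h0 : ∀ t, 0 < t → 0 ≤ f t)
    (hd : ∀ t, 0 < t → HasDerivAt f (-g t) t) : IsCompletelyMonotone f := by
  obtain ⟨G, hG, rfl⟩ := hg.exists_tower
  have : IsMonotoneTower (fun j => Nat.casesOn j f G) := by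
    refine ⟨fun j t ht => ?_, fun j t ht => ?_⟩
    · cases j with
      | zero => exact hd t ht
      | succ j => exact hG.hasDerivAt j t ht
    · cases j with
      | zero => exact h0 t ht
      | succ j => exact hG.nonneg j t ht
  exact this.isCompletelyMonotone

theorem const_mul_comp_mul (hf : IsCompletelyMonotone f) {b c : ℝ} (hb : 0 < b) (hc : 0 ≤ c) :
    IsCompletelyMonotone (fun t => c * f (b * t)) := by
  obtain ⟨F, hF, rfl⟩ := hf.exists_tower
  have : IsMonotoneTower (fun j t => c * b ^ j * F j (b * t)) := by
    refine ⟨fun j t ht => ?_, fun j t ht => ?_⟩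
    · have h1 := hF.hasDerivAt j (b * t) (by positivity)
      have h2 : HasDerivAt (fun t => b * t) b t := by simpa using (hasDerivAt_id t).const_mul b
      have h3 := (h1.comp t h2).const_mul (c * b ^ j)
      convert! h3 using 1
      ring
    · have := hF.nonneg j (b * t) (by positivity)
      positivity
  simpa using this.isCompletelyMonotone

/-- The derivative of a completely monotone function is controlled by its value at a smaller
point, by convexity. -/
theorem neg_deriv_le (hf : IsCompletelyMonotone f) {t : ℝ} (ht : 0 < t) :
    -deriv f t ≤ 2 / t * f (t / 2) := by
  obtain ⟨ξ, hξ, h⟩ := exists_deriv_eq_slope f (show t / 2 < t by linarith)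
    (hf.continuousOn.mono fun x hx => lt_of_lt_of_le (by linarith : 0 < t / 2) hx.1)
    (fun x hx => (hf.hasDerivAt
      (lt_trans (by linarith : 0 < t / 2) hx.1)).differentiableAt.differentiableWithinAt)
  have h1 : -deriv f t ≤ -deriv f ξ :=
    hf.neg_deriv.antitoneOn (lt_trans (by linarith : 0 < t / 2) hξ.1) ht hξ.2.le
  have h2 := hf.nonneg ht
  refine h1.trans ?_
  rw [h]
  have h3 : -((f t - f (t / 2)) / (t - t / 2)) = 2 / t * (f (t / 2) - f t) := by
    field_simp
    ring
  rw [h3]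
  gcongr
  linarith

/-- Differentiation under the integral sign for a family of completely monotone functions, with
the only requirement that the family is integrable pointwise. -/
theorem hasDerivAt_integral {α : Type*} [MeasurableSpace α] {ν : Measure α} {F : α → ℝ → ℝ}
    (hF : ∀ᵐ a ∂ν, IsCompletelyMonotone (F a))
    (hi : ∀ t, 0 < t → Integrable (fun a => F a t) ν) {t : ℝ} (ht : 0 < t) :
    Integrable (fun a => -deriv (F a) t) ν ∧
      HasDerivAt (fun t => ∫ a, F a t ∂ν) (-∫ a, -deriv (F a) t ∂ν) t := by
  have hmeas : AEStronglyMeasurable (fun a => deriv (F a) t) ν := by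
    -- the derivative is the limit of the difference quotients `n (F (t + 1 / n) - F t)`
    have hlim : Tendsto (fun n : ℕ => t + ((n : ℝ) + 1)⁻¹) atTop (𝓝[≠] t) := by
      rw [tendsto_nhdsWithin_iff]
      constructor
      · have := (tendsto_const_nhds (x := t)).add (tendsto_one_div_add_atTop_nhds_zero_nat (𝕜 := ℝ))
        simpa using this
      · refine Eventually.of_forall fun n => ?_
        have : (0 : ℝ) < ((n : ℝ) + 1)⁻¹ := by positivity
        simp only [mem_compl_iff, mem_singleton_iff]
        linarith
    refine aestronglyMeasurable_of_tendsto_ae atTop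
      (f := fun (n : ℕ) a => slope (F a) t (t + ((n : ℝ) + 1)⁻¹)) (fun n => ?_) ?_
    · simp only [slope_def_field, div_eq_mul_inv]
      exact (((hi _ (by positivity)).aestronglyMeasurable).sub
        (hi t ht).aestronglyMeasurable).mul_const _
    · filter_upwards [hF] with a ha
      exact (hasDerivAt_iff_tendsto_slope.1 (ha.hasDerivAt ht)).comp hlim
  have key := hasDerivAt_integral_of_dominated_loc_of_deriv_le (μ := ν) (𝕜 := ℝ)
    (F := fun t a => F a t) (F' := fun t a => deriv (F a) t) (x₀ := t) (s := Ioi (t / 2))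
    (bound := fun a => 2 / (t / 2) * F a (t / 2 / 2))
    (Ioi_mem_nhds (by linarith))
    (by
      filter_upwards [Ioi_mem_nhds ht] with x hx using (hi x hx).aestronglyMeasurable)
    (hi t ht) hmeas
    (by
      filter_upwards [hF] with a ha x hx
      have hx' : t / 2 < x := hx
      have hx0 : 0 < x := by linarith
      have h1 := ha.neg_deriv.nonneg hx0
      have h2 : -deriv (F a) x ≤ -deriv (F a) (t / 2) :=
        ha.neg_deriv.antitoneOn (by simpa using ht) hx0 hx'.le
      rw [Real.norm_eq_abs, abs_of_nonpos (by linarith)]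
      exact h2.trans (ha.neg_deriv_le (by linarith)))
    ((hi _ (by linarith)).const_mul _)
    (by
      filter_upwards [hF] with a ha x hx
      have hx' : t / 2 < x := hx
      exact ha.hasDerivAt (by linarith))
  refine ⟨key.1.neg, ?_⟩
  rw [integral_neg, neg_neg]
  exact key.2

/-- Mixtures of completely monotone functions are completely monotone. -/
theorem integral {α : Type*} [MeasurableSpace α] {ν : Measure α} {F : α → ℝ → ℝ}
    (hF : ∀ᵐ a ∂ν, IsCompletelyMonotone (F a))
    (hi : ∀ t, 0 < t → Integrable (fun a => F a t) ν) :
    IsCompletelyMonotone (fun t => ∫ a, F a t ∂ν) := by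
  let D : ℕ → α → ℝ → ℝ := fun j a => (fun g : ℝ → ℝ => fun t => -deriv g t)^[j] (F a)
  have hD : ∀ j, (∀ᵐ a ∂ν, IsCompletelyMonotone (D j a)) ∧
      ∀ t, 0 < t → Integrable (fun a => D j a t) ν := by
    intro j
    induction j with
    | zero => exact ⟨hF, hi⟩
    | succ j ih =>
      have hs : ∀ a, D (j + 1) a = fun t => -deriv (D j a) t := fun a => by
        simp only [D, Function.iterate_succ_apply']
      simp only [hs]
      refine ⟨?_, fun t ht => (hasDerivAt_integral ih.1 ih.2 ht).1⟩
      filter_upwards [ih.1] with a ha using ha.neg_deriv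
  have : IsMonotoneTower (fun j t => ∫ a, D j a t ∂ν) := by
    refine ⟨fun j t ht => ?_, fun j t ht => integral_nonneg_of_ae ?_⟩
    · have hs : ∀ a, D (j + 1) a = fun t => -deriv (D j a) t := fun a => by
        simp only [D, Function.iterate_succ_apply']
      simp only [hs]
      exact (hasDerivAt_integral (hD j).1 (hD j).2 ht).2
    · filter_upwards [(hD j).1] with a ha using ha.nonneg ht
  exact this.isCompletelyMonotone

/-- If `f(t) - b f(bt)` is completely monotone for every `b > 1`, then so is `t f(t)`: indeed
`-(t f(t))'` is the limit of `(f(t) - b f(bt)) / (b - 1)` as `b ↓ 1`, and likewise for the higher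
derivatives. -/
theorem id_mul (hf : IsCompletelyMonotone f)
    (h : ∀ b, 1 < b → IsCompletelyMonotone (fun t => f t - b * f (b * t))) :
    IsCompletelyMonotone (fun t => t * f t) := by
  obtain ⟨F, hF, rfl⟩ := hf.exists_tower
  have hscale : ∀ b, 1 < b → ∀ j t, 0 < t → b ^ (j + 1) * F j (b * t) ≤ F j t := by
    intro b hb j t ht
    have hb0 : 0 < b := by linarith
    have h1 := (h b hb).2 j t ht
    have h2 := contDiffOn_and_iteratedDeriv_of_hasDerivAt
      (F := fun j t => (-1) ^ j * (F j t - b ^ (j + 1) * F j (b * t)))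
      (fun j t ht => by
        have h1 := hF.hasDerivAt j (b * t) (by positivity)
        have h2 : HasDerivAt (fun t => b * t) b t := by simpa using (hasDerivAt_id t).const_mul b
        have h3 := (((hF.hasDerivAt j t ht).sub
          ((h1.comp t h2).const_mul (b ^ (j + 1))))).const_mul ((-1) ^ j)
        convert! h3 using 1
        ring)
    have h3 := h2.2 j t ht
    simp only [pow_zero, one_mul, zero_add, pow_one] at h3
    rw [h3, ← mul_assoc, ← mul_pow] at h1
    simp only [mul_neg, mul_one, neg_neg, one_pow, one_mul] at h1
    linarith
  have hnonneg : ∀ j t, 0 < t → 0 ≤ t * F (j + 1) t - (j + 1) * F j t := by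
    intro j t ht
    -- `b ↦ b ^ (j + 1) F_j(bt)` is at most its value at `1` for `b > 1`
    have hd : HasDerivAt (fun b => b ^ (j + 1) * F j (b * t))
        ((j + 1) * F j t - t * F (j + 1) t) 1 := by
      have h1 := hF.hasDerivAt j (1 * t) (by simpa using ht)
      have h2 : HasDerivAt (fun b => b * t) t 1 := by simpa using (hasDerivAt_id (1 : ℝ)).mul_const t
      have h3 := (hasDerivAt_pow (j + 1) (1 : ℝ)).mul (h1.comp 1 h2)
      convert! h3 using 1
      simp
      ring
    have hs := (hasDerivAt_iff_tendsto_slope.1 hd).mono_left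
      (nhdsWithin_mono 1 (show Ioi (1 : ℝ) ⊆ {1}ᶜ from fun x hx => ne_of_gt hx))
    have hle := le_of_tendsto hs (b := 0) (by
      filter_upwards [self_mem_nhdsWithin] with b hb
      have hb' : 1 < b := hb
      rw [slope_def_field]
      refine div_nonpos_of_nonpos_of_nonneg ?_ (by linarith)
      have := hscale b hb' j t ht
      simp only [one_pow, one_mul]
      linarith)
    linarith
  have : IsMonotoneTower (fun j t => t * F j t - j * F (j - 1) t) := by
    refine ⟨fun j t ht => ?_, fun j t ht => ?_⟩
    · cases j with
      | zero =>
        have h1 := (hasDerivAt_id t).mul (hF.hasDerivAt 0 t ht)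
        simp only [CharP.cast_eq_zero, zero_mul, sub_zero]
        convert! h1 using 1
        simp
        ring
      | succ j =>
        have h1 := ((hasDerivAt_id t).mul (hF.hasDerivAt (j + 1) t ht)).sub
          ((hF.hasDerivAt j t ht).const_mul ((j + 1 : ℕ) : ℝ))
        convert! h1 using 1
        simp
        ring
    · cases j with
      | zero =>
        have := hF.nonneg 0 t ht
        simp only [CharP.cast_eq_zero, zero_mul, sub_zero]
        positivity
      | succ j => simpa using hnonneg j t ht
  simpa using this.isCompletelyMonotone

/-- The scaling differences `(f(t) - f(bt)) / t = ∫_1^b (-f'(st)) ds` of a completely monotone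
function are completely monotone. -/
theorem sub_comp_mul_div (hf : IsCompletelyMonotone f) {b : ℝ} (hb : 1 < b) :
    IsCompletelyMonotone (fun t => (f t - f (b * t)) / t) := by
  have hcont : ∀ t, 0 < t → ContinuousOn (fun s => -deriv f (s * t)) (Icc 1 b) := by
    intro t ht
    refine hf.neg_deriv.continuousOn.comp (by fun_prop) fun s hs => ?_
    have : 0 < s := lt_of_lt_of_le one_pos hs.1
    exact mul_pos this ht
  have h := integral (ν := volume.restrict (Ioc 1 b)) (F := fun s t => -deriv f (s * t))
    (by
      filter_upwards [ae_restrict_mem measurableSet_Ioc] with s hs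
      simpa using hf.neg_deriv.const_mul_comp_mul (lt_trans one_pos hs.1) zero_le_one)
    (fun t ht => (hcont t ht).integrableOn_Icc.mono_set Ioc_subset_Icc_self)
  refine h.congr fun t ht => ?_
  rw [← intervalIntegral.integral_of_le hb.le]
  have := intervalIntegral.integral_eq_sub_of_hasDerivAt (a := 1) (b := b)
    (f := fun s => -(f (s * t) / t)) (f' := fun s => -deriv f (s * t)) (fun s hs => ?_)
    ((hcont t ht).intervalIntegrable_of_Icc hb.le)
  · rw [this]
    simp only [one_mul]
    ring
  · rw [uIcc_of_le hb.le] at hs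
    have hs0 : 0 < s := lt_of_lt_of_le one_pos hs.1
    have h2 : HasDerivAt (fun s => s * t) t s := by simpa using (hasDerivAt_id s).mul_const t
    have h3 := (((hf.hasDerivAt (mul_pos hs0 ht)).comp s h2).div_const t).neg
    convert! h3 using 1
    field_simp

end IsCompletelyMonotone

/-! ### Uniqueness for Laplace transforms -/

/-- A finite measure on `[0, ∞)` is determined by the values of its Laplace transform at the natural
numbers: these are the moments of its image under `x ↦ e^{-x}`, and that image is carried by
`[0, 1]`, so that its moment generating function is entire. -/
theorem measure_ext_of_integral_exp_neg_nat {μ ν : Measure ℝ} [IsFiniteMeasure μ]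
    [IsFiniteMeasure ν] (hμ : μ (Iio 0) = 0) (hν : ν (Iio 0) = 0)
    (h : ∀ n : ℕ, ∫ x, Real.exp (-n * x) ∂μ = ∫ x, Real.exp (-n * x) ∂ν) : μ = ν := by
  let Y : ℝ → ℝ := fun x => Real.exp (-x)
  have hY : Measurable Y := by fun_prop
  have hmgf : ∀ ρ : Measure ℝ, IsFiniteMeasure ρ → ρ (Iio 0) = 0 → ∀ z : ℂ,
      HasSum (fun n : ℕ => z ^ n / (n.factorial : ℂ) * ((∫ x, Real.exp (-n * x) ∂ρ : ℝ) : ℂ))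
        (complexMGF Y ρ z) := by
    intro ρ _ hρ z
    have hae : ∀ᵐ x ∂ρ, 0 ≤ x := by
      have : ∀ᵐ x ∂ρ, x ∉ Iio (0 : ℝ) := measure_eq_zero_iff_ae_notMem.1 hρ
      filter_upwards [this] with x hx using not_lt.1 hx
    have hnorm : ∀ n : ℕ, ∀ᵐ x ∂ρ, ‖(z * (Y x : ℂ)) ^ n / (n.factorial : ℂ)‖ ≤
        ‖z‖ ^ n / n.factorial := by
      intro n
      filter_upwards [hae] with x hx
      rw [norm_div, norm_pow, norm_mul, Complex.norm_natCast]
      have h1 : ‖(Y x : ℂ)‖ ≤ 1 := by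
        rw [Complex.norm_real, Real.norm_eq_abs, abs_of_pos (Real.exp_pos _)]
        exact Real.exp_le_one_iff.2 (by linarith)
      gcongr
      exact mul_le_of_le_one_right (norm_nonneg _) h1
    have hm : ∀ n : ℕ, AEStronglyMeasurable
        (fun x => (z * (Y x : ℂ)) ^ n / (n.factorial : ℂ)) ρ := by
      intro n
      exact (by fun_prop : Measurable
        (fun x => (z * (Y x : ℂ)) ^ n / (n.factorial : ℂ))).aestronglyMeasurable
    have hint : ∀ n : ℕ, Integrable (fun x => (z * (Y x : ℂ)) ^ n / (n.factorial : ℂ)) ρ :=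
      fun n => Integrable.of_bound (hm n) _ (hnorm n)
    have hsum : Summable fun n : ℕ => ∫ x, ‖(z * (Y x : ℂ)) ^ n / (n.factorial : ℂ)‖ ∂ρ := by
      refine Summable.of_nonneg_of_le (fun n => integral_nonneg fun x => norm_nonneg _)
        (fun n => ?_) ((Real.summable_pow_div_factorial ‖z‖).mul_right (ρ.real univ))
      calc _ ≤ ∫ x, ‖z‖ ^ n / n.factorial ∂ρ :=
            integral_mono_ae (hint n).norm (integrable_const _) (hnorm n)
        _ = _ := by rw [integral_const, smul_eq_mul, mul_comm]
    have key := hasSum_integral_of_summable_integral_norm hint hsum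
    have e1 : ∫ x, ∑' n : ℕ, (z * (Y x : ℂ)) ^ n / (n.factorial : ℂ) ∂ρ = complexMGF Y ρ z := by
      rw [complexMGF]
      refine integral_congr_ae (Eventually.of_forall fun x => ?_)
      simp only
      rw [Complex.exp_eq_exp_ℂ]
      exact (NormedSpace.expSeries_div_hasSum_exp (z * (Y x : ℂ))).tsum_eq
    rw [e1] at key
    convert! key using 2 with n
    rw [← integral_complex_ofReal, ← integral_const_mul]
    refine integral_congr_ae (Eventually.of_forall fun x => ?_)
    simp only [Y]
    rw [mul_pow, ← Complex.ofReal_pow, ← Real.exp_nat_mul]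
    have : (n : ℝ) * -x = -n * x := by ring
    rw [this]
    ring
  have hmap : μ.map Y = ν.map Y := by
    refine Measure.ext_of_complexMGF_eq hY.aemeasurable hY.aemeasurable (funext fun z => ?_)
    have h1 := hmgf μ inferInstance hμ z
    have h2 := hmgf ν inferInstance hν z
    simp only [h] at h1
    exact h1.unique h2
  have hlog : ∀ ρ : Measure ℝ, (ρ.map Y).map (fun y => -Real.log y) = ρ := by
    intro ρ
    rw [Measure.map_map (by fun_prop) hY]
    have : (fun y => -Real.log y) ∘ Y = id := by
      funext x
      simp [Y]
    rw [this, Measure.map_id]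
  rw [← hlog μ, ← hlog ν, hmap]

/-! ### Bernstein representations -/

theorem half_min_mul_min_le_one_sub_exp {u t : ℝ} (hu : 0 < u) (ht : 0 < t) :
    min 1 u / 2 * min 1 t ≤ 1 - Real.exp (-u * t) := by
  have h1 : Real.exp (-u * t) ≤ 1 / (1 + u * t) := by
    rw [neg_mul, Real.exp_neg, ← one_div]
    have := Real.add_one_le_exp (u * t)
    have h0 : 0 < u * t := by positivity
    exact one_div_le_one_div_of_le (by linarith) (by linarith)
  have hx : 0 < u * t := by positivity
  have h2 : min 1 u * min 1 t ≤ min 1 (u * t) := by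
    refine le_min ?_ ?_
    · exact mul_le_one₀ (min_le_left _ _) (le_min zero_le_one ht.le) (min_le_left _ _)
    · exact mul_le_mul (min_le_right _ _) (min_le_right _ _) (le_min zero_le_one ht.le) hu.le
  have h3 : min 1 (u * t) / 2 ≤ 1 - 1 / (1 + u * t) := by
    have : 1 - 1 / (1 + u * t) = u * t / (1 + u * t) := by field_simp; ring
    rw [this, div_le_div_iff₀ (by norm_num) (by linarith)]
    rcases le_total 1 (u * t) with h | h
    · rw [min_eq_left h]; linarith
    · rw [min_eq_right h]; nlinarith
  linarith

theorem one_sub_exp_le_max_mul_min {u t : ℝ} (ht : 0 < t) :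
    1 - Real.exp (-u * t) ≤ max 1 u * min 1 t := by
  have h1 := Real.add_one_le_exp (-u * t)
  have h2 := Real.exp_pos (-u * t)
  rcases le_total 1 t with h | h
  · rw [min_eq_left h]
    have := le_max_left 1 u
    linarith
  · rw [min_eq_right h]
    have := le_max_right 1 u
    nlinarith

theorem one_sub_exp_nonneg {u t : ℝ} (hu : 0 < u) (ht : 0 < t) : 0 ≤ 1 - Real.exp (-u * t) := by
  have : Real.exp (-u * t) ≤ 1 := Real.exp_le_one_iff.2 (by nlinarith)
  linarith

namespace HasBernsteinRep

variable {f g : ℝ → ℝ} {a b : ℝ} {m n : ℝ → ℝ}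

theorem aestronglyMeasurable (h : HasBernsteinRep f a m) :
    AEStronglyMeasurable m (volume.restrict (Ioi 0)) := by
  have h1 : AEStronglyMeasurable (fun t => (min 1 t)⁻¹ * (min 1 t * m t))
      (volume.restrict (Ioi 0)) :=
    (by fun_prop : Measurable fun t : ℝ => (min 1 t)⁻¹).aestronglyMeasurable.mul
      h.integrable.aestronglyMeasurable
  refine h1.congr ?_
  filter_upwards [ae_restrict_mem measurableSet_Ioi] with t ht
  have : (0 : ℝ) < min 1 t := lt_min one_pos ht
  field_simp

theorem integrableOn (h : HasBernsteinRep f a m) {u : ℝ} (hu : 0 < u) :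
    IntegrableOn (fun t => (1 - Real.exp (-u * t)) * m t) (Ioi 0) := by
  refine Integrable.mono' (h.integrable.const_mul (max 1 u))
    ((by fun_prop : Measurable fun t : ℝ => 1 - Real.exp (-u * t)).aestronglyMeasurable.mul
      h.aestronglyMeasurable) ?_
  filter_upwards [ae_restrict_mem measurableSet_Ioi] with t ht
  have h1 := h.density_nonneg t ht
  have h2 := one_sub_exp_nonneg hu ht
  rw [Real.norm_eq_abs, abs_of_nonneg (mul_nonneg h2 h1), ← mul_assoc]
  exact mul_le_mul_of_nonneg_right (one_sub_exp_le_max_mul_min ht) h1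

theorem integrableOn_min_mul {u : ℝ} (hu : 0 < u) (h0 : ∀ t, 0 < t → 0 ≤ m t)
    (hm : AEStronglyMeasurable m (volume.restrict (Ioi 0)))
    (h : IntegrableOn (fun t => (1 - Real.exp (-u * t)) * m t) (Ioi 0)) :
    IntegrableOn (fun t => min 1 t * m t) (Ioi 0) := by
  refine Integrable.mono' (h.const_mul (2 / min 1 u))
    ((by fun_prop : Measurable fun t : ℝ => min 1 t).aestronglyMeasurable.mul hm) ?_
  filter_upwards [ae_restrict_mem measurableSet_Ioi] with t ht
  have ht' : 0 < t := ht
  have h1 := h0 t ht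
  have h2 : 0 ≤ min 1 t := le_min zero_le_one ht'.le
  have h3 : 0 < min 1 u := lt_min one_pos hu
  rw [Real.norm_eq_abs, abs_of_nonneg (mul_nonneg h2 h1), ← mul_assoc]
  refine mul_le_mul_of_nonneg_right ?_ h1
  have := half_min_mul_min_le_one_sub_exp hu ht
  rw [div_mul_eq_mul_div, le_div_iff₀ h3]
  linarith

theorem integral_nonneg (h : HasBernsteinRep f a m) {u : ℝ} (hu : 0 < u) :
    0 ≤ ∫ t in Ioi (0 : ℝ), (1 - Real.exp (-u * t)) * m t :=
  setIntegral_nonneg measurableSet_Ioi fun t ht =>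
    mul_nonneg (one_sub_exp_nonneg hu ht) (h.density_nonneg t ht)

theorem drift_le (h : HasBernsteinRep f a m) {u : ℝ} (hu : 0 < u) : a * u ≤ f u := by
  have := h.integral_nonneg hu
  rw [h.eq u hu]
  linarith

theorem nonneg (h : HasBernsteinRep f a m) {u : ℝ} (hu : 0 < u) : 0 ≤ f u :=
  (mul_nonneg h.drift_nonneg hu.le).trans (h.drift_le hu)

theorem lintegral_eq (h : HasBernsteinRep f a m) {u : ℝ} (hu : 0 < u) :
    ∫⁻ t in Ioi (0 : ℝ), ENNReal.ofReal ((1 - Real.exp (-u * t)) * m t) =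
      ENNReal.ofReal (f u - a * u) := by
  rw [h.eq u hu, add_sub_cancel_left, ofReal_integral_eq_lintegral_ofReal (h.integrableOn hu)]
  filter_upwards [ae_restrict_mem measurableSet_Ioi] with t ht
  exact mul_nonneg (one_sub_exp_nonneg hu ht) (h.density_nonneg t ht)

/-- A Bernstein representation from an identity between integrals with values in `[0, ∞]`; the
integrability of the Lévy density comes for free. -/
theorem of_lintegral (ha : 0 ≤ a) (h0 : ∀ t, 0 < t → 0 ≤ m t)
    (hm : AEStronglyMeasurable m (volume.restrict (Ioi 0))) (hf : ∀ u, 0 < u → a * u ≤ f u)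
    (h : ∀ u, 0 < u → ∫⁻ t in Ioi (0 : ℝ), ENNReal.ofReal ((1 - Real.exp (-u * t)) * m t) =
      ENNReal.ofReal (f u - a * u)) : HasBernsteinRep f a m := by
  have hmeas : ∀ u : ℝ, AEStronglyMeasurable (fun t => (1 - Real.exp (-u * t)) * m t)
      (volume.restrict (Ioi 0)) := fun u =>
    (by fun_prop : Measurable fun t : ℝ => 1 - Real.exp (-u * t)).aestronglyMeasurable.mul hm
  have hpos : ∀ u, 0 < u → 0 ≤ᵐ[volume.restrict (Ioi 0)]
      fun t => (1 - Real.exp (-u * t)) * m t := fun u hu => by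
    filter_upwards [ae_restrict_mem measurableSet_Ioi] with t ht
    exact mul_nonneg (one_sub_exp_nonneg hu ht) (h0 t ht)
  have hint : ∀ u, 0 < u → IntegrableOn (fun t => (1 - Real.exp (-u * t)) * m t) (Ioi 0) := by
    intro u hu
    refine ⟨hmeas u, ?_⟩
    rw [hasFiniteIntegral_iff_ofReal (hpos u hu), h u hu]
    exact ENNReal.ofReal_lt_top
  refine ⟨ha, h0, integrableOn_min_mul one_pos h0 hm (hint 1 one_pos), fun u hu => ?_⟩
  rw [integral_eq_lintegral_of_nonneg_ae (hpos u hu) (hmeas u), h u hu, ENNReal.toReal_ofReal]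
  · ring
  · linarith [hf u hu]

theorem congr (h : HasBernsteinRep f a m) (hg : ∀ u, 0 < u → g u = f u)
    (hn : ∀ t, 0 < t → n t = m t) : HasBernsteinRep g a n := by
  refine ⟨h.drift_nonneg, fun t ht => by rw [hn t ht]; exact h.density_nonneg t ht, ?_, ?_⟩
  · refine h.integrable.congr_fun (fun t ht => ?_) measurableSet_Ioi
    simp only [hn t ht]
  · intro u hu
    rw [hg u hu, h.eq u hu]
    congr 1
    refine setIntegral_congr_fun measurableSet_Ioi fun t ht => ?_
    simp only [hn t ht]

theorem add (hf : HasBernsteinRep f a m) (hg : HasBernsteinRep g b n) :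
    HasBernsteinRep (fun u => f u + g u) (a + b) (fun t => m t + n t) := by
  refine ⟨add_nonneg hf.drift_nonneg hg.drift_nonneg,
    fun t ht => add_nonneg (hf.density_nonneg t ht) (hg.density_nonneg t ht), ?_, ?_⟩
  · simp only [mul_add]
    exact hf.integrable.add hg.integrable
  · intro u hu
    simp only [mul_add]
    rw [integral_add (hf.integrableOn hu) (hg.integrableOn hu), hf.eq u hu, hg.eq u hu]
    ring

theorem sub (hf : HasBernsteinRep f a m) (hg : HasBernsteinRep g b n) (hab : b ≤ a)
    (hmn : ∀ t, 0 < t → n t ≤ m t) :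
    HasBernsteinRep (fun u => f u - g u) (a - b) (fun t => m t - n t) := by
  refine ⟨sub_nonneg.2 hab, fun t ht => sub_nonneg.2 (hmn t ht), ?_, ?_⟩
  · simp only [mul_sub]
    exact hf.integrable.sub hg.integrable
  · intro u hu
    simp only [mul_sub]
    rw [integral_sub (hf.integrableOn hu) (hg.integrableOn hu), hf.eq u hu, hg.eq u hu]
    ring

/-- The Bernstein representation of `u ↦ f(u / c)`. -/
theorem comp_div (hf : HasBernsteinRep f a m) {c : ℝ} (hc : 0 < c) :
    HasBernsteinRep (fun u => f (u / c)) (a / c) (fun t => c * m (c * t)) := by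
  have hqmp : Measure.QuasiMeasurePreserving (fun t : ℝ => c * t)
      (volume.restrict (Ioi 0)) (volume.restrict (Ioi 0)) := by
    refine ⟨by fun_prop, ?_⟩
    refine Measure.AbsolutelyContinuous.mk fun s hs h => ?_
    rw [Measure.map_apply (by fun_prop) hs, Measure.restrict_apply (hs.preimage (by fun_prop))]
    rw [Measure.restrict_apply hs] at h
    have : (fun t : ℝ => c * t) ⁻¹' s ∩ Ioi 0 = (fun t : ℝ => c * t) ⁻¹' (s ∩ Ioi 0) := by
      ext t
      simp [hc]
    rw [this, Real.volume_preimage_mul_left hc.ne', h, mul_zero]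
  have hm : AEStronglyMeasurable (fun t => c * m (c * t)) (volume.restrict (Ioi 0)) :=
    (hf.aestronglyMeasurable.comp_quasiMeasurePreserving hqmp).const_mul c
  refine ⟨div_nonneg hf.drift_nonneg hc.le,
    fun t ht => mul_nonneg hc.le (hf.density_nonneg _ (by positivity)), ?_, ?_⟩
  · refine integrableOn_min_mul hc
      (fun t ht => mul_nonneg hc.le (hf.density_nonneg _ (by positivity))) hm ?_
    have h1 := (integrableOn_Ioi_comp_mul_left_iff
      (fun t => (1 - Real.exp (-1 * t)) * m t) 0 hc).2 (by simpa using hf.integrableOn one_pos)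
    have h2 : IntegrableOn (fun t => c * ((1 - Real.exp (-1 * (c * t))) * m (c * t))) (Ioi 0) :=
      h1.const_mul c
    refine h2.congr_fun (fun t _ => ?_) measurableSet_Ioi
    have : -1 * (c * t) = -c * t := by ring
    simp only [this]
    ring
  · intro u hu
    rw [hf.eq (u / c) (by positivity)]
    have h2 := integral_comp_mul_left_Ioi (fun t => (1 - Real.exp (-(u / c) * t)) * m t) 0 hc
    rw [mul_zero, smul_eq_mul, eq_inv_mul_iff_mul_eq₀ hc.ne', ← integral_const_mul] at h2
    rw [← h2]
    congr 1
    · ring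
    · refine setIntegral_congr_fun measurableSet_Ioi fun t _ => ?_
      have : -(u / c) * (c * t) = -u * t := by field_simp
      simp only [this]
      ring

theorem continuousOn (h : HasBernsteinRep f a m) : ContinuousOn f (Ioi 0) := by
  have h1 : ContinuousOn (fun u => a * u + ∫ t in Ioi (0 : ℝ), (1 - Real.exp (-u * t)) * m t)
      (Ioi 0) := by
    refine ContinuousOn.add (by fun_prop) fun u hu => ContinuousAt.continuousWithinAt ?_
    have hu' : 0 < u := hu
    refine continuousAt_of_dominated (bound := fun t => max 1 (u + 1) * (min 1 t * m t))
      (Eventually.of_forall fun v => (by fun_prop :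
        Measurable fun t : ℝ => 1 - Real.exp (-v * t)).aestronglyMeasurable.mul
          h.aestronglyMeasurable) ?_ (h.integrable.const_mul _) ?_
    · filter_upwards [Ioo_mem_nhds hu' (lt_add_one u)] with v hv
      filter_upwards [ae_restrict_mem measurableSet_Ioi] with t ht
      have h1 := h.density_nonneg t ht
      have h2 := one_sub_exp_nonneg hv.1 ht
      have h3 : (0 : ℝ) ≤ min 1 t := le_min zero_le_one (le_of_lt ht)
      rw [Real.norm_eq_abs, abs_of_nonneg (mul_nonneg h2 h1), ← mul_assoc]
      refine mul_le_mul_of_nonneg_right ((one_sub_exp_le_max_mul_min ht).trans ?_) h1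
      exact mul_le_mul_of_nonneg_right (max_le_max le_rfl hv.2.le) h3
    · exact Eventually.of_forall fun t => by fun_prop
  exact h1.congr fun u hu => h.eq u hu

/-- A Bernstein function determines its Lévy density, if this is continuous. -/
theorem density_unique (hm : HasBernsteinRep f a m) (hn : HasBernsteinRep f b n)
    (hmc : ContinuousOn m (Ioi 0)) (hnc : ContinuousOn n (Ioi 0)) :
    ∀ t, 0 < t → m t = n t := by
  -- the finite measures with Laplace transform `u ↦ f (u + 2) - f (u + 1)`
  let w : ℝ → ℝ := fun t => Real.exp (-1 * t) - Real.exp (-2 * t)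
  have hw : ∀ t : ℝ, 0 < t → 0 < w t := fun t ht =>
    sub_pos.2 (Real.exp_lt_exp.2 (by linarith))
  let ν : ℝ → (ℝ → ℝ) → Measure ℝ := fun a m => ENNReal.ofReal a • Measure.dirac 0 +
    (volume.restrict (Ioi 0)).withDensity (fun t => ENNReal.ofReal (w t * m t))
  have hwint : ∀ {a m}, HasBernsteinRep f a m → IntegrableOn (fun t => w t * m t) (Ioi 0) := by
    intro a m h
    refine ((h.integrableOn two_pos).sub (h.integrableOn one_pos)).congr_fun
      (fun t _ => ?_) measurableSet_Ioi
    simp only [w, Pi.sub_apply]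
    ring
  have hwm : ∀ {a m}, HasBernsteinRep f a m →
      AEMeasurable (fun t => ENNReal.ofReal (w t * m t)) (volume.restrict (Ioi 0)) :=
    fun h => (hwint h).aestronglyMeasurable.aemeasurable.ennreal_ofReal
  have hwpos : ∀ {a m}, HasBernsteinRep f a m →
      0 ≤ᵐ[volume.restrict (Ioi 0)] fun t => w t * m t := by
    intro a m h
    filter_upwards [ae_restrict_mem measurableSet_Ioi] with t ht
    exact mul_nonneg (hw t ht).le (h.density_nonneg t ht)
  have hfin : ∀ {a m}, HasBernsteinRep f a m → ∫⁻ t in Ioi (0 : ℝ), ENNReal.ofReal (w t * m t) ≠ ⊤ :=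
    fun h => ((hasFiniteIntegral_iff_ofReal (hwpos h)).1 (hwint h).2).ne
  have hνfin : ∀ {a m}, HasBernsteinRep f a m → IsFiniteMeasure (ν a m) := by
    intro a m h
    have h1 := isFiniteMeasure_withDensity (hfin h)
    have h2 : IsFiniteMeasure (ENNReal.ofReal a • Measure.dirac (0 : ℝ)) :=
      Measure.smul_finite _ ENNReal.ofReal_ne_top
    exact inferInstanceAs (IsFiniteMeasure (_ + _))
  have hνneg : ∀ {a m}, ν a m (Iio 0) = 0 := by
    intro a m
    have h1 : (volume.restrict (Ioi (0 : ℝ))) (Iio 0) = 0 := by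
      rw [Measure.restrict_apply measurableSet_Iio]
      have : Iio (0 : ℝ) ∩ Ioi 0 = ∅ := by
        ext x; simp only [mem_inter_iff, mem_Iio, mem_Ioi, mem_empty_iff_false, iff_false]
        intro hx; linarith [hx.1, hx.2]
      rw [this, measure_empty]
    simp [ν, withDensity_absolutelyContinuous _ _ h1]
  have hlap : ∀ {a m}, HasBernsteinRep f a m → ∀ k : ℕ,
      ∫ x, Real.exp (-k * x) ∂(ν a m) = f (k + 2) - f (k + 1) := by
    intro a m h k
    have := hνfin h
    have hexp : Integrable (fun x => Real.exp (-k * x)) (ν a m) := by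
      refine Integrable.of_bound (by fun_prop) 1 ?_
      have : ∀ᵐ x ∂(ν a m), x ∉ Iio (0 : ℝ) := measure_eq_zero_iff_ae_notMem.1 hνneg
      filter_upwards [this] with x hx
      rw [Real.norm_eq_abs, abs_of_pos (Real.exp_pos _), Real.exp_le_one_iff]
      have hx0 : 0 ≤ x := by simpa using hx
      have hk : (0 : ℝ) ≤ k := Nat.cast_nonneg k
      nlinarith
    rw [integral_add_measure hexp.left_of_add_measure hexp.right_of_add_measure,
      integral_smul_measure, integral_dirac,
      integral_withDensity_eq_integral_toReal_smul₀ (hwm h)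
        (Eventually.of_forall fun _ => ENNReal.ofReal_lt_top),
      h.eq _ (by positivity), h.eq _ (by positivity), ENNReal.toReal_ofReal h.drift_nonneg,
      add_sub_add_comm, ← integral_sub (h.integrableOn (by positivity))
        (h.integrableOn (by positivity))]
    congr 1
    · simp
      ring
    · refine integral_congr_ae ?_
      filter_upwards [hwpos h] with t ht
      rw [ENNReal.toReal_ofReal ht, smul_eq_mul]
      have e1 : Real.exp (-((k : ℝ) + 2) * t) = Real.exp (-k * t) * Real.exp (-2 * t) := by
        rw [← Real.exp_add]; congr 1; ring
      have e2 : Real.exp (-((k : ℝ) + 1) * t) = Real.exp (-k * t) * Real.exp (-1 * t) := by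
        rw [← Real.exp_add]; congr 1; ring
      rw [e1, e2]
      simp only [w]
      ring
  have := hνfin hm
  have := hνfin hn
  have heq : ν a m = ν b n := measure_ext_of_integral_exp_neg_nat hνneg hνneg fun k => by
    rw [hlap hm, hlap hn]
  have hres : ∀ {a m}, (ν a m).restrict (Ioi 0) =
      (volume.restrict (Ioi 0)).withDensity (fun t => ENNReal.ofReal (w t * m t)) := by
    intro a m
    simp only [ν]
    rw [Measure.restrict_add, Measure.restrict_smul,
      restrict_withDensity measurableSet_Ioi, Measure.restrict_restrict measurableSet_Ioi, inter_self,
      Measure.restrict_eq_zero.2 (by simp), smul_zero, zero_add]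
  have hd : (volume.restrict (Ioi 0)).withDensity (fun t => ENNReal.ofReal (w t * m t)) =
      (volume.restrict (Ioi 0)).withDensity (fun t => ENNReal.ofReal (w t * n t)) := by
    rw [← hres (a := a), ← hres (a := b), heq]
  have hae := (withDensity_eq_iff (hwm hm) (hwm hn) (hfin hm)).1 hd
  have hae' : m =ᵐ[volume.restrict (Ioi 0)] n := by
    filter_upwards [hae, ae_restrict_mem measurableSet_Ioi] with t h1 ht
    rw [ENNReal.ofReal_eq_ofReal_iff (mul_nonneg (hw t ht).le (hm.density_nonneg t ht))
      (mul_nonneg (hw t ht).le (hn.density_nonneg t ht))] at h1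
    exact mul_left_cancel₀ (hw t ht).ne' h1
  intro t ht
  exact Measure.eqOn_open_of_ae_eq hae' isOpen_Ioi hmc hnc ht

end HasBernsteinRep

/-! ### Laplace exponents -/

namespace IsProbOnNonneg

variable {μ : Measure ℝ}

theorem ae_nonneg (hμ : IsProbOnNonneg μ) : ∀ᵐ x ∂μ, 0 ≤ x := by
  have : ∀ᵐ x ∂μ, x ∉ Iio (0 : ℝ) := measure_eq_zero_iff_ae_notMem.1 hμ.measure_Iio_zero
  filter_upwards [this] with x hx
  simpa using hx

theorem norm_exp_le (hμ : IsProbOnNonneg μ) {u : ℝ} (hu : 0 ≤ u) :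
    ∀ᵐ x ∂μ, ‖Real.exp (-u * x)‖ ≤ 1 := by
  filter_upwards [hμ.ae_nonneg] with x hx
  rw [Real.norm_eq_abs, abs_of_pos (Real.exp_pos _), Real.exp_le_one_iff]
  nlinarith

theorem integrable_exp (hμ : IsProbOnNonneg μ) {u : ℝ} (hu : 0 ≤ u) :
    Integrable (fun x => Real.exp (-u * x)) μ :=
  have := hμ.isProbabilityMeasure
  Integrable.of_bound (by fun_prop) 1 (hμ.norm_exp_le hu)

theorem integral_exp_pos (hμ : IsProbOnNonneg μ) {u : ℝ} (hu : 0 ≤ u) :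
    0 < ∫ x, Real.exp (-u * x) ∂μ :=
  have := hμ.isProbabilityMeasure
  MeasureTheory.integral_exp_pos (hμ.integrable_exp hu)

theorem exp_neg_laplaceExponent (hμ : IsProbOnNonneg μ) {u : ℝ} (hu : 0 ≤ u) :
    Real.exp (-laplaceExponent μ u) = ∫ x, Real.exp (-u * x) ∂μ := by
  rw [laplaceExponent, neg_neg, Real.exp_log (hμ.integral_exp_pos hu)]

theorem laplaceExponent_zero (hμ : IsProbOnNonneg μ) : laplaceExponent μ 0 = 0 := by
  have := hμ.isProbabilityMeasure
  simp [laplaceExponent]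

theorem continuousOn_laplaceExponent (hμ : IsProbOnNonneg μ) :
    ContinuousOn (laplaceExponent μ) (Ici 0) := by
  have := hμ.isProbabilityMeasure
  have h : ContinuousOn (fun u => ∫ x, Real.exp (-u * x) ∂μ) (Ici 0) := by
    refine continuousOn_of_dominated (bound := fun _ => 1) (fun u _ => by fun_prop)
      (fun u hu => hμ.norm_exp_le hu) (integrable_const _) ?_
    exact Eventually.of_forall fun x => by fun_prop
  exact (h.log fun u hu => (hμ.integral_exp_pos hu).ne').neg

theorem tendsto_laplaceExponent (hμ : IsProbOnNonneg μ) :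
    Tendsto (laplaceExponent μ) (𝓝[>] 0) (𝓝 0) := by
  have h := (hμ.continuousOn_laplaceExponent 0 self_mem_Ici).tendsto
  rw [hμ.laplaceExponent_zero] at h
  exact h.mono_left (nhdsWithin_mono _ Ioi_subset_Ici_self)

theorem monotoneOn_laplaceExponent (hμ : IsProbOnNonneg μ) :
    MonotoneOn (laplaceExponent μ) (Ici 0) := by
  intro u hu v hv huv
  have := hμ.isProbabilityMeasure
  refine neg_le_neg (Real.log_le_log (hμ.integral_exp_pos hv) ?_)
  refine integral_mono_ae (hμ.integrable_exp hv) (hμ.integrable_exp hu) ?_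
  filter_upwards [hμ.ae_nonneg] with x hx
  exact Real.exp_le_exp.2 (by nlinarith)

theorem laplaceExponent_nonneg (hμ : IsProbOnNonneg μ) {u : ℝ} (hu : 0 ≤ u) :
    0 ≤ laplaceExponent μ u := by
  have := hμ.monotoneOn_laplaceExponent self_mem_Ici hu hu
  rwa [hμ.laplaceExponent_zero] at this

theorem analyticOnNhd_laplaceExponent (hμ : IsProbOnNonneg μ) :
    AnalyticOnNhd ℝ (laplaceExponent μ) (Ioi 0) := by
  intro u hu
  have hmem : -u ∈ interior (integrableExpSet id μ) := by
    have h1 : Iio (0 : ℝ) ⊆ integrableExpSet id μ := fun v hv => by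
      have := hμ.integrable_exp (u := -v) (by simpa using (le_of_lt hv))
      simpa [integrableExpSet] using this
    have h2 := interior_mono h1
    rw [interior_Iio] at h2
    exact h2 (by simpa using hu)
  have h1 := (analyticAt_cgf hmem).comp_of_eq (analyticAt_id (𝕜 := ℝ)).neg rfl
  exact h1.neg

theorem hasDerivAt_laplaceExponent (hμ : IsProbOnNonneg μ) {u : ℝ} (hu : 0 < u) :
    HasDerivAt (laplaceExponent μ) (deriv (laplaceExponent μ) u) u :=
  (hμ.analyticOnNhd_laplaceExponent u hu).differentiableAt.hasDerivAt

theorem deriv_laplaceExponent_nonneg (hμ : IsProbOnNonneg μ) {u : ℝ} (hu : 0 < u) :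
    0 ≤ deriv (laplaceExponent μ) u := by
  have h1 := hμ.monotoneOn_laplaceExponent.mono (Ioi_subset_Ici_self (a := (0 : ℝ)))
  have h2 := h1.derivWithin_nonneg (x := u)
  rwa [derivWithin_of_isOpen isOpen_Ioi hu] at h2

theorem lintegral_deriv_laplaceExponent (hμ : IsProbOnNonneg μ) {U : ℝ} (hU : 0 < U) :
    ∫⁻ u in Ioo 0 U, ENNReal.ofReal (deriv (laplaceExponent μ) u) =
      ENNReal.ofReal (laplaceExponent μ U) := by
  have hc : ContinuousOn (laplaceExponent μ) (Icc 0 U) :=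
    hμ.continuousOn_laplaceExponent.mono Icc_subset_Ici_self
  have hi := intervalIntegral.integrableOn_deriv_of_nonneg hc
    (fun x hx => hμ.hasDerivAt_laplaceExponent hx.1)
    (fun x hx => hμ.deriv_laplaceExponent_nonneg hx.1)
  have h := intervalIntegral.integral_eq_sub_of_hasDerivAt_of_le hU.le hc
    (fun x hx => hμ.hasDerivAt_laplaceExponent hx.1)
    ((intervalIntegrable_iff_integrableOn_Ioc_of_le hU.le).2 hi)
  rw [hμ.laplaceExponent_zero, sub_zero, intervalIntegral.integral_of_le hU.le] at h
  rw [restrict_Ioo_eq_restrict_Ioc, ← h, ofReal_integral_eq_lintegral_ofReal hi]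
  filter_upwards [ae_restrict_mem measurableSet_Ioc] with x hx
  exact hμ.deriv_laplaceExponent_nonneg hx.1

theorem deriv_laplaceExponent_eq (hμ : IsProbOnNonneg μ) {g : ℝ → ℝ} (hg : ContinuousOn g (Ioi 0))
    (h0 : ∀ u, 0 < u → 0 ≤ g u)
    (h : ∀ U, 0 < U → ∫⁻ u in Ioo 0 U, ENNReal.ofReal (g u) = ENNReal.ofReal (laplaceExponent μ U))
    {u : ℝ} (hu : 0 < u) : deriv (laplaceExponent μ) u = g u := by
  have hpos : ∀ U, 0 ≤ᵐ[volume.restrict (Ioc 0 U)] g := fun U => by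
    filter_upwards [ae_restrict_mem measurableSet_Ioc] with x hx using h0 x hx.1
  have hm : ∀ U, AEStronglyMeasurable g (volume.restrict (Ioc 0 U)) := fun U =>
    (hg.mono fun x hx => hx.1).aestronglyMeasurable measurableSet_Ioc
  have hi : ∀ U, 0 < U → IntegrableOn g (Ioc 0 U) := fun U hU => by
    refine ⟨hm U, ?_⟩
    rw [hasFiniteIntegral_iff_ofReal (hpos U), ← restrict_Ioo_eq_restrict_Ioc, h U hU]
    exact ENNReal.ofReal_lt_top
  have heq : ∀ U, 0 < U → laplaceExponent μ U = ∫ x in (0 : ℝ)..U, g x := fun U hU => by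
    rw [intervalIntegral.integral_of_le hU.le, integral_eq_lintegral_of_nonneg_ae (hpos U) (hm U),
      ← restrict_Ioo_eq_restrict_Ioc, h U hU,
      ENNReal.toReal_ofReal (hμ.laplaceExponent_nonneg hU.le)]
  have hd := intervalIntegral.integral_hasDerivAt_right
    ((intervalIntegrable_iff_integrableOn_Ioc_of_le hu.le).2 (hi u hu))
    (hg.stronglyMeasurableAtFilter isOpen_Ioi u hu) (hg.continuousAt (Ioi_mem_nhds hu))
  have he : laplaceExponent μ =ᶠ[𝓝 u] fun U => ∫ x in (0 : ℝ)..U, g x := by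
    filter_upwards [Ioi_mem_nhds hu] with x hx using heq x hx
  rw [he.deriv_eq]
  exact hd.deriv

/-- A probability measure on `[0, ∞)` is determined by its Laplace exponent. -/
theorem eq_of_laplaceExponent_eq {ν : Measure ℝ} (hμ : IsProbOnNonneg μ) (hν : IsProbOnNonneg ν)
    (h : ∀ u, 0 < u → laplaceExponent μ u = laplaceExponent ν u) : μ = ν := by
  have := hμ.isProbabilityMeasure
  have := hν.isProbabilityMeasure
  refine measure_ext_of_integral_exp_neg_nat hμ.measure_Iio_zero hν.measure_Iio_zero fun n => ?_
  rw [← hμ.exp_neg_laplaceExponent n.cast_nonneg, ← hν.exp_neg_laplaceExponent n.cast_nonneg]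
  rcases n.eq_zero_or_pos with rfl | hn
  · simp [hμ.laplaceExponent_zero, hν.laplaceExponent_zero]
  · rw [h n (by exact_mod_cast hn)]

end IsProbOnNonneg

/-! ### Integrating a Bernstein function against `du / u` -/

theorem lintegral_exp_neg_mul {u t : ℝ} (hu : 0 < u) (ht : 0 < t) :
    ∫⁻ s in Ioo 0 t, ENNReal.ofReal (Real.exp (-(u * s))) =
      ENNReal.ofReal ((1 - Real.exp (-u * t)) / u) := by
  have hi : IntegrableOn (fun s => Real.exp (-(u * s))) (Ioc 0 t) :=
    ((by fun_prop : Continuous fun s => Real.exp (-(u * s))).integrableOn_Icc).mono_set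
      Ioc_subset_Icc_self
  have h := intervalIntegral.integral_eq_sub_of_hasDerivAt (a := 0) (b := t)
    (f := fun s => -(Real.exp (-(u * s)) / u)) (f' := fun s => Real.exp (-(u * s)))
    (fun s _ => by
      have h1 : HasDerivAt (fun s => -(u * s)) (-u) s := by
        simpa using ((hasDerivAt_id s).const_mul (-u))
      have h2 := (h1.exp.div_const u).neg
      convert! h2 using 1
      field_simp)
    ((by fun_prop : Continuous fun s => Real.exp (-(u * s))).intervalIntegrable _ _)
  rw [intervalIntegral.integral_of_le ht.le] at h
  rw [restrict_Ioo_eq_restrict_Ioc, ← ofReal_integral_eq_lintegral_ofReal hi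
    (Eventually.of_forall fun s => (Real.exp_pos _).le), h]
  congr 1
  rw [neg_mul]
  simp
  ring

theorem lintegral_one_sub_exp_div_comm {U t : ℝ} (hU : 0 < U) (ht : 0 < t) :
    ∫⁻ u in Ioo 0 U, ENNReal.ofReal ((1 - Real.exp (-u * t)) / u) =
      ∫⁻ s in Ioo 0 t, ENNReal.ofReal ((1 - Real.exp (-U * s)) / s) := by
  calc _ = ∫⁻ u in Ioo 0 U, ∫⁻ s in Ioo 0 t, ENNReal.ofReal (Real.exp (-(u * s))) :=
        setLIntegral_congr_fun measurableSet_Ioo fun u hu => (lintegral_exp_neg_mul hu.1 ht).symm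
    _ = ∫⁻ s in Ioo 0 t, ∫⁻ u in Ioo 0 U, ENNReal.ofReal (Real.exp (-(u * s))) :=
        lintegral_lintegral_swap (by fun_prop)
    _ = _ := setLIntegral_congr_fun measurableSet_Ioo fun s hs => by
        have e : -U * s = -s * U := by ring
        rw [e, ← lintegral_exp_neg_mul hs.1 hU]
        simp only [mul_comm]

/-- Tonelli's theorem for the integral of `(1 - e^{-ut}) / u` over `0 < u < U` and a Lévy density in
`t`: the result is a Bernstein function whose Lévy density is the tail divided by `s`. -/
theorem lintegral_bernstein_div {m : ℝ → ENNReal} (hm : AEMeasurable m (volume.restrict (Ioi 0)))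
    {U : ℝ} (hU : 0 < U) :
    ∫⁻ u in Ioo 0 U, ∫⁻ t in Ioi (0 : ℝ), ENNReal.ofReal ((1 - Real.exp (-u * t)) / u) * m t =
      ∫⁻ s in Ioi (0 : ℝ), ENNReal.ofReal ((1 - Real.exp (-U * s)) / s) * ∫⁻ t in Ioi s, m t := by
  have hm2 : AEMeasurable (fun p : ℝ × ℝ => m p.2)
      ((volume.restrict (Ioo 0 U)).prod (volume.restrict (Ioi 0))) := hm.comp_snd
  have hm3 : AEMeasurable (fun p : ℝ × ℝ => m p.1)
      ((volume.restrict (Ioi 0)).prod (volume.restrict (Ioi 0))) := hm.comp_fst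
  calc _ = ∫⁻ t in Ioi (0 : ℝ), ∫⁻ u in Ioo 0 U,
          ENNReal.ofReal ((1 - Real.exp (-u * t)) / u) * m t :=
        lintegral_lintegral_swap ((by fun_prop : Measurable fun p : ℝ × ℝ =>
          ENNReal.ofReal ((1 - Real.exp (-p.1 * p.2)) / p.1)).aemeasurable.mul hm2)
    _ = ∫⁻ t in Ioi (0 : ℝ), ∫⁻ s in Ioi (0 : ℝ),
          (Iio t).indicator (fun s => ENNReal.ofReal ((1 - Real.exp (-U * s)) / s) * m t) s := by
        refine setLIntegral_congr_fun measurableSet_Ioi fun t ht => ?_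
        rw [lintegral_mul_const _ (by fun_prop), lintegral_one_sub_exp_div_comm hU ht,
          lintegral_indicator measurableSet_Iio, Measure.restrict_restrict measurableSet_Iio,
          lintegral_mul_const _ (by fun_prop), inter_comm, Ioi_inter_Iio]
    _ = ∫⁻ s in Ioi (0 : ℝ), ∫⁻ t in Ioi (0 : ℝ),
          (Iio t).indicator (fun s => ENNReal.ofReal ((1 - Real.exp (-U * s)) / s) * m t) s := by
        refine lintegral_lintegral_swap ?_
        have h1 : AEMeasurable (fun p : ℝ × ℝ =>
            ENNReal.ofReal ((1 - Real.exp (-U * p.2)) / p.2) * m p.1)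
            ((volume.restrict (Ioi 0)).prod (volume.restrict (Ioi 0))) :=
          (by fun_prop : Measurable fun p : ℝ × ℝ =>
            ENNReal.ofReal ((1 - Real.exp (-U * p.2)) / p.2)).aemeasurable.mul hm3
        exact h1.indicator (measurableSet_lt measurable_snd measurable_fst)
    _ = _ := by
        refine setLIntegral_congr_fun measurableSet_Ioi fun s hs => ?_
        have hs' : 0 < s := hs
        have h1 : ∀ t, (Iio t).indicator
            (fun s => ENNReal.ofReal ((1 - Real.exp (-U * s)) / s) * m t) s =
            (Ioi s).indicator (fun t => ENNReal.ofReal ((1 - Real.exp (-U * s)) / s) * m t) t := by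
          intro t
          simp [indicator_apply]
        simp only [h1]
        rw [lintegral_indicator measurableSet_Ioi, Measure.restrict_restrict measurableSet_Ioi,
          Ioi_inter_Ioi, max_eq_left hs'.le, lintegral_const_mul'']
        exact hm.mono_measure (Measure.restrict_mono (Ioi_subset_Ioi hs'.le) le_rfl)

theorem HasBernsteinRep.lintegral_div {f m : ℝ → ℝ} {a : ℝ} (h : HasBernsteinRep f a m) {U : ℝ}
    (hU : 0 < U) :
    ∫⁻ u in Ioo 0 U, ENNReal.ofReal (f u / u) = ENNReal.ofReal (a * U) +
      ∫⁻ s in Ioi (0 : ℝ), ENNReal.ofReal ((1 - Real.exp (-U * s)) / s) *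
        ∫⁻ t in Ioi s, ENNReal.ofReal (m t) := by
  rw [← lintegral_bernstein_div h.aestronglyMeasurable.aemeasurable.ennreal_ofReal hU]
  have h1 : ENNReal.ofReal (a * U) = ∫⁻ _ in Ioo 0 U, ENNReal.ofReal a := by
    rw [setLIntegral_const, Real.volume_Ioo, sub_zero, ENNReal.ofReal_mul h.drift_nonneg]
  rw [h1, ← lintegral_add_left measurable_const]
  refine setLIntegral_congr_fun measurableSet_Ioo fun u hu => ?_
  have hu0 : 0 < u := hu.1
  have h2 : ∀ t, 0 < t → ENNReal.ofReal ((1 - Real.exp (-u * t)) / u) * ENNReal.ofReal (m t) =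
      ENNReal.ofReal u⁻¹ * ENNReal.ofReal ((1 - Real.exp (-u * t)) * m t) := by
    intro t ht
    rw [← ENNReal.ofReal_mul (div_nonneg (one_sub_exp_nonneg hu0 ht) hu0.le),
      ← ENNReal.ofReal_mul (inv_nonneg.2 hu0.le)]
    congr 1
    ring
  rw [setLIntegral_congr_fun measurableSet_Ioi h2, lintegral_const_mul' _ _ ENNReal.ofReal_ne_top,
    h.lintegral_eq hu0, ← ENNReal.ofReal_mul (inv_nonneg.2 hu0.le), ← ENNReal.ofReal_add
      h.drift_nonneg (mul_nonneg (inv_nonneg.2 hu0.le) (sub_nonneg.2 (h.drift_le hu0)))]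
  congr 1
  field_simp
  ring

namespace IsCompleteBernstein

variable {f g : ℝ → ℝ}

theorem congr (hf : IsCompleteBernstein f) (h : ∀ u, 0 < u → g u = f u) :
    IsCompleteBernstein g := by
  obtain ⟨a, m, hm, hr⟩ := hf
  exact ⟨a, m, hm, hr.congr h fun _ _ => rfl⟩

theorem comp_div (hf : IsCompleteBernstein f) {c : ℝ} (hc : 0 < c) :
    IsCompleteBernstein (fun u => f (u / c)) := by
  obtain ⟨a, m, hm, hr⟩ := hf
  exact ⟨_, _, hm.const_mul_comp_mul hc hc.le, hr.comp_div hc⟩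

end IsCompleteBernstein

theorem IsCompletelyMonotone.tendsto_atTop_zero {k : ℝ → ℝ} (hk : IsCompletelyMonotone k)
    (hi : IntegrableOn (fun t => min 1 t * (k t / t)) (Ioi 0)) : Tendsto k atTop (𝓝 0) := by
  -- `k` decreases to a limit; were it positive, `k t / t` would not be integrable at infinity
  rw [Metric.tendsto_atTop]
  intro ε hε
  have hex : ∃ T, 0 < T ∧ k T < ε := by
    by_contra! hcon
    have h1 : IntegrableOn (fun t : ℝ => t⁻¹) (Ioi 1) := by
      refine Integrable.mono' ((hi.mono_set (Ioi_subset_Ioi zero_le_one)).const_mul ε⁻¹)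
        (by fun_prop) ?_
      filter_upwards [ae_restrict_mem measurableSet_Ioi] with t ht
      have ht1 : 1 < t := ht
      have ht0 : 0 < t := by linarith
      rw [Real.norm_eq_abs, abs_of_pos (inv_pos.2 ht0), min_eq_left ht1.le, one_mul]
      have := hcon t ht0
      rw [← div_eq_inv_mul, div_div, mul_comm t ε, ← div_div, inv_eq_one_div]
      gcongr
      rwa [one_le_div hε]
    exact not_integrableOn_Ioi_inv h1
  obtain ⟨T, hT, hkT⟩ := hex
  refine ⟨T, fun t ht => ?_⟩
  have ht0 : 0 < t := lt_of_lt_of_le hT ht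
  rw [Real.dist_eq, sub_zero, abs_of_nonneg (hk.nonneg ht0)]
  exact (hk.antitoneOn hT ht0 ht).trans_lt hkT

/-! ### Thorin's class and the function `u ψ'(u)` -/

/-- If `ψ` has Lévy density `k(t)/t` with `k` completely monotone, then `u ψ'(u)` has Lévy density
`-k'`. -/
theorem IsThorin.isCompleteBernstein_mul_deriv {μ : Measure ℝ} (h : IsThorin μ) :
    IsCompleteBernstein (fun u => u * deriv (laplaceExponent μ) u) := by
  obtain ⟨hμ, a, k, hk, hr⟩ := h
  have hlim := hk.tendsto_atTop_zero hr.integrable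
  have hm := hk.neg_deriv
  have htail : ∀ s, 0 < s → ∫⁻ t in Ioi s, ENNReal.ofReal (-deriv k t) = ENNReal.ofReal (k s) := by
    intro s hs
    have hd : ∀ x ∈ Ici s, HasDerivAt k (deriv k x) x := fun x hx =>
      hk.hasDerivAt (lt_of_lt_of_le hs hx)
    have hn : ∀ x ∈ Ioi s, deriv k x ≤ 0 := fun x hx => by
      have := hm.nonneg (lt_trans hs hx)
      linarith
    have hi : IntegrableOn (fun t => -deriv k t) (Ioi s) :=
      (integrableOn_Ioi_deriv_of_nonpos' hd hn hlim).neg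
    rw [← ofReal_integral_eq_lintegral_ofReal hi, integral_neg,
      integral_Ioi_of_hasDerivAt_of_nonpos' hd hn hlim]
    · simp
    · filter_upwards [ae_restrict_mem measurableSet_Ioi] with t ht
      simpa using hn t ht
  have hK : ∀ U, 0 < U → ∫⁻ s in Ioi (0 : ℝ), ENNReal.ofReal ((1 - Real.exp (-U * s)) / s) *
      ∫⁻ t in Ioi s, ENNReal.ofReal (-deriv k t) =
      ENNReal.ofReal (laplaceExponent μ U - a * U) := by
    intro U hU
    rw [← hr.lintegral_eq hU]
    refine setLIntegral_congr_fun measurableSet_Ioi fun s hs => ?_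
    have hs' : 0 < s := hs
    rw [htail s hs, ← ENNReal.ofReal_mul (div_nonneg (one_sub_exp_nonneg hU hs) hs'.le)]
    congr 1
    ring
  have hmm : AEStronglyMeasurable (fun t => -deriv k t) (volume.restrict (Ioi 0)) :=
    hm.continuousOn.aestronglyMeasurable measurableSet_Ioi
  -- the double integral in `hK` is finite, hence so is the inner integral for some `u`
  have hint : IntegrableOn (fun t => min 1 t * -deriv k t) (Ioi 0) := by
    have h1 := lintegral_bernstein_div hmm.aemeasurable.ennreal_ofReal one_pos
    rw [hK 1 one_pos] at h1
    have h2 : AEMeasurable (fun u : ℝ => ∫⁻ t in Ioi (0 : ℝ),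
        ENNReal.ofReal ((1 - Real.exp (-u * t)) / u) * ENNReal.ofReal (-deriv k t))
        (volume.restrict (Ioo 0 1)) := by
      have := (by fun_prop : Measurable fun p : ℝ × ℝ =>
        ENNReal.ofReal ((1 - Real.exp (-p.1 * p.2)) / p.1)).aemeasurable
        (μ := (volume.restrict (Ioo 0 1)).prod (volume.restrict (Ioi 0))) |>.mul
        (hmm.aemeasurable.ennreal_ofReal.comp_snd)
      exact this.lintegral_prod_right'
    have h3 := ae_lt_top' h2 (h1.trans_ne ENNReal.ofReal_ne_top)
    have hne : (ae (volume.restrict (Ioo (0 : ℝ) 1))).NeBot :=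
      ae_restrict_neBot.2 (by simp)
    obtain ⟨u, hu, hu01⟩ := (h3.and (ae_restrict_mem measurableSet_Ioo)).exists
    have hu0 : 0 < u := hu01.1
    refine HasBernsteinRep.integrableOn_min_mul hu0 (fun t ht => hm.nonneg ht) hmm ?_
    have hnn : ∀ t, 0 < t → 0 ≤ (1 - Real.exp (-u * t)) / u * -deriv k t := fun t ht =>
      mul_nonneg (div_nonneg (one_sub_exp_nonneg hu0 ht) hu0.le) (hm.nonneg ht)
    have h4 : IntegrableOn (fun t => (1 - Real.exp (-u * t)) / u * -deriv k t) (Ioi 0) := by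
      refine ⟨(by fun_prop : Measurable fun t : ℝ =>
        (1 - Real.exp (-u * t)) / u).aestronglyMeasurable.mul hmm, ?_⟩
      rw [hasFiniteIntegral_iff_ofReal]
      · refine lt_of_le_of_lt (lintegral_mono_ae ?_) hu
        filter_upwards [ae_restrict_mem measurableSet_Ioi] with t ht
        rw [ENNReal.ofReal_mul (div_nonneg (one_sub_exp_nonneg hu0 ht) hu0.le)]
      · filter_upwards [ae_restrict_mem measurableSet_Ioi] with t ht using hnn t ht
    have h5 : IntegrableOn (fun t => u * ((1 - Real.exp (-u * t)) / u * -deriv k t)) (Ioi 0) :=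
      h4.const_mul u
    refine h5.congr_fun (fun t _ => ?_) measurableSet_Ioi
    field_simp
  let F : ℝ → ℝ := fun u => a * u + ∫ t in Ioi (0 : ℝ), (1 - Real.exp (-u * t)) * -deriv k t
  have hF : HasBernsteinRep F a (fun t => -deriv k t) :=
    ⟨hr.drift_nonneg, fun t ht => hm.nonneg ht, hint, fun u _ => rfl⟩
  refine ⟨a, _, hm, hF.congr (fun u hu => ?_) fun _ _ => rfl⟩
  have := hμ.deriv_laplaceExponent_eq (g := fun u => F u / u)
    (hF.continuousOn.div continuousOn_id fun u hu => ne_of_gt hu)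
    (fun u hu => div_nonneg (hF.nonneg hu) hu.le)
    (fun U hU => by
      rw [hF.lintegral_div hU, hK U hU, ← ENNReal.ofReal_add
        (mul_nonneg hr.drift_nonneg hU.le) (sub_nonneg.2 (hr.drift_le hU))]
      congr 1
      ring) hu
  rw [this]
  field_simp

/-- If `u ψ'(u)` has a completely monotone Lévy density `m`, then `ψ` has Lévy density `k(t)/t`, where
`k` is the tail integral of `m`. -/
theorem isThorin_of_isCompleteBernstein_mul_deriv {μ : Measure ℝ} (hμ : IsProbOnNonneg μ)
    (h : IsCompleteBernstein (fun u => u * deriv (laplaceExponent μ) u)) : IsThorin μ := by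
  obtain ⟨a, m, hm, hr⟩ := h
  let k : ℝ → ℝ := fun s => ∫ t in Ioi s, m t
  have hint : ∀ s, 0 < s → IntegrableOn m (Ioi s) := by
    intro s hs
    have hsub : Ioi s ⊆ Ioi 0 := Ioi_subset_Ioi hs.le
    have hmin : 0 < min 1 s := lt_min one_pos hs
    refine Integrable.mono' ((hr.integrable.mono_set hsub).const_mul (min 1 s)⁻¹)
      (hr.aestronglyMeasurable.mono_measure (Measure.restrict_mono hsub le_rfl)) ?_
    filter_upwards [ae_restrict_mem measurableSet_Ioi] with t ht
    have h0 := hm.nonneg (lt_trans hs ht)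
    rw [Real.norm_eq_abs, abs_of_nonneg h0, ← mul_assoc, ← div_eq_inv_mul]
    refine le_mul_of_one_le_left h0 ?_
    rw [one_le_div hmin]
    exact min_le_min_left 1 (le_of_lt ht)
  have hk0 : ∀ s, 0 < s → 0 ≤ k s := fun s hs =>
    setIntegral_nonneg measurableSet_Ioi fun t ht => hm.nonneg (lt_trans hs ht)
  have hkd : ∀ s, 0 < s → HasDerivAt k (-m s) s := by
    intro s hs
    have hs2 : 0 < s / 2 := by linarith
    have hii : IntervalIntegrable m volume (s / 2) s := by
      rw [intervalIntegrable_iff_integrableOn_Ioc_of_le (by linarith)]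
      exact (hint _ hs2).mono_set fun x hx => hx.1
    have h1 := (intervalIntegral.integral_hasDerivAt_right hii
      (hm.continuousOn.stronglyMeasurableAtFilter isOpen_Ioi s hs)
      (hm.continuousOn.continuousAt (Ioi_mem_nhds hs))).const_sub (k (s / 2))
    refine h1.congr_of_eventuallyEq ?_
    filter_upwards [Ioi_mem_nhds (show s / 2 < s by linarith)] with x hx
    have := intervalIntegral.integral_Ioi_sub_Ioi (hint _ hs2) (le_of_lt hx)
    rw [← this]
    simp [k]
  have hk : IsCompletelyMonotone k := hm.of_hasDerivAt hk0 hkd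
  have hadd : ∀ U, 0 < U → ENNReal.ofReal (a * U) + ∫⁻ s in Ioi (0 : ℝ),
      ENNReal.ofReal ((1 - Real.exp (-U * s)) * (k s / s)) =
      ENNReal.ofReal (laplaceExponent μ U) := by
    intro U hU
    have h1 := hr.lintegral_div hU
    have h2 : ∀ u ∈ Ioo 0 U, ENNReal.ofReal (u * deriv (laplaceExponent μ) u / u) =
        ENNReal.ofReal (deriv (laplaceExponent μ) u) := fun u hu => by
      rw [mul_div_cancel_left₀ _ hu.1.ne']
    rw [setLIntegral_congr_fun measurableSet_Ioo h2, hμ.lintegral_deriv_laplaceExponent hU] at h1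
    rw [h1]
    congr 1
    refine setLIntegral_congr_fun measurableSet_Ioi fun s hs => ?_
    have hs' : 0 < s := hs
    have h3 : ∫⁻ t in Ioi s, ENNReal.ofReal (m t) = ENNReal.ofReal (k s) := by
      rw [ofReal_integral_eq_lintegral_ofReal (hint s hs)]
      filter_upwards [ae_restrict_mem measurableSet_Ioi] with t ht
      exact hm.nonneg (lt_trans hs' ht)
    rw [h3, ← ENNReal.ofReal_mul (div_nonneg (one_sub_exp_nonneg hU hs) hs'.le)]
    congr 1
    ring
  have hle : ∀ U, 0 < U → a * U ≤ laplaceExponent μ U := fun U hU => by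
    have h1 : ENNReal.ofReal (a * U) ≤ ENNReal.ofReal (laplaceExponent μ U) := by
      rw [← hadd U hU]
      exact le_self_add
    exact (ENNReal.ofReal_le_ofReal_iff (hμ.laplaceExponent_nonneg hU.le)).1 h1
  refine ⟨hμ, a, k, hk, HasBernsteinRep.of_lintegral hr.drift_nonneg
    (fun t ht => div_nonneg (hk0 t ht) ht.le) ?_ hle fun U hU => ?_⟩
  · exact (hk.continuousOn.div continuousOn_id fun u hu => ne_of_gt hu).aestronglyMeasurable
      measurableSet_Ioi
  · rw [ENNReal.ofReal_sub _ (mul_nonneg hr.drift_nonneg hU.le), ← hadd U hU,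
      ENNReal.add_sub_cancel_left ENNReal.ofReal_ne_top]

/-! ### Thorin's class and scaling differences -/

/-- If `ψ` has Lévy density `k(t)/t`, then `ψ(u) - ψ(cu)` has Lévy density `(k(t) - k(t/c))/t`. -/
theorem IsThorin.isCompleteBernstein_sub {μ : Measure ℝ} (h : IsThorin μ) {c : ℝ}
    (hc : c ∈ Ioo (0 : ℝ) 1) :
    IsCompleteBernstein (fun u => laplaceExponent μ u - laplaceExponent μ (c * u)) := by
  obtain ⟨-, a, k, hk, hr⟩ := h
  have hc0 : 0 < c := hc.1
  have hb : 1 < c⁻¹ := (one_lt_inv₀ hc0).2 hc.2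
  have hb0 : 0 < c⁻¹ := by positivity
  have hle : ∀ t, 0 < t → k (c⁻¹ * t) ≤ k t := fun t ht =>
    hk.antitoneOn ht (mul_pos hb0 ht) (by nlinarith)
  have e : ∀ t, 0 < t → c⁻¹ * (k (c⁻¹ * t) / (c⁻¹ * t)) = k (c⁻¹ * t) / t := fun t ht => by
    field_simp
  have h1 := hr.sub (hr.comp_div hb0) (div_le_self hr.drift_nonneg hb.le) (fun t ht => by
    rw [e t ht]
    exact div_le_div_of_nonneg_right (hle t ht) ht.le)
  refine ⟨_, _, hk.sub_comp_mul_div hb, h1.congr (fun u _ => ?_) fun t ht => ?_⟩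
  · rw [div_inv_eq_mul, mul_comm]
  · rw [e t ht, sub_div]

/-- If the dyadic scaling difference `ψ(u) - ψ(u/2)` of a Laplace exponent is a complete Bernstein
function, then so is `ψ` itself, since `ψ(u)` is the sum of the differences
`ψ(u/2^i) - ψ(u/2^{i+1})`. -/
theorem IsProbOnNonneg.isCompleteBernstein_of_sub_half {μ : Measure ℝ} (hμ : IsProbOnNonneg μ)
    (h : IsCompleteBernstein (fun u => laplaceExponent μ u - laplaceExponent μ (1 / 2 * u))) :
    IsCompleteBernstein (laplaceExponent μ) := by
  obtain ⟨a, m, hm, hr⟩ := h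
  set ψ := laplaceExponent μ
  let M : ℕ → ℝ → ℝ := fun i t => 2 ^ i * m (2 ^ i * t)
  have hM : ∀ i, IsCompletelyMonotone (M i) := fun i =>
    hm.const_mul_comp_mul (by positivity) (by positivity)
  have hMr : ∀ i : ℕ, HasBernsteinRep (fun u => ψ (u / 2 ^ i) - ψ (u / 2 ^ (i + 1)))
      (a / 2 ^ i) (M i) := fun i =>
    (hr.comp_div (c := 2 ^ i) (by positivity)).congr (fun u _ => by
      congr 2
      rw [pow_succ]
      field_simp) fun _ _ => rfl
  have hψ : ∀ u, 0 < u → HasSum (fun i : ℕ => ψ (u / 2 ^ i) - ψ (u / 2 ^ (i + 1))) (ψ u) := by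
    intro u hu
    rw [hasSum_iff_tendsto_nat_of_nonneg (fun i => (hMr i).nonneg hu)]
    simp only [Finset.sum_range_sub' (fun i : ℕ => ψ (u / 2 ^ i)), pow_zero, div_one]
    have h1 : Tendsto (fun i : ℕ => u / 2 ^ i) atTop (𝓝[>] 0) := by
      rw [tendsto_nhdsWithin_iff]
      refine ⟨?_, Eventually.of_forall fun i => by simp only [mem_Ioi]; positivity⟩
      have := (tendsto_pow_atTop_nhds_zero_of_lt_one (r := (1 / 2 : ℝ)) (by norm_num)
        (by norm_num)).const_mul u
      simpa [div_eq_mul_inv] using this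
    simpa using (tendsto_const_nhds (x := ψ u)).sub (hμ.tendsto_laplaceExponent.comp h1)
  have ha : ∀ u, 0 < u → HasSum (fun i : ℕ => a / 2 ^ i * u) (2 * a * u) := by
    intro u _
    have := (hasSum_geometric_two.mul_left a).mul_right u
    convert! this using 2 with i
    · simp [div_eq_mul_inv]
    · ring
  have hsub : ∀ u, 0 < u → HasSum
      (fun i : ℕ => ψ (u / 2 ^ i) - ψ (u / 2 ^ (i + 1)) - a / 2 ^ i * u) (ψ u - 2 * a * u) :=
    fun u hu => (hψ u hu).sub (ha u hu)
  have hle : ∀ u, 0 < u → 2 * a * u ≤ ψ u := fun u hu => by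
    have := (hsub u hu).nonneg fun i => sub_nonneg.2 ((hMr i).drift_le hu)
    linarith
  have hlint : ∀ u, 0 < u → ∫⁻ t in Ioi (0 : ℝ), ∑' i,
      ENNReal.ofReal ((1 - Real.exp (-u * t)) * M i t) = ENNReal.ofReal (ψ u - 2 * a * u) := by
    intro u hu
    rw [lintegral_tsum fun i =>
      ((hMr i).integrableOn hu).aestronglyMeasurable.aemeasurable.ennreal_ofReal]
    simp only [(hMr _).lintegral_eq hu]
    rw [← ENNReal.ofReal_tsum_of_nonneg (fun i => sub_nonneg.2 ((hMr i).drift_le hu))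
      (hsub u hu).summable, (hsub u hu).tsum_eq]
  have hsum : ∀ t, 0 < t → Summable fun i => M i t := by
    intro t ht
    -- summability holds at almost every point, hence at some point to the left of `t`
    have h1 := ae_lt_top' (AEMeasurable.tsum fun i =>
      ((hMr i).integrableOn one_pos).aestronglyMeasurable.aemeasurable.ennreal_ofReal)
      ((hlint 1 one_pos).trans_ne ENNReal.ofReal_ne_top)
    have h2 := ae_restrict_of_ae_restrict_of_subset (Ioo_subset_Ioi_self : Ioo (0 : ℝ) t ⊆ Ioi 0) h1
    have hne : (ae (volume.restrict (Ioo (0 : ℝ) t))).NeBot :=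
      ae_restrict_neBot.2 (by simpa using ht)
    obtain ⟨s, hs, hst⟩ := (h2.and (ae_restrict_mem measurableSet_Ioo)).exists
    have hs0 : 0 < s := hst.1
    have hpos : 0 < 1 - Real.exp (-1 * s) := by
      have : Real.exp (-1 * s) < 1 := Real.exp_lt_one_iff.2 (by linarith)
      linarith
    have h3 : Summable fun i => (1 - Real.exp (-1 * s)) * M i s := by
      have := ENNReal.summable_toReal hs.ne
      refine this.congr fun i => ?_
      rw [ENNReal.toReal_ofReal (mul_nonneg hpos.le ((hM i).nonneg hs0))]
    exact Summable.of_nonneg_of_le (fun i => (hM i).nonneg ht)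
      (fun i => (hM i).antitoneOn hs0 ht hst.2.le) ((summable_mul_left_iff hpos.ne').1 h3)
  have hcm : IsCompletelyMonotone (fun t => ∑' i, M i t) := by
    have hi : ∀ t, 0 < t → Integrable (fun i => M i t) Measure.count := fun t ht =>
      integrable_count_iff.2 (hsum t ht).norm
    refine (IsCompletelyMonotone.integral (ν := Measure.count) (Eventually.of_forall hM) hi).congr
      fun t ht => ?_
    rw [integral_countable (hi t ht)]
    simp [Measure.real]
  refine ⟨2 * a, _, hcm, HasBernsteinRep.of_lintegral (by linarith [hr.drift_nonneg])
    (fun t ht => hcm.nonneg ht) (hcm.continuousOn.aestronglyMeasurable measurableSet_Ioi) hle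
    fun u hu => ?_⟩
  rw [← hlint u hu]
  refine setLIntegral_congr_fun measurableSet_Ioi fun t ht => ?_
  rw [← ENNReal.ofReal_tsum_of_nonneg
    (fun i => mul_nonneg (one_sub_exp_nonneg hu ht) ((hM i).nonneg ht))
    ((hsum t ht).mul_left _), tsum_mul_left]

/-- If all scaling differences of `ψ` are complete Bernstein functions, then so is `ψ`, with density
`n`, say, and by uniqueness the differences have the densities `n(t) - b n(bt)`, where `b = 1/c`. Since
these are completely monotone for all `b > 1`, so is `t n(t)`. -/
theorem isThorin_of_isCompleteBernstein_sub {μ : Measure ℝ} (hμ : IsProbOnNonneg μ)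
    (h : ∀ c ∈ Ioo (0 : ℝ) 1,
      IsCompleteBernstein (fun u => laplaceExponent μ u - laplaceExponent μ (c * u))) :
    IsThorin μ := by
  obtain ⟨a, n, hn, hr⟩ := hμ.isCompleteBernstein_of_sub_half (h (1 / 2) (by norm_num))
  refine ⟨hμ, a, fun t => t * n t, hn.id_mul fun b hb => ?_,
    hr.congr (fun _ _ => rfl) fun t ht => mul_div_cancel_left₀ _ (ne_of_gt ht)⟩
  have hb0 : 0 < b := by linarith
  obtain ⟨a', m, hm, hr'⟩ := h b⁻¹ ⟨inv_pos.2 hb0, inv_lt_one_of_one_lt₀ hb⟩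
  have h1 : HasBernsteinRep (laplaceExponent μ) (a' + a / b) (fun t => m t + b * n (b * t)) :=
    (hr'.add (hr.comp_div hb0)).congr (fun u _ => by
      rw [div_eq_inv_mul, sub_add_cancel]) fun _ _ => rfl
  have h2 := hr.density_unique h1 hn.continuousOn
    (hm.continuousOn.add (hn.const_mul_comp_mul hb0 hb0.le).continuousOn)
  exact hm.congr fun t ht => by rw [h2 t ht, add_sub_cancel_right]

/-! ### Almost sure finiteness from Laplace transforms -/

/-- If nonnegative random variables `Z n` converge in `[0, ∞]` and their Laplace transforms are
bounded below by a function tending to `1` at `0`, uniformly in `n`, then the limit is finite. -/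
theorem ae_ne_top_of_le_integral_exp {Ω : Type*} [MeasurableSpace Ω] {P : Measure Ω}
    [IsProbabilityMeasure P] {Z : ℕ → Ω → ℝ} {W : Ω → ENNReal} (hZ : ∀ n, AEMeasurable (Z n) P)
    (h0 : ∀ n, ∀ᵐ ω ∂P, 0 ≤ Z n ω)
    (hlim : ∀ᵐ ω ∂P, Tendsto (fun n => ENNReal.ofReal (Z n ω)) atTop (𝓝 (W ω))) {κ : ℝ → ℝ}
    (hκ : ∀ u, 0 < u → ∀ n, Real.exp (-κ u) ≤ ∫ ω, Real.exp (-u * Z n ω) ∂P)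
    (hκ0 : Tendsto κ (𝓝[>] 0) (𝓝 0)) : ∀ᵐ ω ∂P, W ω ≠ ⊤ := by
  have hW : AEMeasurable W P :=
    aemeasurable_of_tendsto_metrizable_ae atTop (fun n => (hZ n).ennreal_ofReal) hlim
  have hset : NullMeasurableSet {ω | W ω ≠ ⊤} P :=
    (hW.nullMeasurableSet_preimage (measurableSet_singleton ⊤)).compl
  have hbound : ∀ u, 0 < u → Real.exp (-κ u) ≤ P.real {ω | W ω ≠ ⊤} := by
    intro u hu
    classical
    have hdct := tendsto_integral_of_dominated_convergence (μ := P)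
      (F := fun n ω => Real.exp (-u * Z n ω))
      (f := fun ω => if W ω = ⊤ then 0 else Real.exp (-u * (W ω).toReal)) (fun _ => (1 : ℝ))
      (fun n => (Real.measurable_exp.comp_aemeasurable
        ((hZ n).const_mul (-u))).aestronglyMeasurable) (integrable_const _)
      (fun n => by
        filter_upwards [h0 n] with ω hω
        rw [Real.norm_eq_abs, abs_of_pos (Real.exp_pos _), Real.exp_le_one_iff]
        nlinarith)
      (by
        filter_upwards [hlim, ae_all_iff.2 h0] with ω hω hω0
        split_ifs with htop
        · rw [htop] at hω
          have h1 : Tendsto (fun n => Z n ω) atTop atTop := by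
            rw [tendsto_atTop]
            intro b
            filter_upwards [hω.eventually (lt_mem_nhds (ENNReal.ofReal_lt_top (r := b)))] with n hn
            exact (ENNReal.lt_ofReal_iff_toReal_lt ENNReal.ofReal_ne_top).1 hn |>.le.trans'
              (by rw [ENNReal.toReal_ofReal']; exact le_max_left _ _)
          have h2 : Tendsto (fun n => -u * Z n ω) atTop atBot :=
            h1.const_mul_atTop_of_neg (by linarith)
          exact Real.tendsto_exp_atBot.comp h2
        · have h1 := (ENNReal.tendsto_toReal htop).comp hω
          have h2 : Tendsto (fun n => Z n ω) atTop (𝓝 (W ω).toReal) := by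
            refine h1.congr fun n => ?_
            simp [hω0 n]
          exact ((Real.continuous_exp.tendsto _).comp (h2.const_mul (-u))))
    refine (ge_of_tendsto hdct (Eventually.of_forall (hκ u hu))).trans ?_
    have hind : P.real {ω | W ω ≠ ⊤} = ∫ ω, {ω | W ω ≠ ⊤}.indicator (1 : Ω → ℝ) ω ∂P := by
      rw [integral_indicator₀ hset]
      simp
    rw [hind]
    refine integral_mono_of_nonneg (Eventually.of_forall fun ω => ?_)
      ((integrable_const (1 : ℝ)).indicator₀ hset)
      (Eventually.of_forall fun ω => ?_)
    · simp only [Pi.zero_apply]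
      split_ifs
      · exact le_rfl
      · exact (Real.exp_pos _).le
    · by_cases h : W ω = ⊤
      · simp [h]
      · simp only [h, if_false, indicator_apply, mem_ofPred_eq, ne_eq, not_false_eq_true, if_true,
          Pi.one_apply, Real.exp_le_one_iff]
        have := ENNReal.toReal_nonneg (a := W ω)
        nlinarith
  have hone : 1 ≤ P.real {ω | W ω ≠ ⊤} := by
    have h1 : Tendsto (fun u => Real.exp (-κ u)) (𝓝[>] 0) (𝓝 1) := by
      simpa [Function.comp_def] using (Real.continuous_exp.tendsto _).comp hκ0.neg
    refine le_of_tendsto h1 ?_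
    filter_upwards [self_mem_nhdsWithin] with u hu using hbound u hu
  have h2 : P {ω | W ω ≠ ⊤} = 1 := by
    refine le_antisymm prob_le_one ?_
    rw [← ENNReal.ofReal_one]
    exact (ENNReal.ofReal_le_iff_le_toReal (measure_ne_top _ _)).2 hone
  exact (mem_ae_iff_prob_eq_one₀ hset).2 h2

/-! ### Poisson point processes -/

section Poisson

variable {E : Type*} [MeasurableSpace E]

/-- An s-finite measure is a countable sum of multiples of probability measures. -/
theorem exists_eq_sum_smul_isProbabilityMeasure [Nonempty E] (Λ : Measure E) [SFinite Λ] :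
    ∃ (r : ℕ → ℝ≥0) (ν : ℕ → Measure E), (∀ j, IsProbabilityMeasure (ν j)) ∧
      Λ = Measure.sum fun j => r j • ν j := by
  have h : ∀ j, ∃ (r : ℝ≥0) (ν : Measure E), IsProbabilityMeasure ν ∧ sfiniteSeq Λ j = r • ν := by
    intro j
    let κ : FiniteMeasure E := ⟨sfiniteSeq Λ j, inferInstance⟩
    refine ⟨κ.mass, κ.normalize, inferInstance, ?_⟩
    have h1 := congrArg FiniteMeasure.toMeasure κ.self_eq_mass_smul_normalize
    rw [FiniteMeasure.toMeasure_smul] at h1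
    exact h1
  choose r ν hν hr using h
  refine ⟨r, ν, hν, ?_⟩
  simp only [← hr, sum_sfiniteSeq]

/-- The law of a finite random collection of points of `E`: the number of points is Poisson with
parameter `r`, and the points are independent with law `ν`. Only the first `c.1` terms of the
sequence `c.2` count as points of `c : ℕ × (ℕ → E)`. -/
noncomputable def cloudLaw (r : ℝ≥0) (ν : Measure E) [IsProbabilityMeasure ν] :
    Measure (ℕ × (ℕ → E)) :=
  (poissonMeasure r).prod (Measure.infinitePi fun _ : ℕ => ν)

instance (r : ℝ≥0) (ν : Measure E) [IsProbabilityMeasure ν] :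
    IsProbabilityMeasure (cloudLaw r ν) := by
  unfold cloudLaw
  infer_instance

theorem measurable_prod_range {M : Type*} [CommMonoid M] [MeasurableSpace M] [MeasurableMul₂ M]
    {g : E → M} (hg : Measurable g) :
    Measurable fun c : ℕ × (ℕ → E) => ∏ i ∈ Finset.range c.1, g (c.2 i) :=
  measurable_from_prod_countable_right fun n =>
    Finset.measurable_fun_prod (Finset.range n) (f := fun i (ξ : ℕ → E) => g (ξ i))
      fun i _ => hg.comp (measurable_pi_apply i)

theorem measurable_sum_range {M : Type*} [AddCommMonoid M] [MeasurableSpace M] [MeasurableAdd₂ M]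
    {g : E → M} (hg : Measurable g) :
    Measurable fun c : ℕ × (ℕ → E) => ∑ i ∈ Finset.range c.1, g (c.2 i) :=
  measurable_from_prod_countable_right fun n =>
    Finset.measurable_fun_sum (Finset.range n) (f := fun i (ξ : ℕ → E) => g (ξ i))
      fun i _ => hg.comp (measurable_pi_apply i)

theorem integral_pow_poissonMeasure (r : ℝ≥0) (z : ℂ) :
    ∫ n, z ^ n ∂(poissonMeasure r) = Complex.exp (r * (z - 1)) := by
  rw [integral_poissonMeasure]
  calc ∑' n : ℕ, (Real.exp (-r) * r ^ n / n.factorial) • z ^ n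
      = ∑' n : ℕ, (Real.exp (-r) : ℂ) * ((r * z) ^ n / n.factorial) := by
        congr with n
        rw [Complex.real_smul]
        push_cast
        rw [mul_pow]
        ring
    _ = Complex.exp (r * (z - 1)) := by
        rw [tsum_mul_left, (NormedSpace.expSeries_div_hasSum_exp ((r : ℂ) * z)).tsum_eq,
          ← Complex.exp_eq_exp_ℂ, Complex.ofReal_exp, ← Complex.exp_add]
        push_cast
        ring_nf

theorem integral_prod_infinitePi {ν : Measure E} [IsProbabilityMeasure ν] {g : E → ℂ}
    (hg : Measurable g) (n : ℕ) :
    ∫ ξ, ∏ i ∈ Finset.range n, g (ξ i) ∂(Measure.infinitePi fun _ : ℕ => ν) =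
      (∫ x, g x ∂ν) ^ n := by
  have h1 : iIndepFun (fun (i : Fin n) (ξ : ℕ → E) => g (ξ i))
      (Measure.infinitePi fun _ : ℕ => ν) :=
    (iIndepFun_infinitePi (P := fun _ : ℕ => ν) (X := fun _ => g) fun _ => hg).precomp
      Fin.val_injective
  simp only [Finset.prod_range]
  rw [h1.integral_fun_prod_eq_prod_integral
    fun i => (hg.comp (measurable_pi_apply _)).aestronglyMeasurable]
  have h2 : ∀ i : ℕ, ∫ ξ : ℕ → E, g (ξ i) ∂(Measure.infinitePi fun _ : ℕ => ν) = ∫ x, g x ∂ν := by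
    intro i
    have hmp := measurePreserving_eval_infinitePi (fun _ : ℕ => ν) i
    have := integral_map hmp.measurable.aemeasurable
      (f := g) (μ := Measure.infinitePi fun _ : ℕ => ν) hg.aestronglyMeasurable
    rw [hmp.map_eq] at this
    exact this.symm
  simp [h2]

/-- The probability generating functional of a single cloud. -/
theorem integral_prod_cloudLaw (r : ℝ≥0) (ν : Measure E) [IsProbabilityMeasure ν] {g : E → ℂ}
    (hg : Measurable g) (hg1 : ∀ x, ‖g x‖ ≤ 1) :
    ∫ c, ∏ i ∈ Finset.range c.1, g (c.2 i) ∂(cloudLaw r ν) =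
      Complex.exp (∫ x, (g x - 1) ∂(r • ν)) := by
  have hi : Integrable (fun c : ℕ × (ℕ → E) => ∏ i ∈ Finset.range c.1, g (c.2 i))
      ((poissonMeasure r).prod (Measure.infinitePi fun _ : ℕ => ν)) := by
    refine Integrable.of_bound (measurable_prod_range hg).aestronglyMeasurable 1
      (Eventually.of_forall fun c => ?_)
    rw [norm_prod]
    exact Finset.prod_le_one (fun _ _ => norm_nonneg _) fun _ _ => hg1 _
  rw [cloudLaw, integral_prod _ hi]
  simp only [integral_prod_infinitePi hg]
  rw [integral_pow_poissonMeasure]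
  congr 1
  have hgi : Integrable g ν := Integrable.of_bound hg.aestronglyMeasurable 1
    (Eventually.of_forall hg1)
  rw [integral_smul_nnreal_measure, integral_sub hgi (integrable_const _)]
  simp [NNReal.smul_def]

variable (r : ℕ → ℝ≥0) (ν : ℕ → Measure E) [∀ j, IsProbabilityMeasure (ν j)]

/-- The law of a sequence of independent clouds; their union is a Poisson point process with
intensity `∑ j, r j • ν j`. -/
noncomputable def cloudSeqLaw : Measure (ℕ → ℕ × (ℕ → E)) :=
  Measure.infinitePi fun j => cloudLaw (r j) (ν j)

instance : IsProbabilityMeasure (cloudSeqLaw r ν) := by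
  unfold cloudSeqLaw
  infer_instance

/-- The probability generating functional of the union of the first `J` clouds. -/
theorem integral_prod_cloudSeqLaw {g : E → ℂ} (hg : Measurable g) (hg1 : ∀ x, ‖g x‖ ≤ 1) (J : ℕ) :
    ∫ ω, ∏ j ∈ Finset.range J, ∏ i ∈ Finset.range (ω j).1, g ((ω j).2 i) ∂(cloudSeqLaw r ν) =
      Complex.exp (∑ j ∈ Finset.range J, ∫ x, (g x - 1) ∂(r j • ν j)) := by
  have h1 : iIndepFun (fun (j : Fin J) (ω : ℕ → ℕ × (ℕ → E)) =>
      ∏ i ∈ Finset.range (ω j).1, g ((ω j).2 i)) (cloudSeqLaw r ν) :=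
    (iIndepFun_infinitePi (P := fun j => cloudLaw (r j) (ν j))
      (X := fun _ c => ∏ i ∈ Finset.range c.1, g (c.2 i))
      fun _ => measurable_prod_range hg).precomp Fin.val_injective
  rw [Complex.exp_sum]
  simp only [Finset.prod_range (n := J)]
  rw [h1.integral_fun_prod_eq_prod_integral fun j =>
    ((measurable_prod_range hg).comp (measurable_pi_apply _)).aestronglyMeasurable]
  refine Finset.prod_congr rfl fun j _ => ?_
  rw [← integral_prod_cloudLaw (r j) (ν j) hg hg1]
  have hmp := measurePreserving_eval_infinitePi (fun j => cloudLaw (r j) (ν j)) (j : ℕ)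
  have := integral_map hmp.measurable.aemeasurable
    (μ := Measure.infinitePi fun j => cloudLaw (r j) (ν j))
    (f := fun c : ℕ × (ℕ → E) => ∏ i ∈ Finset.range c.1, g (c.2 i))
    (measurable_prod_range hg).aestronglyMeasurable
  rw [hmp.map_eq] at this
  exact this.symm

/-- The sum of the values of `h` at the points of the first `J` clouds. -/
noncomputable def cloudSum (h : E → ℝ) (J : ℕ) (ω : ℕ → ℕ × (ℕ → E)) : ℝ :=
  ∑ j ∈ Finset.range J, ∑ i ∈ Finset.range (ω j).1, h ((ω j).2 i)

theorem measurable_cloudSum {h : E → ℝ} (hh : Measurable h) (J : ℕ) :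
    Measurable (cloudSum h J) :=
  Finset.measurable_fun_sum _ fun j _ => (measurable_sum_range hh).comp (measurable_pi_apply j)

theorem integral_exp_neg_cloudSum {h : E → ℝ} (hh : Measurable h) (h0 : ∀ x, 0 ≤ h x) (J : ℕ) :
    ∫ ω, Real.exp (-cloudSum h J ω) ∂(cloudSeqLaw r ν) =
      Real.exp (-∑ j ∈ Finset.range J, ∫ x, (1 - Real.exp (-h x)) ∂(r j • ν j)) := by
  have key := integral_prod_cloudSeqLaw r ν (g := fun x => ((Real.exp (-h x) : ℝ) : ℂ))
    (by fun_prop) (fun x => by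
      rw [Complex.norm_real, Real.norm_eq_abs, abs_of_pos (Real.exp_pos _), Real.exp_le_one_iff]
      linarith [h0 x]) J
  have e1 : ∀ ω : ℕ → ℕ × (ℕ → E), ∏ j ∈ Finset.range J, ∏ i ∈ Finset.range (ω j).1,
      ((Real.exp (-h ((ω j).2 i)) : ℝ) : ℂ) = ((Real.exp (-cloudSum h J ω) : ℝ) : ℂ) := by
    intro ω
    rw [cloudSum, ← Finset.sum_neg_distrib, Real.exp_sum]
    simp only [← Finset.sum_neg_distrib, Real.exp_sum]
    push_cast
    rfl
  simp only [e1] at key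
  rw [integral_complex_ofReal] at key
  have e2 : ∑ j ∈ Finset.range J, ∫ x, (((Real.exp (-h x) : ℝ) : ℂ) - 1) ∂(r j • ν j) =
      ((-∑ j ∈ Finset.range J, ∫ x, (1 - Real.exp (-h x)) ∂(r j • ν j) : ℝ) : ℂ) := by
    rw [← Finset.sum_neg_distrib, Complex.ofReal_sum]
    refine Finset.sum_congr rfl fun j _ => ?_
    rw [← integral_neg, ← integral_complex_ofReal]
    congr 1
    funext x
    push_cast
    ring
  rw [e2, ← Complex.ofReal_exp] at key
  exact_mod_cast key

theorem integral_exp_mul_I_cloudSum {h : E → ℝ} (hh : Measurable h) (J : ℕ) :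
    ∫ ω, Complex.exp (cloudSum h J ω * Complex.I) ∂(cloudSeqLaw r ν) =
      Complex.exp (∑ j ∈ Finset.range J, ∫ x, (Complex.exp (h x * Complex.I) - 1) ∂(r j • ν j)) := by
  have key := integral_prod_cloudSeqLaw r ν (g := fun x => Complex.exp (h x * Complex.I))
    (by fun_prop) (fun x => (Complex.norm_exp_ofReal_mul_I _).le) J
  rw [← key]
  congr 1
  funext ω
  rw [cloudSum]
  push_cast
  rw [Finset.sum_mul, Complex.exp_sum]
  refine Finset.prod_congr rfl fun j _ => ?_
  rw [Finset.sum_mul, Complex.exp_sum]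

variable {r ν}

/-- The characteristic function of a sum over all points of a Poisson point process with intensity
`Λ`. -/
theorem integral_exp_mul_I_of_tendsto_cloudSum {Λ : Measure E}
    (hΛ : Λ = Measure.sum fun j => r j • ν j) {h : E → ℝ} (hh : Measurable h)
    (hi : Integrable (fun x => Complex.exp (h x * Complex.I) - 1) Λ)
    {Z : (ℕ → ℕ × (ℕ → E)) → ℝ}
    (hZ : ∀ᵐ ω ∂(cloudSeqLaw r ν), Tendsto (fun J => cloudSum h J ω) atTop (𝓝 (Z ω))) :
    ∫ ω, Complex.exp (Z ω * Complex.I) ∂(cloudSeqLaw r ν) =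
      Complex.exp (∫ x, (Complex.exp (h x * Complex.I) - 1) ∂Λ) := by
  have h1 : Tendsto (fun J => ∫ ω, Complex.exp (cloudSum h J ω * Complex.I) ∂(cloudSeqLaw r ν))
      atTop (𝓝 (∫ ω, Complex.exp (Z ω * Complex.I) ∂(cloudSeqLaw r ν))) := by
    refine tendsto_integral_of_dominated_convergence (fun _ => (1 : ℝ)) (fun J => ?_)
      (integrable_const _) (fun J => Eventually.of_forall fun ω =>
        (Complex.norm_exp_ofReal_mul_I _).le) ?_
    · have := measurable_cloudSum hh J
      exact (by fun_prop : Measurable fun ω =>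
        Complex.exp (cloudSum h J ω * Complex.I)).aestronglyMeasurable
    · filter_upwards [hZ] with ω hω
      exact ((by fun_prop : Continuous fun x : ℝ =>
        Complex.exp (x * Complex.I)).tendsto _).comp hω
  simp only [integral_exp_mul_I_cloudSum r ν hh] at h1
  refine tendsto_nhds_unique h1 ((Complex.continuous_exp.tendsto _).comp ?_)
  rw [hΛ] at hi ⊢
  exact (hasSum_integral_measure hi).tendsto_sum_nat

/-- A lower bound for the Laplace transforms of the partial sums over a Poisson point process with
intensity `Λ`, and their limit. -/
theorem tendsto_integral_exp_neg_cloudSum {Λ : Measure E}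
    (hΛ : Λ = Measure.sum fun j => r j • ν j) {h : E → ℝ} (hh : Measurable h) (h0 : ∀ x, 0 ≤ h x)
    (hi : Integrable (fun x => 1 - Real.exp (-h x)) Λ) :
    (∀ J, Real.exp (-∫ x, (1 - Real.exp (-h x)) ∂Λ) ≤
      ∫ ω, Real.exp (-cloudSum h J ω) ∂(cloudSeqLaw r ν)) ∧
    Tendsto (fun J => ∫ ω, Real.exp (-cloudSum h J ω) ∂(cloudSeqLaw r ν)) atTop
      (𝓝 (Real.exp (-∫ x, (1 - Real.exp (-h x)) ∂Λ))) := by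
  have hnn : ∀ x, 0 ≤ 1 - Real.exp (-h x) := fun x => by
    have : Real.exp (-h x) ≤ 1 := Real.exp_le_one_iff.2 (by linarith [h0 x])
    linarith
  simp only [integral_exp_neg_cloudSum r ν hh h0]
  rw [hΛ] at hi ⊢
  have hs := hasSum_integral_measure hi
  refine ⟨fun J => Real.exp_le_exp.2 (neg_le_neg ?_),
    (Real.continuous_exp.tendsto _).comp hs.tendsto_sum_nat.neg⟩
  exact sum_le_hasSum _ (fun j _ => integral_nonneg hnn) hs

end Poisson

/-! ### Existence of subordinators -/

section Windows

/-- The contribution of a point `p = (τ, x)`, which stands for a jump of size `x⁺` at time `τ`, to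
the sum of the jumps at times in `B`. -/
noncomputable def windowJump (B : Set ℝ) (p : ℝ × ℝ) : ℝ := B.indicator 1 p.1 * max p.2 0

theorem windowJump_nonneg (B : Set ℝ) (p : ℝ × ℝ) : 0 ≤ windowJump B p :=
  mul_nonneg (indicator_nonneg (fun _ _ => zero_le_one) _) (le_max_right _ _)

theorem measurable_windowJump {B : Set ℝ} (hB : MeasurableSet B) : Measurable (windowJump B) :=
  ((measurable_one.indicator hB).comp measurable_fst).mul (measurable_snd.max measurable_const)

/-- The random measure on the time axis which has an atom of mass `x⁺` at `τ` for each point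
`(τ, x)` of the clouds. -/
noncomputable def jumpMeasure (ω : ℕ → ℕ × (ℕ → ℝ × ℝ)) : Measure ℝ :=
  Measure.sum fun j => ∑ i ∈ Finset.range (ω j).1,
    ENNReal.ofReal ((ω j).2 i).2 • Measure.dirac ((ω j).2 i).1

theorem tendsto_cloudSum_windowJump {B : Set ℝ} (hB : MeasurableSet B)
    (ω : ℕ → ℕ × (ℕ → ℝ × ℝ)) :
    Tendsto (fun J => ENNReal.ofReal (cloudSum (windowJump B) J ω)) atTop
      (𝓝 (jumpMeasure ω B)) := by
  have h1 : jumpMeasure ω B = ∑' j, ENNReal.ofReal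
      (∑ i ∈ Finset.range (ω j).1, windowJump B ((ω j).2 i)) := by
    rw [jumpMeasure, Measure.sum_apply _ hB]
    congr 1
    funext j
    rw [ENNReal.ofReal_sum_of_nonneg fun i _ => windowJump_nonneg B _, Measure.finsetSum_apply]
    refine Finset.sum_congr rfl fun i _ => ?_
    rw [Measure.smul_apply, Measure.dirac_apply' _ hB, smul_eq_mul, windowJump]
    by_cases h : ((ω j).2 i).1 ∈ B
    · simp only [h, indicator_of_mem, Pi.one_apply, mul_one, one_mul]
      rw [ENNReal.ofReal_max, ENNReal.ofReal_zero, max_eq_left (zero_le)]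
    · simp [h]
  rw [h1]
  refine (ENNReal.tendsto_nat_tsum _).congr fun J => ?_
  rw [cloudSum, ENNReal.ofReal_sum_of_nonneg fun j _ =>
    Finset.sum_nonneg fun i _ => windowJump_nonneg B _]

theorem measurable_jumpMeasure {B : Set ℝ} (hB : MeasurableSet B) :
    Measurable fun ω => jumpMeasure ω B :=
  measurable_of_tendsto_metrizable
    (fun J => (measurable_cloudSum (measurable_windowJump hB) J).ennreal_ofReal)
    (tendsto_pi_nhds.2 fun ω => tendsto_cloudSum_windowJump hB ω)

theorem tendsto_cloudSum_toReal {B : Set ℝ} (hB : MeasurableSet B) {ω : ℕ → ℕ × (ℕ → ℝ × ℝ)}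
    (h : jumpMeasure ω B ≠ ⊤) :
    Tendsto (fun J => cloudSum (windowJump B) J ω) atTop (𝓝 (jumpMeasure ω B).toReal) := by
  refine ((ENNReal.tendsto_toReal h).comp (tendsto_cloudSum_windowJump hB ω)).congr fun J => ?_
  exact ENNReal.toReal_ofReal (Finset.sum_nonneg fun j _ => Finset.sum_nonneg fun i _ =>
    windowJump_nonneg B _)

end Windows

section Exponents

variable {η : Measure ℝ}

theorem one_sub_exp_neg_le_min {y : ℝ} : 1 - Real.exp (-y) ≤ min 1 y :=
  le_min (by linarith [Real.exp_pos (-y)]) (by linarith [Real.add_one_le_exp (-y)])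

theorem integrable_one_sub_exp (hη : Integrable (fun x => min 1 (max x 0)) η) {u : ℝ}
    (hu : 0 ≤ u) : Integrable (fun x => 1 - Real.exp (-(u * max x 0))) η := by
  refine Integrable.mono' (hη.const_mul (max 1 u)) (by fun_prop) (Eventually.of_forall fun x => ?_)
  have hx : 0 ≤ max x 0 := le_max_right _ _
  have h1 : Real.exp (-(u * max x 0)) ≤ 1 := Real.exp_le_one_iff.2 (by nlinarith)
  rw [Real.norm_eq_abs, abs_of_nonneg (by linarith)]
  refine one_sub_exp_neg_le_min.trans ?_
  rcases le_total 1 (max x 0) with h | h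
  · rw [min_eq_left h, mul_one]
    exact (min_le_left _ _).trans (le_max_left _ _)
  · rw [min_eq_right h]
    exact (min_le_right _ _).trans (mul_le_mul_of_nonneg_right (le_max_right _ _) hx)

theorem integrable_exp_mul_I_sub_one (hη : Integrable (fun x => min 1 (max x 0)) η) (v : ℝ) :
    Integrable (fun x => Complex.exp ((v * max x 0 : ℝ) * Complex.I) - 1) η := by
  refine Integrable.mono' (hη.const_mul (max 2 |v|)) (by fun_prop)
    (Eventually.of_forall fun x => ?_)
  have hx : 0 ≤ max x 0 := le_max_right _ _
  rcases le_total 1 (max x 0) with h | h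
  · rw [min_eq_left h, mul_one]
    refine ((norm_sub_le _ _).trans ?_).trans (le_max_left _ _)
    rw [Complex.norm_exp_ofReal_mul_I, norm_one]
    norm_num
  · rw [min_eq_right h, mul_comm _ Complex.I]
    refine Real.norm_exp_I_mul_ofReal_sub_one_le.trans ?_
    rw [norm_mul, Real.norm_eq_abs, Real.norm_eq_abs, abs_of_nonneg hx]
    exact mul_le_mul_of_nonneg_right (le_max_right _ _) hx

theorem tendsto_integral_one_sub_exp (hη : Integrable (fun x => min 1 (max x 0)) η) :
    Tendsto (fun u => ∫ x, (1 - Real.exp (-(u * max x 0))) ∂η) (𝓝[>] 0) (𝓝 0) := by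
  have h := tendsto_integral_filter_of_dominated_convergence (μ := η) (l := 𝓝[>] (0 : ℝ))
    (F := fun u x => 1 - Real.exp (-(u * max x 0))) (f := fun _ => 0)
    (fun x => min 1 (max x 0)) (Eventually.of_forall fun u => by fun_prop)
    (by
      filter_upwards [Ioo_mem_nhdsGT (show (0 : ℝ) < 1 from one_pos)] with u hu
      refine Eventually.of_forall fun x => ?_
      have hx : 0 ≤ max x 0 := le_max_right _ _
      have h1 : Real.exp (-(u * max x 0)) ≤ 1 := Real.exp_le_one_iff.2 (by nlinarith [hu.1])
      rw [Real.norm_eq_abs, abs_of_nonneg (by linarith)]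
      exact one_sub_exp_neg_le_min.trans (min_le_min_left 1 (by nlinarith [hu.2])))
    hη
    (Eventually.of_forall fun x => by
      have h1 : Continuous fun u : ℝ => 1 - Real.exp (-(u * max x 0)) := by fun_prop
      have h2 := (h1.tendsto 0).mono_left (nhdsWithin_le_nhds (s := Ioi 0))
      simpa using h2)
  simpa using h

variable {B : Set ℝ}

theorem integrable_indicator_one {𝕜 : Type*} [RCLike 𝕜] (hB : MeasurableSet B)
    (hB' : volume B ≠ ⊤) : Integrable (B.indicator (1 : ℝ → 𝕜)) volume :=
  (integrable_indicator_iff hB).2 (integrableOn_const hB')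

theorem one_sub_exp_windowJump (u : ℝ) (p : ℝ × ℝ) : 1 - Real.exp (-(u * windowJump B p)) =
    B.indicator (1 : ℝ → ℝ) p.1 * (1 - Real.exp (-(u * max p.2 0))) := by
  by_cases h : p.1 ∈ B <;> simp [windowJump, h]

theorem integrable_one_sub_exp_windowJump (hη : Integrable (fun x => min 1 (max x 0)) η)
    (hB : MeasurableSet B) (hB' : volume B ≠ ⊤) {u : ℝ} (hu : 0 ≤ u) :
    Integrable (fun p => 1 - Real.exp (-(u * windowJump B p))) (volume.prod η) := by
  simp only [one_sub_exp_windowJump]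
  exact (integrable_indicator_one hB hB').mul_prod (integrable_one_sub_exp hη hu)

theorem integral_one_sub_exp_windowJump [SFinite η] (hB : MeasurableSet B) (u : ℝ) :
    ∫ p, (1 - Real.exp (-(u * windowJump B p))) ∂(volume.prod η) =
      volume.real B * ∫ x, (1 - Real.exp (-(u * max x 0))) ∂η := by
  simp only [one_sub_exp_windowJump]
  rw [integral_prod_mul (B.indicator (1 : ℝ → ℝ)) fun x => 1 - Real.exp (-(u * max x 0)),
    integral_indicator_one hB]

variable {ι : Type*} [Fintype ι] {C : ι → Set ℝ}

theorem exp_sum_windowJump_sub_one (hC : Pairwise (Function.onFun Disjoint C)) (v : ι → ℝ)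
    (p : ℝ × ℝ) :
    Complex.exp ((∑ i, v i * windowJump (C i) p : ℝ) * Complex.I) - 1 =
      ∑ i, (C i).indicator (1 : ℝ → ℂ) p.1 *
        (Complex.exp ((v i * max p.2 0 : ℝ) * Complex.I) - 1) := by
  by_cases h : ∃ i, p.1 ∈ C i
  · obtain ⟨i, hi⟩ := h
    have hne : ∀ j, j ≠ i → p.1 ∉ C j := fun j hj hpj =>
      (disjoint_left.1 (hC hj) hpj) hi
    rw [Finset.sum_eq_single i (fun j _ hj => by simp [windowJump, hne j hj]) (by simp),
      Finset.sum_eq_single i (fun j _ hj => by simp [hne j hj]) (by simp)]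
    simp [windowJump, hi]
  · push Not at h
    simp [windowJump, h]

theorem integrable_exp_sum_windowJump (hη : Integrable (fun x => min 1 (max x 0)) η)
    (hC : Pairwise (Function.onFun Disjoint C)) (hCm : ∀ i, MeasurableSet (C i))
    (hCf : ∀ i, volume (C i) ≠ ⊤) (v : ι → ℝ) :
    Integrable (fun p => Complex.exp ((∑ i, v i * windowJump (C i) p : ℝ) * Complex.I) - 1)
      (volume.prod η) := by
  simp only [exp_sum_windowJump_sub_one hC]
  exact integrable_finsetSum _ fun i _ =>
    (integrable_indicator_one (hCm i) (hCf i)).mul_prod (integrable_exp_mul_I_sub_one hη (v i))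

theorem integral_exp_sum_windowJump [SFinite η]
    (hη : Integrable (fun x => min 1 (max x 0)) η)
    (hC : Pairwise (Function.onFun Disjoint C)) (hCm : ∀ i, MeasurableSet (C i))
    (hCf : ∀ i, volume (C i) ≠ ⊤) (v : ι → ℝ) :
    ∫ p, (Complex.exp ((∑ i, v i * windowJump (C i) p : ℝ) * Complex.I) - 1) ∂(volume.prod η) =
      ∑ i, volume.real (C i) * ∫ x, (Complex.exp ((v i * max x 0 : ℝ) * Complex.I) - 1) ∂η := by
  simp only [exp_sum_windowJump_sub_one hC]
  rw [integral_finsetSum _ fun i _ =>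
    (integrable_indicator_one (hCm i) (hCf i)).mul_prod (integrable_exp_mul_I_sub_one hη (v i))]
  refine Finset.sum_congr rfl fun i _ => ?_
  rw [integral_prod_mul ((C i).indicator (1 : ℝ → ℂ))
    fun x => Complex.exp ((v i * max x 0 : ℝ) * Complex.I) - 1]
  congr 1
  rw [integral_indicator (hCm i)]
  simp

end Exponents

section Construction

variable {η : Measure ℝ} [SFinite η] {r : ℕ → ℝ≥0} {ν : ℕ → Measure (ℝ × ℝ)}
  [∀ j, IsProbabilityMeasure (ν j)]

theorem ae_jumpMeasure_ne_top (hη : Integrable (fun x => min 1 (max x 0)) η)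
    (hΛ : (volume.prod η : Measure (ℝ × ℝ)) = Measure.sum fun j => r j • ν j) {B : Set ℝ}
    (hB : MeasurableSet B) (hB' : volume B ≠ ⊤) :
    ∀ᵐ ω ∂(cloudSeqLaw r ν), jumpMeasure ω B ≠ ⊤ := by
  refine ae_ne_top_of_le_integral_exp (Z := cloudSum (windowJump B))
    (κ := fun u => volume.real B * ∫ x, (1 - Real.exp (-(u * max x 0))) ∂η)
    (fun J => (measurable_cloudSum (measurable_windowJump hB) J).aemeasurable)
    (fun J => Eventually.of_forall fun ω => Finset.sum_nonneg fun j _ =>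
      Finset.sum_nonneg fun i _ => windowJump_nonneg B _)
    (Eventually.of_forall fun ω => tendsto_cloudSum_windowJump hB ω) (fun u hu J => ?_) ?_
  · have h := (tendsto_integral_exp_neg_cloudSum hΛ (h := fun p => u * windowJump B p)
      ((measurable_windowJump hB).const_mul u)
      (fun p => mul_nonneg hu.le (windowJump_nonneg B p))
      (integrable_one_sub_exp_windowJump hη hB hB' hu.le)).1 J
    rw [integral_one_sub_exp_windowJump hB] at h
    refine h.trans_eq ?_
    congr 1
    funext ω
    simp only [cloudSum, Finset.mul_sum, neg_mul, Finset.sum_neg_distrib]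
  · simpa using (tendsto_integral_one_sub_exp hη).const_mul (volume.real B)

theorem integral_exp_neg_jumpMeasure (hη : Integrable (fun x => min 1 (max x 0)) η)
    (hΛ : (volume.prod η : Measure (ℝ × ℝ)) = Measure.sum fun j => r j • ν j) {B : Set ℝ}
    (hB : MeasurableSet B) (hB' : volume B ≠ ⊤) {u : ℝ} (hu : 0 ≤ u) :
    ∫ ω, Real.exp (-(u * (jumpMeasure ω B).toReal)) ∂(cloudSeqLaw r ν) =
      Real.exp (-(volume.real B * ∫ x, (1 - Real.exp (-(u * max x 0))) ∂η)) := by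
  have h := (tendsto_integral_exp_neg_cloudSum hΛ (h := fun p => u * windowJump B p)
    ((measurable_windowJump hB).const_mul u)
    (fun p => mul_nonneg hu (windowJump_nonneg B p))
    (integrable_one_sub_exp_windowJump hη hB hB' hu)).2
  rw [integral_one_sub_exp_windowJump hB] at h
  refine tendsto_nhds_unique ?_ h
  have e : ∀ J ω, cloudSum (fun p => u * windowJump B p) J ω = u * cloudSum (windowJump B) J ω := by
    intro J ω
    simp only [cloudSum, Finset.mul_sum]
  simp only [e]
  refine tendsto_integral_of_dominated_convergence (fun _ => (1 : ℝ)) (fun J => ?_)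
    (integrable_const _) (fun J => Eventually.of_forall fun ω => ?_) ?_
  · have := measurable_cloudSum (measurable_windowJump hB) J
    exact (by fun_prop : Measurable fun ω =>
      Real.exp (-(u * cloudSum (windowJump B) J ω))).aestronglyMeasurable
  · rw [Real.norm_eq_abs, abs_of_pos (Real.exp_pos _), Real.exp_le_one_iff]
    have : 0 ≤ cloudSum (windowJump B) J ω := Finset.sum_nonneg fun j _ =>
      Finset.sum_nonneg fun i _ => windowJump_nonneg B _
    nlinarith
  · filter_upwards [ae_jumpMeasure_ne_top hη hΛ hB hB'] with ω hω
    exact ((by fun_prop : Continuous fun x : ℝ => Real.exp (-(u * x))).tendsto _).comp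
      (tendsto_cloudSum_toReal hB hω)

/-- The joint characteristic function of the sums of the jumps in disjoint time windows. -/
theorem integral_exp_mul_I_jumpMeasure (hη : Integrable (fun x => min 1 (max x 0)) η)
    (hΛ : (volume.prod η : Measure (ℝ × ℝ)) = Measure.sum fun j => r j • ν j) {ι : Type*}
    [Fintype ι] {C : ι → Set ℝ} (hC : Pairwise (Function.onFun Disjoint C))
    (hCm : ∀ i, MeasurableSet (C i)) (hCf : ∀ i, volume (C i) ≠ ⊤) (v : ι → ℝ) :
    ∫ ω, Complex.exp ((∑ i, v i * (jumpMeasure ω (C i)).toReal : ℝ) * Complex.I)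
        ∂(cloudSeqLaw r ν) =
      ∏ i, Complex.exp (volume.real (C i) *
        ∫ x, (Complex.exp ((v i * max x 0 : ℝ) * Complex.I) - 1) ∂η) := by
  rw [integral_exp_mul_I_of_tendsto_cloudSum hΛ (h := fun p => ∑ i, v i * windowJump (C i) p)
    (Finset.measurable_fun_sum _ fun i _ => (measurable_windowJump (hCm i)).const_mul (v i))
    (integrable_exp_sum_windowJump hη hC hCm hCf v),
    integral_exp_sum_windowJump hη hC hCm hCf v, Complex.exp_sum]
  filter_upwards [ae_all_iff.2 fun i => ae_jumpMeasure_ne_top hη hΛ (hCm i) (hCf i)] with ω hω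
  have h := tendsto_finsetSum Finset.univ fun i _ =>
    (tendsto_cloudSum_toReal (hCm i) (hω i)).const_mul (v i)
  refine h.congr fun J => ?_
  simp only [cloudSum, Finset.mul_sum]
  rw [Finset.sum_comm]
  refine Finset.sum_congr rfl fun j _ => ?_
  rw [Finset.sum_comm]

theorem charFun_map_jumpMeasure (hη : Integrable (fun x => min 1 (max x 0)) η)
    (hΛ : (volume.prod η : Measure (ℝ × ℝ)) = Measure.sum fun j => r j • ν j) {B : Set ℝ}
    (hB : MeasurableSet B) (hB' : volume B ≠ ⊤) (v : ℝ) :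
    charFun ((cloudSeqLaw r ν).map fun ω => (jumpMeasure ω B).toReal) v =
      Complex.exp (volume.real B *
        ∫ x, (Complex.exp ((v * max x 0 : ℝ) * Complex.I) - 1) ∂η) := by
  have hm := (measurable_jumpMeasure hB).ennreal_toReal
  rw [charFun_apply, integral_map hm.aemeasurable (by fun_prop)]
  have h := integral_exp_mul_I_jumpMeasure hη hΛ (ι := Unit) (C := fun _ => B)
    (fun i j hij => (hij rfl).elim) (fun _ => hB) (fun _ => hB') (fun _ => v)
  simpa [mul_comm] using h

/-- The sums of the jumps in disjoint time windows are independent. -/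
theorem iIndepFun_jumpMeasure (hη : Integrable (fun x => min 1 (max x 0)) η)
    (hΛ : (volume.prod η : Measure (ℝ × ℝ)) = Measure.sum fun j => r j • ν j) {ι : Type*}
    [Fintype ι] {C : ι → Set ℝ} (hC : Pairwise (Function.onFun Disjoint C))
    (hCm : ∀ i, MeasurableSet (C i)) (hCf : ∀ i, volume (C i) ≠ ⊤) :
    iIndepFun (fun i ω => (jumpMeasure ω (C i)).toReal) (cloudSeqLaw r ν) := by
  have hm : ∀ i, Measurable fun ω : ℕ → ℕ × (ℕ → ℝ × ℝ) => (jumpMeasure ω (C i)).toReal :=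
    fun i => (measurable_jumpMeasure (hCm i)).ennreal_toReal
  have hm' : Measurable fun ω : ℕ → ℕ × (ℕ → ℝ × ℝ) =>
      WithLp.toLp 2 fun i => (jumpMeasure ω (C i)).toReal :=
    (WithLp.measurable_toLp 2 _).comp (measurable_pi_lambda _ hm)
  rw [iIndepFun_iff_charFun_pi fun i => (hm i).aemeasurable]
  intro v
  simp only [charFun_map_jumpMeasure hη hΛ (hCm _) (hCf _)]
  rw [← integral_exp_mul_I_jumpMeasure hη hΛ hC hCm hCf, charFun_apply,
    integral_map hm'.aemeasurable (by fun_prop)]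
  rfl

/-- The process `t ↦ a t + (sum of the jumps in (0, t])`. -/
noncomputable def jumpProcess (a : ℝ) (t : ℝ≥0) (ω : ℕ → ℕ × (ℕ → ℝ × ℝ)) : ℝ :=
  a * t + (jumpMeasure ω (Ioc 0 (t : ℝ))).toReal

theorem volume_Ioc_ne_top (s t : ℝ) : volume (Ioc s t) ≠ ⊤ := by
  rw [Real.volume_Ioc]
  exact ENNReal.ofReal_ne_top

/-- The paths are right-continuous and nondecreasing because, up to the drift, they are distribution
functions of measures; the increments are functions of the jumps in disjoint time windows, and by the formula for
the characteristic function the laws depend only on the lengths of the windows. -/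
theorem isSubordinator_jumpProcess (hη : Integrable (fun x => min 1 (max x 0)) η)
    (hΛ : (volume.prod η : Measure (ℝ × ℝ)) = Measure.sum fun j => r j • ν j) {a : ℝ}
    (ha : 0 ≤ a) : IsSubordinator (jumpProcess a) (cloudSeqLaw r ν) := by
  have hfin : ∀ᵐ ω ∂(cloudSeqLaw r ν), ∀ t : ℝ, jumpMeasure ω (Ioc 0 t) ≠ ⊤ := by
    filter_upwards [ae_all_iff.2 fun n : ℕ =>
      ae_jumpMeasure_ne_top hη hΛ (measurableSet_Ioc (a := (0 : ℝ)) (b := n))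
        (volume_Ioc_ne_top _ _)] with ω hω t
    obtain ⟨n, hn⟩ := exists_nat_ge t
    exact ((measure_mono (Ioc_subset_Ioc_right hn)).trans_lt (hω n).lt_top).ne
  have hinc : ∀ᵐ ω ∂(cloudSeqLaw r ν), ∀ s t : ℝ≥0, s ≤ t →
      jumpProcess a t ω - jumpProcess a s ω =
        a * (t - s) + (jumpMeasure ω (Ioc (s : ℝ) t)).toReal := by
    filter_upwards [hfin] with ω hω s t hst
    have hst' : (s : ℝ) ≤ t := hst
    have h1 : jumpMeasure ω (Ioc 0 (t : ℝ)) =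
        jumpMeasure ω (Ioc 0 (s : ℝ)) + jumpMeasure ω (Ioc (s : ℝ) t) := by
      rw [← measure_union (Ioc_disjoint_Ioc_of_le le_rfl) measurableSet_Ioc,
        Ioc_union_Ioc_eq_Ioc (NNReal.coe_nonneg s) hst']
    have h2 : jumpMeasure ω (Ioc (s : ℝ) t) ≠ ⊤ :=
      ((measure_mono (Ioc_subset_Ioc_left s.2)).trans_lt (hω t).lt_top).ne
    simp only [jumpProcess]
    rw [h1, ENNReal.toReal_add (hω s) h2]
    ring
  have hmeas : ∀ s t : ℝ, Measurable fun ω => (jumpMeasure ω (Ioc s t)).toReal := fun s t =>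
    (measurable_jumpMeasure measurableSet_Ioc).ennreal_toReal
  refine ⟨fun t => measurable_const.add (hmeas _ _), Eventually.of_forall fun ω => by
    simp [jumpProcess], fun n t ht => ?_, fun s t => ?_, ?_, ?_⟩
  · -- the increments are affine functions of the jumps in disjoint time windows
    have hdisj : Pairwise (Function.onFun Disjoint
        fun i : Fin n => Ioc (t i.castSucc : ℝ) (t i.succ)) := by
      refine (pairwise_disjoint_on _).2 fun i j hij => Ioc_disjoint_Ioc_of_le ?_
      have : t i.succ ≤ t j.castSucc := ht (by
        rw [Fin.le_def]
        simpa using Nat.succ_le_of_lt (Fin.lt_def.1 hij))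
      exact_mod_cast this
    have h1 := iIndepFun_jumpMeasure hη hΛ hdisj (fun i => measurableSet_Ioc)
      (fun i => volume_Ioc_ne_top _ _)
    have h2 := h1.comp (fun i x => a * (t i.succ - t i.castSucc) + x)
      (fun i => by fun_prop)
    refine h2.congr fun i => ?_
    filter_upwards [hinc] with ω hω
    rw [hω _ _ (ht (Fin.castSucc_le_succ i))]
    rfl
  · have hlaw : (cloudSeqLaw r ν).map (fun ω => (jumpMeasure ω (Ioc (s : ℝ) (s + t : ℝ≥0))).toReal) =
        (cloudSeqLaw r ν).map (fun ω => (jumpMeasure ω (Ioc 0 (t : ℝ))).toReal) := by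
      have := Measure.isProbabilityMeasure_map (μ := cloudSeqLaw r ν)
        (hmeas s (s + t : ℝ≥0)).aemeasurable
      have := Measure.isProbabilityMeasure_map (μ := cloudSeqLaw r ν) (hmeas 0 t).aemeasurable
      refine Measure.ext_of_charFun (funext fun v => ?_)
      rw [charFun_map_jumpMeasure hη hΛ measurableSet_Ioc (volume_Ioc_ne_top _ _),
        charFun_map_jumpMeasure hη hΛ measurableSet_Ioc (volume_Ioc_ne_top _ _)]
      simp
    have e1 : (cloudSeqLaw r ν).map (fun ω => jumpProcess a (s + t) ω - jumpProcess a s ω) =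
        ((cloudSeqLaw r ν).map
          (fun ω => (jumpMeasure ω (Ioc (s : ℝ) (s + t : ℝ≥0))).toReal)).map (fun x => a * t + x) := by
      rw [Measure.map_map (by fun_prop) (hmeas _ _)]
      refine Measure.map_congr ?_
      filter_upwards [hinc] with ω hω
      rw [hω s (s + t) le_self_add]
      simp
    have e2 : (cloudSeqLaw r ν).map (jumpProcess a t) = ((cloudSeqLaw r ν).map
        (fun ω => (jumpMeasure ω (Ioc 0 (t : ℝ))).toReal)).map (fun x => a * t + x) := by
      rw [Measure.map_map (by fun_prop) (hmeas _ _)]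
      rfl
    rw [e1, e2, hlaw]
  · filter_upwards [hfin] with ω hω s t hst
    have hst' : (s : ℝ) ≤ t := hst
    exact add_le_add (mul_le_mul_of_nonneg_left hst' ha)
      (ENNReal.toReal_mono (hω t) (measure_mono (Ioc_subset_Ioc_right hst')))
  · filter_upwards [hfin] with ω hω t
    have h1 : Tendsto (fun s : ℝ≥0 => jumpMeasure ω (Ioc 0 (s : ℝ))) (𝓝[>] t)
        (𝓝 (jumpMeasure ω (Ioc 0 (t : ℝ)))) := by
      have h2 := tendsto_measure_biInter_gt (μ := jumpMeasure ω) (a := t)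
        (s := fun s : ℝ≥0 => Ioc 0 (s : ℝ)) (fun _ _ => measurableSet_Ioc.nullMeasurableSet)
        (fun i j _ hij => Ioc_subset_Ioc_right (by exact_mod_cast hij))
        ⟨t + 1, by simp, hω _⟩
      have h3 : ⋂ s > t, Ioc 0 (s : ℝ) = Ioc 0 (t : ℝ) := by
        ext x
        simp only [gt_iff_lt, mem_iInter, mem_Ioc]
        constructor
        · intro h
          refine ⟨(h (t + 1) (by simp)).1, le_of_forall_gt_imp_ge_of_dense fun y hy => ?_⟩
          have hy0 : 0 ≤ y := t.2.trans hy.le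
          exact (h ⟨y, hy0⟩ (by exact_mod_cast hy)).2
        · intro h s hs
          exact ⟨h.1, h.2.trans (by exact_mod_cast hs.le)⟩
      rw [h3] at h2
      exact h2
    rw [← continuousWithinAt_Ioi_iff_Ici]
    refine ContinuousWithinAt.add (by fun_prop) ?_
    exact (ENNReal.tendsto_toReal (hω t)).comp h1

end Construction

/-- Existence of a subordinator with given drift and Lévy measure. -/
theorem exists_isSubordinator {η : Measure ℝ} [SFinite η]
    (hη : Integrable (fun x => min 1 (max x 0)) η) {a : ℝ} (ha : 0 ≤ a) :
    ∃ (Ω : Type) (_ : MeasurableSpace Ω) (P : Measure Ω) (X : ℝ≥0 → Ω → ℝ),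
      IsProbabilityMeasure P ∧ IsSubordinator X P ∧ (∀ t ω, 0 ≤ X t ω) ∧
      ∀ u, 0 ≤ u → ∫ ω, Real.exp (-u * X 1 ω) ∂P =
        Real.exp (-(a * u + ∫ x, (1 - Real.exp (-(u * max x 0))) ∂η)) := by
  obtain ⟨r, ν, hν, hΛ⟩ := exists_eq_sum_smul_isProbabilityMeasure
    (volume.prod η : Measure (ℝ × ℝ))
  refine ⟨_, _, cloudSeqLaw r ν, jumpProcess a, inferInstance,
    isSubordinator_jumpProcess hη hΛ ha,
    fun t ω => add_nonneg (mul_nonneg ha t.2) ENNReal.toReal_nonneg, fun u hu => ?_⟩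
  have h := integral_exp_neg_jumpMeasure hη hΛ (measurableSet_Ioc (a := (0 : ℝ)) (b := 1))
    (volume_Ioc_ne_top _ _) hu
  have e : ∀ ω, Real.exp (-u * jumpProcess a 1 ω) =
      Real.exp (-(a * u)) * Real.exp (-(u * (jumpMeasure ω (Ioc 0 1)).toReal)) := by
    intro ω
    rw [← Real.exp_add, jumpProcess]
    congr 1
    simp
    ring
  simp only [e]
  rw [integral_const_mul, h, ← Real.exp_add]
  congr 1
  simp
  ring

/-! ### Riemann sums for pathwise exponential integrals -/

/-- The grid points `k / (N + 1)`. -/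
noncomputable def grid (N k : ℕ) : ℝ≥0 := k / (N + 1)

theorem coe_grid (N k : ℕ) : (grid N k : ℝ) = k / (N + 1) := by simp [grid]

theorem grid_mono (N : ℕ) : Monotone (grid N) := fun i j hij => by
  unfold grid
  gcongr

theorem grid_succ (N k : ℕ) : grid N (k + 1) = grid N k + grid N 1 := by
  simp only [grid]
  push_cast
  rw [add_div]

theorem grid_zero (N : ℕ) : grid N 0 = 0 := by simp [grid]

theorem grid_mul (N n : ℕ) : grid N (n * (N + 1)) = n := by
  simp only [grid]
  push_cast
  field_simp

theorem grid_self (N : ℕ) : grid N (N + 1) = 1 := by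
  simpa using grid_mul N 1

/-- The lower Riemann–Stieltjes sum of `∫_{(0,n]} e^{-t} dx_t` on the grid of mesh
`1 / (N + 1)`. -/
noncomputable def expSum (n N : ℕ) (x : ℝ≥0 → ℝ) : ℝ :=
  ∑ k ∈ Finset.range (n * (N + 1)),
    Real.exp (-grid N (k + 1)) * (x (grid N (k + 1)) - x (grid N k))

section Path

variable {x : ℝ≥0 → ℝ}

theorem pathMeasure_Ioc (hx : Monotone x) (hc : ∀ t, ContinuousWithinAt x (Ici t) t) (s t : ℝ≥0) :
    pathMeasure x (Ioc (s : ℝ) t) = ENNReal.ofReal (x t - x s) := by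
  have hval : ∀ s : ℝ≥0, (hx.comp fun _ _ hab => Real.toNNReal_mono hab :
      Monotone (x ∘ Real.toNNReal)).stieltjesFunction s = x s := by
    intro s
    rw [Monotone.stieltjesFunction_eq]
    have h1 : ContinuousWithinAt (x ∘ Real.toNNReal) (Ici (s : ℝ)) s := by
      refine ContinuousWithinAt.comp (t := Ici s) ?_ continuous_real_toNNReal.continuousWithinAt ?_
      · simpa using hc s
      · intro y hy
        exact NNReal.le_toNNReal_of_coe_le hy
    rw [h1.rightLim_eq]
    simp
  rw [pathMeasure, dif_pos hx, StieltjesFunction.measure_Ioc, hval, hval]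

theorem integrableOn_exp_neg_pathMeasure (hx : Monotone x)
    (hc : ∀ t, ContinuousWithinAt x (Ici t) t) (s t : ℝ≥0) :
    IntegrableOn (fun r : ℝ => Real.exp (-r)) (Ioc (s : ℝ) t) (pathMeasure x) := by
  refine Measure.integrableOn_of_bounded (M := 1) ?_ (by fun_prop) ?_
  · rw [pathMeasure_Ioc hx hc]
    exact ENNReal.ofReal_ne_top
  · filter_upwards [ae_restrict_mem measurableSet_Ioc] with r hr
    rw [Real.norm_eq_abs, abs_of_pos (Real.exp_pos _), Real.exp_le_one_iff]
    have := s.2.trans hr.1.le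
    linarith

theorem integral_exp_neg_pathMeasure_mem (hx : Monotone x)
    (hc : ∀ t, ContinuousWithinAt x (Ici t) t) {s t : ℝ≥0} (hst : s ≤ t) :
    Real.exp (-t) * (x t - x s) ≤ ∫ r in Ioc (s : ℝ) t, Real.exp (-r) ∂(pathMeasure x) ∧
    ∫ r in Ioc (s : ℝ) t, Real.exp (-r) ∂(pathMeasure x) ≤ Real.exp (-s) * (x t - x s) := by
  have hi := integrableOn_exp_neg_pathMeasure hx hc s t
  have hfin : pathMeasure x (Ioc (s : ℝ) t) ≠ ⊤ := by
    rw [pathMeasure_Ioc hx hc]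
    exact ENNReal.ofReal_ne_top
  have hconst : ∀ c : ℝ, ∫ _ in Ioc (s : ℝ) t, c ∂(pathMeasure x) = c * (x t - x s) := by
    intro c
    rw [setIntegral_const, Measure.real, pathMeasure_Ioc hx hc,
      ENNReal.toReal_ofReal (sub_nonneg.2 (hx hst)), smul_eq_mul, mul_comm]
  constructor
  · rw [← hconst]
    exact setIntegral_mono_on (integrableOn_const hfin) hi measurableSet_Ioc
      fun r hr => Real.exp_le_exp.2 (neg_le_neg hr.2)
  · rw [← hconst]
    exact setIntegral_mono_on hi (integrableOn_const hfin) measurableSet_Ioc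
      fun r hr => Real.exp_le_exp.2 (neg_le_neg hr.1.le)

theorem tendsto_expSum (hx : Monotone x)
    (hc : ∀ t, ContinuousWithinAt x (Ici t) t) (n : ℕ) :
    Tendsto (fun N => expSum n N x) atTop
      (𝓝 (∫ r in Ioc (0 : ℝ) n, Real.exp (-r) ∂(pathMeasure x))) := by
  have hsplit : ∀ N : ℕ, ∫ r in Ioc (0 : ℝ) n, Real.exp (-r) ∂(pathMeasure x) =
      ∑ k ∈ Finset.range (n * (N + 1)),
        ∫ r in Ioc (grid N k : ℝ) (grid N (k + 1)), Real.exp (-r) ∂(pathMeasure x) := by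
    intro N
    have h := intervalIntegral.sum_integral_adjacent_intervals (μ := pathMeasure x)
      (f := fun r => Real.exp (-r)) (a := fun k => (grid N k : ℝ)) (n := n * (N + 1))
      (fun k _ => (intervalIntegrable_iff_integrableOn_Ioc_of_le
        (by exact_mod_cast grid_mono N k.le_succ)).2
          (integrableOn_exp_neg_pathMeasure hx hc _ _))
    rw [grid_zero, grid_mul] at h
    simp only [NNReal.coe_zero, NNReal.coe_natCast] at h
    rw [intervalIntegral.integral_of_le n.cast_nonneg] at h
    rw [← h]
    exact Finset.sum_congr rfl fun k _ =>
      intervalIntegral.integral_of_le (by exact_mod_cast grid_mono N k.le_succ)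
  have hlow : ∀ N : ℕ, expSum n N x ≤ ∫ r in Ioc (0 : ℝ) n, Real.exp (-r) ∂(pathMeasure x) := by
    intro N
    rw [hsplit N]
    exact Finset.sum_le_sum fun k _ =>
      (integral_exp_neg_pathMeasure_mem hx hc (grid_mono N k.le_succ)).1
  have hupp : ∀ N : ℕ, ∫ r in Ioc (0 : ℝ) n, Real.exp (-r) ∂(pathMeasure x) -
      (x n - x 0) * (1 / ((N : ℝ) + 1)) ≤ expSum n N x := by
    intro N
    have h1 : (x n - x 0) * (1 / ((N : ℝ) + 1)) = ∑ k ∈ Finset.range (n * (N + 1)),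
        (x (grid N (k + 1)) - x (grid N k)) * (1 / ((N : ℝ) + 1)) := by
      rw [← Finset.sum_mul, Finset.sum_range_sub (fun k => x (grid N k)), grid_zero, grid_mul]
    rw [hsplit N, h1, ← Finset.sum_sub_distrib]
    refine Finset.sum_le_sum fun k _ => ?_
    have h2 := (integral_exp_neg_pathMeasure_mem hx hc (grid_mono N k.le_succ)).2
    have h3 : 0 ≤ x (grid N (k + 1)) - x (grid N k) := sub_nonneg.2 (hx (grid_mono N k.le_succ))
    -- the oscillation of `e^{-t}` on a grid interval is at most the mesh
    have h4 : Real.exp (-grid N k) - Real.exp (-grid N (k + 1)) ≤ 1 / ((N : ℝ) + 1) := by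
      have e : (grid N (k + 1) : ℝ) = grid N k + 1 / ((N : ℝ) + 1) := by
        rw [grid_succ]
        push_cast
        rw [coe_grid N 1, Nat.cast_one]
      rw [e, neg_add, Real.exp_add]
      have h5 : Real.exp (-(grid N k : ℝ)) ≤ 1 := Real.exp_le_one_iff.2 (by simp)
      have h6 := Real.add_one_le_exp (-(1 / ((N : ℝ) + 1)))
      have h7 := Real.exp_pos (-(grid N k : ℝ))
      have h8 : 0 < 1 / ((N : ℝ) + 1) := by positivity
      nlinarith
    have h9 := mul_le_mul_of_nonneg_right h4 h3
    linarith
  have hlim : Tendsto (fun N : ℕ => ∫ r in Ioc (0 : ℝ) n, Real.exp (-r) ∂(pathMeasure x) -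
      (x n - x 0) * (1 / ((N : ℝ) + 1))) atTop
      (𝓝 (∫ r in Ioc (0 : ℝ) n, Real.exp (-r) ∂(pathMeasure x))) := by
    have h := ((tendsto_one_div_add_atTop_nhds_zero_nat (𝕜 := ℝ)).const_mul (x n - x 0)).const_sub
      (∫ r in Ioc (0 : ℝ) n, Real.exp (-r) ∂(pathMeasure x))
    rwa [mul_zero, sub_zero] at h
  exact tendsto_of_tendsto_of_tendsto_of_le_of_le hlim tendsto_const_nhds hupp hlow

theorem tendsto_integral_Ioc_exp_neg (hx : Monotone x)
    (hc : ∀ t, ContinuousWithinAt x (Ici t) t) :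
    Tendsto (fun n : ℕ =>
      ENNReal.ofReal (∫ r in Ioc (0 : ℝ) n, Real.exp (-r) ∂(pathMeasure x))) atTop
      (𝓝 (∫⁻ r in Ioi (0 : ℝ), ENNReal.ofReal (Real.exp (-r)) ∂(pathMeasure x))) := by
  have h1 : ∀ n : ℕ, ENNReal.ofReal (∫ r in Ioc (0 : ℝ) n, Real.exp (-r) ∂(pathMeasure x)) =
      ((pathMeasure x).withDensity fun r => ENNReal.ofReal (Real.exp (-r))) (Ioc (0 : ℝ) n) := by
    intro n
    have hi := integrableOn_exp_neg_pathMeasure hx hc 0 n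
    simp only [NNReal.coe_zero, NNReal.coe_natCast] at hi
    rw [withDensity_apply _ measurableSet_Ioc, ofReal_integral_eq_lintegral_ofReal hi
      (Eventually.of_forall fun r => (Real.exp_pos _).le)]
  have h2 : Ioi (0 : ℝ) = ⋃ n : ℕ, Ioc (0 : ℝ) n := by
    ext r
    simp only [mem_Ioi, mem_iUnion, mem_Ioc]
    exact ⟨fun h => (exists_nat_ge r).imp fun n hn => ⟨h, hn⟩, fun ⟨n, hn⟩ => hn.1⟩
  simp only [h1]
  rw [← withDensity_apply _ measurableSet_Ioi, h2]
  exact tendsto_measure_iUnion_atTop fun m n hmn => Ioc_subset_Ioc_right (by exact_mod_cast hmn)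

end Path

/-! ### The exponential integral of a subordinator -/

section ExpIntegral

variable {Ω : Type*} [MeasurableSpace Ω] {P : Measure Ω}
  {X : ℝ≥0 → Ω → ℝ}

theorem integral_prod_increments (hX : IsSubordinator X P) (N K : ℕ) {f : ℕ → ℝ → ℝ}
    (hf : ∀ k, Measurable (f k)) :
    ∫ ω, ∏ k ∈ Finset.range K, f k (X (grid N (k + 1)) ω - X (grid N k) ω) ∂P =
      ∏ k ∈ Finset.range K, ∫ ω, f k (X (grid N (k + 1)) ω - X (grid N k) ω) ∂P := by
  have h1 := ((hX.indep.nat (grid_mono N)).comp f hf).precomp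
    (Fin.val_injective (n := K))
  simp only [Finset.prod_range]
  exact h1.integral_fun_prod_eq_prod_integral fun k =>
    ((hf k).comp ((hX.measurable _).sub (hX.measurable _))).aestronglyMeasurable

theorem IsSubordinator.integral_exp_neg_one (hX : IsSubordinator X P)
    (hX1 : IsProbOnNonneg (P.map (X 1))) {v : ℝ} (hv : 0 ≤ v) :
    ∫ ω, Real.exp (-v * X 1 ω) ∂P = Real.exp (-laplaceExponent (P.map (X 1)) v) := by
  rw [hX1.exp_neg_laplaceExponent hv, integral_map (hX.measurable 1).aemeasurable (by fun_prop)]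

/-- The Laplace transform of the increments over the grid: the increments over the `N + 1` grid
intervals of `[0, 1]` are independent and identically distributed, with sum `X 1`. -/
theorem IsSubordinator.integral_exp_neg_increment (hX : IsSubordinator X P)
    (hX1 : IsProbOnNonneg (P.map (X 1))) {v : ℝ} (hv : 0 ≤ v) (N k : ℕ) :
    ∫ ω, Real.exp (-v * (X (grid N (k + 1)) ω - X (grid N k) ω)) ∂P =
      Real.exp (-(laplaceExponent (P.map (X 1)) v / (N + 1))) := by
  have hstat : ∀ k, ∫ ω, Real.exp (-v * (X (grid N (k + 1)) ω - X (grid N k) ω)) ∂P =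
      ∫ ω, Real.exp (-v * X (grid N 1) ω) ∂P := by
    intro k
    have h1 := integral_map (μ := P) (φ := fun ω => X (grid N (k + 1)) ω - X (grid N k) ω)
      (f := fun x => Real.exp (-v * x))
      ((hX.measurable _).sub (hX.measurable _)).aemeasurable (by fun_prop)
    rw [← h1, grid_succ, hX.stationary,
      integral_map (hX.measurable _).aemeasurable (by fun_prop)]
  have hprod := integral_prod_increments hX N (N + 1) (f := fun _ x => Real.exp (-v * x))
    (fun _ => by fun_prop)
  simp only [hstat, Finset.prod_const, Finset.card_range] at hprod
  have htel : ∫ ω, ∏ k ∈ Finset.range (N + 1),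
      Real.exp (-v * (X (grid N (k + 1)) ω - X (grid N k) ω)) ∂P =
      Real.exp (-laplaceExponent (P.map (X 1)) v) := by
    rw [← hX.integral_exp_neg_one hX1 hv]
    refine integral_congr_ae ?_
    filter_upwards [hX.zero] with ω hω
    rw [← Real.exp_sum, ← Finset.mul_sum, Finset.sum_range_sub (fun k => X (grid N k) ω),
      grid_self, grid_zero, hω, sub_zero]
  rw [hstat]
  have hN : ((N + 1 : ℕ) : ℝ) ≠ 0 := by positivity
  refine (pow_left_inj₀ (integral_nonneg fun ω => (Real.exp_pos _).le) (Real.exp_pos _).le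
    (Nat.succ_ne_zero N)).1 ?_
  rw [← hprod, htel, ← Real.exp_nat_mul]
  congr 1
  push_cast
  field_simp

theorem IsSubordinator.integral_exp_neg_expSum (hX : IsSubordinator X P)
    (hX1 : IsProbOnNonneg (P.map (X 1))) {u : ℝ} (hu : 0 ≤ u) (n N : ℕ) :
    ∫ ω, Real.exp (-u * expSum n N fun t => X t ω) ∂P =
      Real.exp (-∑ k ∈ Finset.range (n * (N + 1)),
        laplaceExponent (P.map (X 1)) (u * Real.exp (-grid N (k + 1))) / (N + 1)) := by
  have h := integral_prod_increments hX N (n * (N + 1))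
    (f := fun k x => Real.exp (-(u * Real.exp (-grid N (k + 1))) * x)) (fun _ => by fun_prop)
  simp only [hX.integral_exp_neg_increment hX1 (mul_nonneg hu (Real.exp_pos _).le)] at h
  rw [← Real.exp_sum, Finset.sum_neg_distrib] at h
  rw [← h]
  congr 1
  funext ω
  rw [← Real.exp_sum, expSum, Finset.mul_sum]
  congr 1
  refine Finset.sum_congr rfl fun k _ => ?_
  ring

/-- Riemann sums for `∫_0^n φ(u e^{-t}) dt`, where `Φ' = φ(v) / v`. -/
theorem tendsto_sum_grid {φ Φ : ℝ → ℝ} (hφ : MonotoneOn φ (Ici 0))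
    (hΦ : ∀ v, 0 < v → HasDerivAt Φ (φ v / v) v) {u : ℝ} (hu : 0 < u) (n : ℕ) :
    Tendsto (fun N : ℕ => ∑ k ∈ Finset.range (n * (N + 1)),
      φ (u * Real.exp (-grid N (k + 1))) / (N + 1)) atTop
      (𝓝 (Φ u - Φ (u * Real.exp (-n)))) := by
  let F : ℝ → ℝ := fun s => Φ (u * Real.exp (-s))
  have hF : ∀ s, HasDerivAt F (-φ (u * Real.exp (-s))) s := by
    intro s
    have h1 : HasDerivAt (fun s => u * Real.exp (-s)) (u * (Real.exp (-s) * -1)) s :=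
      ((hasDerivAt_neg s).exp).const_mul u
    have h2 := (hΦ (u * Real.exp (-s)) (by positivity)).comp s h1
    convert! h2 using 1
    have := Real.exp_pos (-s)
    field_simp
  have hanti : ∀ s t, s ≤ t → φ (u * Real.exp (-t)) ≤ φ (u * Real.exp (-s)) := fun s t hst =>
    hφ (mul_nonneg hu.le (Real.exp_pos _).le) (mul_nonneg hu.le (Real.exp_pos _).le)
      (mul_le_mul_of_nonneg_left (Real.exp_le_exp.2 (neg_le_neg hst)) hu.le)
  have hstep : ∀ N k : ℕ,
      φ (u * Real.exp (-grid N (k + 1))) / (N + 1) ≤ F (grid N k) - F (grid N (k + 1)) ∧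
      F (grid N k) - F (grid N (k + 1)) ≤ φ (u * Real.exp (-grid N k)) / (N + 1) := by
    intro N k
    have hN : (0 : ℝ) < N + 1 := by positivity
    have e : (grid N (k + 1) : ℝ) - grid N k = 1 / ((N : ℝ) + 1) := by
      rw [grid_succ]
      push_cast
      rw [coe_grid N 1, Nat.cast_one]
      ring
    have hlt : (grid N k : ℝ) < grid N (k + 1) := by
      rw [← sub_pos, e]
      positivity
    obtain ⟨ξ, hξ, hs⟩ := exists_hasDerivAt_eq_slope F _ hlt
      (fun s _ => (hF s).continuousAt.continuousWithinAt) (fun s _ => hF s)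
    rw [e] at hs
    have h1 : F (grid N k) - F (grid N (k + 1)) = φ (u * Real.exp (-ξ)) / (N + 1) := by
      field_simp at hs
      field_simp
      linarith
    rw [h1]
    exact ⟨div_le_div_of_nonneg_right (hanti _ _ hξ.2.le) hN.le,
      div_le_div_of_nonneg_right (hanti _ _ hξ.1.le) hN.le⟩
  have htel : ∀ N : ℕ, ∑ k ∈ Finset.range (n * (N + 1)), (F (grid N k) - F (grid N (k + 1))) =
      Φ u - Φ (u * Real.exp (-n)) := by
    intro N
    rw [Finset.sum_range_sub' (fun k => F (grid N k)), grid_zero, grid_mul]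
    simp [F]
  have hφtel : ∀ N : ℕ, ∑ k ∈ Finset.range (n * (N + 1)), φ (u * Real.exp (-grid N k)) / (N + 1) =
      ∑ k ∈ Finset.range (n * (N + 1)), φ (u * Real.exp (-grid N (k + 1))) / (N + 1) +
      (φ u - φ (u * Real.exp (-n))) * (1 / ((N : ℝ) + 1)) := by
    intro N
    have h := Finset.sum_range_sub' (fun k => φ (u * Real.exp (-grid N k)) / ((N : ℝ) + 1))
      (n * (N + 1))
    rw [Finset.sum_sub_distrib, grid_zero, grid_mul] at h
    simp only [NNReal.coe_zero, neg_zero, Real.exp_zero, mul_one, NNReal.coe_natCast] at h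
    rw [sub_eq_iff_eq_add] at h
    rw [h]
    ring
  have hlim : Tendsto (fun N : ℕ => Φ u - Φ (u * Real.exp (-n)) -
      (φ u - φ (u * Real.exp (-n))) * (1 / ((N : ℝ) + 1))) atTop
      (𝓝 (Φ u - Φ (u * Real.exp (-n)))) := by
    have h := ((tendsto_one_div_add_atTop_nhds_zero_nat (𝕜 := ℝ)).const_mul
      (φ u - φ (u * Real.exp (-n)))).const_sub (Φ u - Φ (u * Real.exp (-n)))
    rwa [mul_zero, sub_zero] at h
  refine tendsto_of_tendsto_of_tendsto_of_le_of_le hlim tendsto_const_nhds (fun N => ?_) fun N => ?_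
  · have h1 := Finset.sum_le_sum fun k (_ : k ∈ Finset.range (n * (N + 1))) => (hstep N k).2
    rw [htel, hφtel] at h1
    simp only
    linarith
  · have h1 := Finset.sum_le_sum fun k (_ : k ∈ Finset.range (n * (N + 1))) => (hstep N k).1
    rw [htel] at h1
    exact h1

theorem IsSubordinator.ae_tendsto_expSum (hX : IsSubordinator X P) (n : ℕ) :
    ∀ᵐ ω ∂P, Tendsto (fun N => expSum n N fun t => X t ω) atTop
      (𝓝 (∫ r in Ioc (0 : ℝ) n, Real.exp (-r) ∂(pathMeasure fun t => X t ω))) := by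
  filter_upwards [hX.mono, hX.right_continuous] with ω h1 h2
  exact tendsto_expSum h1 h2 n

theorem IsSubordinator.measurable_expSum (hX : IsSubordinator X P) (n N : ℕ) :
    Measurable fun ω => expSum n N fun t => X t ω :=
  Finset.measurable_fun_sum _ fun _ _ =>
    ((hX.measurable _).sub (hX.measurable _)).const_mul _

theorem IsSubordinator.aemeasurable_integral_Ioc (hX : IsSubordinator X P) (n : ℕ) :
    AEMeasurable (fun ω => ∫ r in Ioc (0 : ℝ) n, Real.exp (-r) ∂(pathMeasure fun t => X t ω)) P :=
  aemeasurable_of_tendsto_metrizable_ae atTop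
    (fun N => (hX.measurable_expSum n N).aemeasurable) (hX.ae_tendsto_expSum n)

/-- The Laplace transform of `∫_{(0,n]} e^{-t} dX_t` is `exp (-∫_0^n φ(u e^{-t}) dt)`, where `φ` is
the Laplace exponent of `X 1`; the exponent is expressed by means of an antiderivative `Φ` of
`φ(v) / v`. -/
theorem IsSubordinator.integral_exp_neg_integral_Ioc [IsProbabilityMeasure P]
    (hX : IsSubordinator X P)
    (hX1 : IsProbOnNonneg (P.map (X 1))) {Φ : ℝ → ℝ}
    (hΦ : ∀ v, 0 < v → HasDerivAt Φ (laplaceExponent (P.map (X 1)) v / v) v) {u : ℝ} (hu : 0 < u)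
    (n : ℕ) :
    ∫ ω, Real.exp (-u * ∫ r in Ioc (0 : ℝ) n, Real.exp (-r) ∂(pathMeasure fun t => X t ω)) ∂P =
      Real.exp (-(Φ u - Φ (u * Real.exp (-n)))) := by
  have h1 : Tendsto (fun N => ∫ ω, Real.exp (-u * expSum n N fun t => X t ω) ∂P) atTop
      (𝓝 (∫ ω, Real.exp
        (-u * ∫ r in Ioc (0 : ℝ) n, Real.exp (-r) ∂(pathMeasure fun t => X t ω)) ∂P)) := by
    refine tendsto_integral_of_dominated_convergence (fun _ => (1 : ℝ)) (fun N => ?_)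
      (integrable_const _) (fun N => ?_) ?_
    · have := hX.measurable_expSum n N
      exact (by fun_prop : Measurable fun ω =>
        Real.exp (-u * expSum n N fun t => X t ω)).aestronglyMeasurable
    · filter_upwards [hX.mono] with ω hω
      rw [Real.norm_eq_abs, abs_of_pos (Real.exp_pos _), Real.exp_le_one_iff]
      have : 0 ≤ expSum n N fun t => X t ω := Finset.sum_nonneg fun k _ =>
        mul_nonneg (Real.exp_pos _).le (sub_nonneg.2 (hω (grid_mono N k.le_succ)))
      nlinarith
    · filter_upwards [hX.ae_tendsto_expSum n] with ω hω
      exact (Real.continuous_exp.tendsto _).comp (hω.const_mul (-u))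
  simp only [hX.integral_exp_neg_expSum hX1 hu.le] at h1
  exact tendsto_nhds_unique h1 ((Real.continuous_exp.tendsto _).comp
    (tendsto_sum_grid hX1.monotoneOn_laplaceExponent hΦ hu n).neg)

theorem IsSubordinator.ae_tendsto_integral_Ioc (hX : IsSubordinator X P) :
    ∀ᵐ ω ∂P, Tendsto (fun n : ℕ => ENNReal.ofReal
      (∫ r in Ioc (0 : ℝ) n, Real.exp (-r) ∂(pathMeasure fun t => X t ω))) atTop
      (𝓝 (∫⁻ r in Ioi (0 : ℝ), ENNReal.ofReal (Real.exp (-r)) ∂(pathMeasure fun t => X t ω))) := by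
  filter_upwards [hX.mono, hX.right_continuous] with ω h1 h2
  exact tendsto_integral_Ioc_exp_neg h1 h2

/-- The exponential integral converges almost surely as soon as the Laplace exponents of the
integrals over `(0, n]` are bounded by a function that vanishes at `0`. -/
theorem IsSubordinator.ae_integrableOn_exp_neg [IsProbabilityMeasure P]
    (hX : IsSubordinator X P)
    (hX1 : IsProbOnNonneg (P.map (X 1))) {Φ κ : ℝ → ℝ}
    (hΦ : ∀ v, 0 < v → HasDerivAt Φ (laplaceExponent (P.map (X 1)) v / v) v)
    (hκ : ∀ u, 0 < u → ∀ n : ℕ, Φ u - Φ (u * Real.exp (-n)) ≤ κ u)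
    (hκ0 : Tendsto κ (𝓝[>] 0) (𝓝 0)) :
    ∀ᵐ ω ∂P, IntegrableOn (fun t : ℝ => Real.exp (-t)) (Ioi 0) (pathMeasure fun t => X t ω) := by
  have h := ae_ne_top_of_le_integral_exp (P := P) (κ := κ) hX.aemeasurable_integral_Ioc
    (fun n => Eventually.of_forall fun ω => integral_nonneg fun r => (Real.exp_pos _).le)
    hX.ae_tendsto_integral_Ioc (fun u hu n => by
      rw [hX.integral_exp_neg_integral_Ioc hX1 hΦ hu]
      exact Real.exp_le_exp.2 (neg_le_neg (hκ u hu n))) hκ0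
  filter_upwards [h] with ω hω
  refine ⟨by fun_prop, ?_⟩
  rw [hasFiniteIntegral_iff_ofReal (Eventually.of_forall fun r => (Real.exp_pos _).le)]
  exact hω.lt_top

theorem IsSubordinator.ae_tendsto_integral_Ioi (hX : IsSubordinator X P)
    (hi : ∀ᵐ ω ∂P, IntegrableOn (fun t : ℝ => Real.exp (-t)) (Ioi 0)
      (pathMeasure fun t => X t ω)) :
    ∀ᵐ ω ∂P, Tendsto (fun n : ℕ =>
      ∫ r in Ioc (0 : ℝ) n, Real.exp (-r) ∂(pathMeasure fun t => X t ω)) atTop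
      (𝓝 (∫ r in Ioi (0 : ℝ), Real.exp (-r) ∂(pathMeasure fun t => X t ω))) := by
  filter_upwards [hi, hX.ae_tendsto_integral_Ioc] with ω h1 h2
  have hpos : ∀ ρ : Measure ℝ, 0 ≤ᵐ[ρ] fun r => Real.exp (-r) := fun ρ =>
    Eventually.of_forall fun r => (Real.exp_pos _).le
  rw [integral_eq_lintegral_of_nonneg_ae (hpos _) h1.1]
  refine ((ENNReal.tendsto_toReal ?_).comp h2).congr fun n => ?_
  · exact ((hasFiniteIntegral_iff_ofReal (hpos _)).1 h1.2).ne
  · exact ENNReal.toReal_ofReal (integral_nonneg fun r => (Real.exp_pos _).le)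

theorem IsSubordinator.aemeasurable_integral_Ioi (hX : IsSubordinator X P)
    (hi : ∀ᵐ ω ∂P, IntegrableOn (fun t : ℝ => Real.exp (-t)) (Ioi 0)
      (pathMeasure fun t => X t ω)) :
    AEMeasurable (fun ω => ∫ r in Ioi (0 : ℝ), Real.exp (-r) ∂(pathMeasure fun t => X t ω)) P :=
  aemeasurable_of_tendsto_metrizable_ae atTop hX.aemeasurable_integral_Ioc
    (hX.ae_tendsto_integral_Ioi hi)

theorem IsSubordinator.tendsto_exp_neg_integral_Ioi [IsProbabilityMeasure P]
    (hX : IsSubordinator X P)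
    (hX1 : IsProbOnNonneg (P.map (X 1))) {Φ : ℝ → ℝ}
    (hΦ : ∀ v, 0 < v → HasDerivAt Φ (laplaceExponent (P.map (X 1)) v / v) v)
    (hi : ∀ᵐ ω ∂P, IntegrableOn (fun t : ℝ => Real.exp (-t)) (Ioi 0)
      (pathMeasure fun t => X t ω)) {u : ℝ} (hu : 0 < u) :
    Tendsto (fun n : ℕ => Real.exp (-(Φ u - Φ (u * Real.exp (-n))))) atTop
      (𝓝 (∫ ω, Real.exp
        (-u * ∫ r in Ioi (0 : ℝ), Real.exp (-r) ∂(pathMeasure fun t => X t ω)) ∂P)) := by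
  simp only [← hX.integral_exp_neg_integral_Ioc hX1 hΦ hu]
  refine tendsto_integral_of_dominated_convergence (fun _ => (1 : ℝ)) (fun n => ?_)
    (integrable_const _) (fun n => Eventually.of_forall fun ω => ?_) ?_
  · exact (Real.measurable_exp.comp_aemeasurable
      ((hX.aemeasurable_integral_Ioc n).const_mul (-u))).aestronglyMeasurable
  · rw [Real.norm_eq_abs, abs_of_pos (Real.exp_pos _), Real.exp_le_one_iff]
    have : 0 ≤ ∫ r in Ioc (0 : ℝ) n, Real.exp (-r) ∂(pathMeasure fun t => X t ω) :=
      integral_nonneg fun r => (Real.exp_pos _).le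
    nlinarith
  · filter_upwards [hX.ae_tendsto_integral_Ioi hi] with ω hω
    exact (Real.continuous_exp.tendsto _).comp (hω.const_mul (-u))

end ExpIntegral

/-! ### Subordinators with a given Laplace exponent and the logarithmic moment -/

/-- Every Bernstein function with a Lévy density is the Laplace exponent of a subordinator. -/
theorem HasBernsteinRep.exists_isSubordinator {f m : ℝ → ℝ} {a : ℝ} (h : HasBernsteinRep f a m) :
    ∃ (Ω : Type) (_ : MeasurableSpace Ω) (P : Measure Ω) (X : ℝ≥0 → Ω → ℝ),
      IsProbabilityMeasure P ∧ IsSubordinator X P ∧ IsProbOnNonneg (P.map (X 1)) ∧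
      ∀ u, 0 < u → laplaceExponent (P.map (X 1)) u = f u := by
  let η : Measure ℝ := (volume.restrict (Ioi 0)).withDensity fun t => ENNReal.ofReal (m t)
  have hm : AEMeasurable (fun t => ENNReal.ofReal (m t)) (volume.restrict (Ioi 0)) :=
    h.aestronglyMeasurable.aemeasurable.ennreal_ofReal
  have hlt : ∀ᵐ t ∂(volume.restrict (Ioi (0 : ℝ))), ENNReal.ofReal (m t) < ⊤ :=
    Eventually.of_forall fun t => ENNReal.ofReal_lt_top
  have hη : Integrable (fun x => min 1 (max x 0)) η := by
    rw [integrable_withDensity_iff_integrable_smul₀' hm hlt]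
    refine h.integrable.congr_fun (fun t ht => ?_) measurableSet_Ioi
    have ht0 : 0 < t := ht
    simp only
    rw [ENNReal.toReal_ofReal (h.density_nonneg t ht0), max_eq_left ht0.le, smul_eq_mul, mul_comm]
  obtain ⟨Ω, _, P, X, hP, hX, hpos, hL⟩ := _root_.exists_isSubordinator hη h.drift_nonneg
  have hX1 : IsProbOnNonneg (P.map (X 1)) := by
    refine ⟨Measure.isProbabilityMeasure_map (hX.measurable 1).aemeasurable, ?_⟩
    rw [Measure.map_apply (hX.measurable 1) measurableSet_Iio]
    convert! measure_empty (μ := P)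
    ext ω
    simpa using hpos 1 ω
  refine ⟨Ω, _, P, X, hP, hX, hX1, fun u hu => ?_⟩
  have h1 := hL u hu.le
  rw [hX.integral_exp_neg_one hX1 hu.le, Real.exp_eq_exp, neg_inj] at h1
  rw [h1, h.eq u hu, integral_withDensity_eq_integral_toReal_smul₀ hm hlt]
  congr 1
  refine setIntegral_congr_fun measurableSet_Ioi fun t ht => ?_
  have ht0 : 0 < t := ht
  rw [ENNReal.toReal_ofReal (h.density_nonneg t ht0), max_eq_left ht0.le, smul_eq_mul, neg_mul,
    mul_comm]

/-- After the substitution `s = vx` the right-hand side is `∫_0^x (1 - e^{-s})/s ds`, whose integrand is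
at least `(1 - e^{-1})/s` for `s > 1`. -/
theorem ofReal_posLog_le {x : ℝ} (hx : 0 ≤ x) :
    ENNReal.ofReal ((1 - Real.exp (-1)) * Real.posLog x) ≤
      ∫⁻ v in Ioo 0 1, ENNReal.ofReal ((1 - Real.exp (-v * x)) / v) := by
  rcases le_or_gt x 1 with h1 | h1
  · rw [Real.posLog_eq_zero_iff x |>.2 (by rwa [abs_of_nonneg hx])]
    simp
  have hx0 : 0 < x := by linarith
  have hexp : Real.exp (-1) < 1 := by simp
  rw [lintegral_one_sub_exp_div_comm one_pos hx0]
  have hi : IntegrableOn (fun s : ℝ => (1 - Real.exp (-1)) * s⁻¹) (Ioc 1 x) := by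
    refine (ContinuousOn.integrableOn_Icc ?_).mono_set Ioc_subset_Icc_self
    exact continuousOn_const.mul (continuousOn_inv₀.mono fun s hs => by
      have : 1 ≤ s := hs.1
      simp; linarith)
  have h2 : ENNReal.ofReal ((1 - Real.exp (-1)) * Real.posLog x) =
      ∫⁻ s in Ioc 1 x, ENNReal.ofReal ((1 - Real.exp (-1)) * s⁻¹) := by
    rw [← ofReal_integral_eq_lintegral_ofReal hi, integral_const_mul,
      ← intervalIntegral.integral_of_le h1.le, integral_inv_of_pos one_pos hx0, div_one,
      Real.posLog_eq_log (by rw [abs_of_nonneg hx]; exact h1.le)]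
    filter_upwards [ae_restrict_mem measurableSet_Ioc] with s hs
    have : 0 < s := by linarith [hs.1]
    exact mul_nonneg (by linarith) (by positivity)
  rw [h2, ← restrict_Ioo_eq_restrict_Ioc]
  refine (setLIntegral_mono' measurableSet_Ioo fun s hs => ?_).trans
    (lintegral_mono_set (Ioo_subset_Ioo_left zero_le_one))
  have hs0 : 0 < s := by linarith [hs.1]
  rw [← div_eq_mul_inv]
  refine ENNReal.ofReal_le_ofReal (div_le_div_of_nonneg_right ?_ hs0.le)
  have := Real.exp_le_exp.2 (show -1 * s ≤ -1 by linarith [hs.1])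
  linarith

/-- The logarithmic moment of `ν` is finite if `φ(v) / v` is integrable at `0`, where `φ` is the
Laplace exponent of `ν`. -/
theorem IsProbOnNonneg.integrable_posLog {ν : Measure ℝ} (hν : IsProbOnNonneg ν)
    (h : ∫⁻ v in Ioo 0 1, ENNReal.ofReal (laplaceExponent ν v / v) ≠ ⊤) :
    Integrable Real.posLog ν := by
  have := hν.isProbabilityMeasure
  have hexp : Real.exp (-1) < 1 := by simp
  have hmeas : Measurable (Real.posLog : ℝ → ℝ) := by
    unfold Real.posLog
    fun_prop
  have hc : (1 - Real.exp (-1)) ≠ 0 := by linarith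
  rw [← integrable_const_mul_iff hc.isUnit]
  refine ⟨(hmeas.const_mul _).aestronglyMeasurable, ?_⟩
  rw [hasFiniteIntegral_iff_ofReal (Eventually.of_forall fun x =>
    mul_nonneg (by linarith) Real.posLog_nonneg)]
  calc ∫⁻ x, ENNReal.ofReal ((1 - Real.exp (-1)) * Real.posLog x) ∂ν
      ≤ ∫⁻ x, (∫⁻ v in Ioo 0 1, ENNReal.ofReal ((1 - Real.exp (-v * x)) / v)) ∂ν := by
        refine lintegral_mono_ae ?_
        filter_upwards [hν.ae_nonneg] with x hx using ofReal_posLog_le hx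
    _ = ∫⁻ v in Ioo 0 1, ∫⁻ x, ENNReal.ofReal ((1 - Real.exp (-v * x)) / v) ∂ν :=
        lintegral_lintegral_swap (by fun_prop)
    _ ≤ ∫⁻ v in Ioo 0 1, ENNReal.ofReal (laplaceExponent ν v / v) := by
        refine setLIntegral_mono' measurableSet_Ioo fun v hv => ?_
        have hi := hν.integrable_exp hv.1.le
        have hi1 : Integrable (fun x => (1 - Real.exp (-v * x)) / v) ν :=
          ((integrable_const 1).sub hi).div_const v
        rw [← ofReal_integral_eq_lintegral_ofReal hi1]
        · refine ENNReal.ofReal_le_ofReal ?_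
          rw [integral_div]
          refine div_le_div_of_nonneg_right ?_ hv.1.le
          rw [integral_sub (integrable_const 1) hi, ← hν.exp_neg_laplaceExponent hv.1.le]
          have := Real.add_one_le_exp (-laplaceExponent ν v)
          simp
          linarith
        · filter_upwards [hν.ae_nonneg] with x hx
          have : Real.exp (-v * x) ≤ 1 := Real.exp_le_one_iff.2 (by nlinarith [hv.1])
          exact div_nonneg (by simpa using this) hv.1.le
    _ < ⊤ := h.lt_top

/-! ### Exponential integrals and the derivative of the Laplace exponent -/

/-- If `μ` is the law of the exponential integral of `X`, then `u ψ'(u)` is the Laplace exponent of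
`X 1`, where `ψ` is the Laplace exponent of `μ`. -/
theorem IsLawOfExpIntegral.mul_deriv_laplaceExponent {Ω : Type*} [MeasurableSpace Ω]
    {P : Measure Ω} [IsProbabilityMeasure P] {X : ℝ≥0 → Ω → ℝ} {μ : Measure ℝ}
    (h : IsLawOfExpIntegral μ X P) (hμ : IsProbOnNonneg μ) (hX : IsSubordinator X P)
    (hX1 : IsProbOnNonneg (P.map (X 1))) {u : ℝ} (hu : 0 < u) :
    u * deriv (laplaceExponent μ) u = laplaceExponent (P.map (X 1)) u := by
  set φ := laplaceExponent (P.map (X 1))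
  set ψ := laplaceExponent μ
  have hcont : ContinuousOn (fun v => φ v / v) (Ioi 0) :=
    (hX1.continuousOn_laplaceExponent.mono Ioi_subset_Ici_self).div continuousOn_id
      fun v hv => ne_of_gt hv
  let Φ : ℝ → ℝ := fun u => ∫ v in (1 : ℝ)..u, φ v / v
  have hΦ : ∀ v, 0 < v → HasDerivAt Φ (φ v / v) v := by
    intro v hv
    refine intervalIntegral.integral_hasDerivAt_right ?_
      (hcont.stronglyMeasurableAtFilter isOpen_Ioi v hv) (hcont.continuousAt (Ioi_mem_nhds hv))
    refine (hcont.mono fun w hw => ?_).intervalIntegrable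
    exact (lt_min one_pos hv).trans_le hw.1
  have hmono : MonotoneOn Φ (Ioi 0) := by
    refine monotoneOn_of_deriv_nonneg (convex_Ioi 0)
      (fun v hv => (hΦ v hv).continuousAt.continuousWithinAt)
      (fun v hv => ?_) fun v hv => ?_
    · rw [interior_Ioi] at hv
      exact (hΦ v hv).differentiableAt.differentiableWithinAt
    · rw [interior_Ioi] at hv
      rw [(hΦ v hv).deriv]
      exact div_nonneg (hX1.laplaceExponent_nonneg (le_of_lt hv)) (le_of_lt hv)
  have hlim : ∀ u, 0 < u →
      Tendsto (fun n : ℕ => Φ (u * Real.exp (-n))) atTop (𝓝 (Φ u - ψ u)) := by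
    intro u hu
    have h1 := hX.tendsto_exp_neg_integral_Ioi hX1 hΦ h.1 hu
    have h2 : ∫ ω, Real.exp
        (-u * ∫ r in Ioi (0 : ℝ), Real.exp (-r) ∂(pathMeasure fun t => X t ω)) ∂P =
        Real.exp (-ψ u) := by
      rw [hμ.exp_neg_laplaceExponent hu.le, ← h.2.map_eq,
        integral_map h.2.aemeasurable (by fun_prop)]
    rw [h2] at h1
    have h3 := (Real.continuousAt_log (Real.exp_ne_zero _)).tendsto.comp h1
    simp only [Function.comp_def, Real.log_exp] at h3
    have h4 := h3.const_add (Φ u)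
    refine (h4.congr fun n => ?_)
    ring
  -- by monotonicity, the limit of `Φ` at `0` along `u e^{-n}` does not depend on `u`
  have hle : ∀ u v, 0 < u → 0 < v → Φ u - ψ u ≤ Φ v - ψ v := by
    intro u v hu hv
    obtain ⟨j, hj⟩ := exists_nat_ge (Real.log (u / v))
    have h1 : Tendsto (fun n : ℕ => Φ (u * Real.exp (-(n + j : ℕ)))) atTop (𝓝 (Φ u - ψ u)) :=
      (hlim u hu).comp (tendsto_add_atTop_nat j)
    refine le_of_tendsto_of_tendsto' h1 (hlim v hv) fun n => ?_
    refine hmono (mul_pos hu (Real.exp_pos _)) (mul_pos hv (Real.exp_pos _)) ?_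
    have h2 : u ≤ v * Real.exp j := by
      rw [mul_comm, ← div_le_iff₀ hv, ← Real.log_le_iff_le_exp (div_pos hu hv)]
      exact hj
    have h3 : Real.exp (-((n + j : ℕ) : ℝ)) = Real.exp (-(n : ℝ)) * Real.exp (-(j : ℝ)) := by
      rw [← Real.exp_add]
      push_cast
      ring_nf
    have h4 : Real.exp (j : ℝ) * Real.exp (-(j : ℝ)) = 1 := by
      rw [← Real.exp_add, add_neg_cancel, Real.exp_zero]
    have h5 := mul_le_mul_of_nonneg_right h2
      (mul_pos (Real.exp_pos (-(n : ℝ))) (Real.exp_pos (-(j : ℝ)))).le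
    rw [h3]
    calc _ ≤ _ := h5
      _ = v * Real.exp (-n) * (Real.exp j * Real.exp (-j)) := by ring
      _ = _ := by rw [h4, mul_one]
  have heq : ψ =ᶠ[𝓝 u] fun v => Φ v - (Φ u - ψ u) := by
    filter_upwards [Ioi_mem_nhds hu] with v hv
    have := le_antisymm (hle u v hu hv) (hle v u hv hu)
    linarith
  have hd := ((hΦ u hu).sub_const (Φ u - ψ u)).congr_of_eventuallyEq heq
  rw [hd.deriv, mul_div_cancel₀ _ hu.ne']

/-- A subordinator whose Laplace exponent is `u ψ'(u)` has a convergent exponential integral, whose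
Laplace exponent is `ψ`. -/
theorem IsSubordinator.isLawOfExpIntegral {Ω : Type*} [MeasurableSpace Ω]
    {P : Measure Ω} [IsProbabilityMeasure P] {X : ℝ≥0 → Ω → ℝ} (hX : IsSubordinator X P)
    {μ : Measure ℝ} (hμ : IsProbOnNonneg μ) (hX1 : IsProbOnNonneg (P.map (X 1)))
    (h : ∀ u, 0 < u → laplaceExponent (P.map (X 1)) u = u * deriv (laplaceExponent μ) u) :
    IsLawOfExpIntegral μ X P := by
  set ψ := laplaceExponent μ
  have hΦ : ∀ v, 0 < v → HasDerivAt ψ (laplaceExponent (P.map (X 1)) v / v) v := by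
    intro v hv
    rw [h v hv, mul_div_cancel_left₀ _ hv.ne']
    exact hμ.hasDerivAt_laplaceExponent hv
  have hi := hX.ae_integrableOn_exp_neg hX1 hΦ (κ := ψ)
    (fun u hu n => sub_le_self _ (hμ.laplaceExponent_nonneg (by positivity)))
    hμ.tendsto_laplaceExponent
  have hmeas := hX.aemeasurable_integral_Ioi hi
  refine ⟨hi, hmeas, ?_⟩
  set I : Ω → ℝ := fun ω => ∫ r in Ioi (0 : ℝ), Real.exp (-r) ∂(pathMeasure fun t => X t ω)
  have hI : IsProbOnNonneg (P.map I) := by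
    refine ⟨Measure.isProbabilityMeasure_map hmeas, ?_⟩
    rw [Measure.map_apply_of_aemeasurable hmeas measurableSet_Iio]
    convert! measure_empty (μ := P)
    ext ω
    simpa using (integral_nonneg fun r => (Real.exp_pos _).le : 0 ≤ I ω)
  refine hI.eq_of_laplaceExponent_eq hμ fun u hu => ?_
  have h1 := hX.tendsto_exp_neg_integral_Ioi hX1 hΦ hi hu
  -- as `ψ` vanishes at `0`, the exponents `ψ(u) - ψ(u e^{-n})` tend to `ψ(u)`
  have h2 : Tendsto (fun n : ℕ => u * Real.exp (-n)) atTop (𝓝[>] 0) := by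
    refine tendsto_nhdsWithin_iff.2 ⟨?_, Eventually.of_forall fun n => mul_pos hu (Real.exp_pos _)⟩
    have := (Real.tendsto_exp_neg_atTop_nhds_zero.comp tendsto_natCast_atTop_atTop).const_mul u
    simpa using this
  have h3 := (Real.continuous_exp.tendsto _).comp
    ((hμ.tendsto_laplaceExponent.comp h2).const_sub (ψ u)).neg
  have h4 := tendsto_nhds_unique h1 h3
  rw [sub_zero, ← integral_map (f := fun x => Real.exp (-u * x)) hmeas (by fun_prop),
    ← hI.exp_neg_laplaceExponent hu.le, Real.exp_eq_exp, neg_inj] at h4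
  exact h4

/-- If `u ψ'(u)` is the Laplace exponent of `ν`, then `ν` has a finite logarithmic moment, since
`∫_0^1 ψ'(v) dv = ψ(1)`. -/
theorem IsProbOnNonneg.integrable_posLog_of_mul_deriv {μ ν : Measure ℝ} (hμ : IsProbOnNonneg μ)
    (hν : IsProbOnNonneg ν)
    (h : ∀ u, 0 < u → laplaceExponent ν u = u * deriv (laplaceExponent μ) u) :
    Integrable Real.posLog ν := by
  refine hν.integrable_posLog ?_
  rw [setLIntegral_congr_fun measurableSet_Ioo fun v hv => by
    rw [h v hv.1, mul_div_cancel_left₀ _ hv.1.ne'], hμ.lintegral_deriv_laplaceExponent one_pos]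
  exact ENNReal.ofReal_ne_top

theorem corollary3p6 (μ : Measure ℝ) (hμ : IsProbOnNonneg μ) (hL : IsSelfdecomposable μ) :
    [ IsThorin μ,
      ∀ c ∈ Ioo (0 : ℝ) 1,
        IsCompleteBernstein (fun u => laplaceExponent μ u - laplaceExponent μ (c * u)),
      ∀ c : ℝ, 1 < c →
        IsCompleteBernstein (fun u => laplaceExponent μ (c * u) - laplaceExponent μ u),
      IsCompleteBernstein (fun u => u * deriv (laplaceExponent μ) u),
      ∃ (Ω : Type) (_ : MeasurableSpace Ω) (P : Measure Ω) (X : ℝ≥0 → Ω → ℝ),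
        IsProbabilityMeasure P ∧ IsSubordinator X P ∧
        Integrable (fun ω => Real.posLog (X 1 ω)) P ∧
        IsBondesson (P.map (X 1)) ∧
        IsLawOfExpIntegral μ X P ].TFAE := by
  tfae_have 1 → 2 := fun h c hc => h.isCompleteBernstein_sub hc
  tfae_have 2 → 1 := isThorin_of_isCompleteBernstein_sub hμ
  tfae_have 2 → 3 := fun h c hc => by
    have hc0 : 0 < c := by linarith
    refine ((h c⁻¹ ⟨by positivity, inv_lt_one_of_one_lt₀ hc⟩).comp_div
      (inv_pos.2 hc0)).congr fun u hu => ?_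
    simp only [div_inv_eq_mul]
    rw [mul_comm u c, inv_mul_cancel_left₀ hc0.ne']
  tfae_have 3 → 2 := fun h c hc => by
    refine ((h c⁻¹ ((one_lt_inv₀ hc.1).2 hc.2)).comp_div (inv_pos.2 hc.1)).congr fun u hu => ?_
    simp only [div_inv_eq_mul]
    rw [mul_comm u c, inv_mul_cancel_left₀ hc.1.ne']
  tfae_have 1 → 4 := IsThorin.isCompleteBernstein_mul_deriv
  tfae_have 4 → 1 := isThorin_of_isCompleteBernstein_mul_deriv hμ
  tfae_have 4 → 5 := fun h => by
    obtain ⟨a, m, hm, hr⟩ := h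
    obtain ⟨Ω, _, P, X, hP, hX, hX1, hφ⟩ := hr.exists_isSubordinator
    refine ⟨Ω, _, P, X, hP, hX, ?_, ⟨hX1, a, m, hm, hr.congr hφ fun _ _ => rfl⟩,
      hX.isLawOfExpIntegral hμ hX1 hφ⟩
    exact (hμ.integrable_posLog_of_mul_deriv hX1 hφ).comp_measurable (hX.measurable 1)
  tfae_have 5 → 4 := fun ⟨Ω, _, P, X, hP, hX, _, hB, hI⟩ =>
    hB.2.congr fun u hu => hI.mul_deriv_laplaceExponent hμ hX hB.1 hu
  tfae_finish
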